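/- **Theorem.** There is an algorithm that takes as input an instance of the bounded $m$-dimensional knapsack problem $$\max\{c^\top x : Ax\le b,\ 0\le x\le u,\ x\in\mathbb{Z}^n\},\qquad A\in\mathbb{Z}_{\ge 0}^{m\times n},\ b\in\mathbb{Z}_{\ge 0}^m,\ c,u\in\mathbb{Z}_{\ge 0}^n,\quad m\ge 1,$$ together with a rational $\varepsilon\in(0,1)$, and returns a feasible point $x$, together with its value $c^\top x$, such that $$c^\top x\ \ge\ (1-\varepsilon)\cdot \mathrm{OPT},$$ where $\mathrm{OPT}$ is the optimal value. If all minors of $A$ of order $\operatorname{rank}(A)$ are at most $\Delta$ in absolute value, then the algorithm uses $$O\bigl(T_{LP}\cdot(1/\varepsilon)^{m+3}\cdot(2m)^{2m+6}\cdot\Delta\bigr)$$ arithmetic operations (on a unit-cost random access machine over rational numbers with rounding down, comparisons and memory access by integer addresses). The constant in $O(\cdot)$ is absolute. The numbers computed by the algorithm have bit length bounded by a fixed polynomial in the bit length of the input. The algorithm has access to a linear programming solver that returns an optimal vertex of any feasible linear program $\max\{c'^\top x: A'x\le b',\ 0\le x\le u'\}$, and $T_{LP}\ge\max(1,n)$ is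 any bound for the cost of that solver on linear programs of this form with $m$ constraints, at most $n$ variables, and nonnegative integer data that do not exceed the largest number in $A,b,c,u$. -/

import Mathlib

/-! ### The bounded `m`-dimensional knapsack problem -/

/-- An instance of the bounded `m`-dimensional knapsack problem with `n` items:
maximize `c · x` subject to `A x ≤ b`, `0 ≤ x ≤ u`, `x` integral, with data in the
nonnegative integers. -/
structure Knapsack (m n : ℕ) where
  A : Matrix (Fin m) (Fin n) ℕ
  b : Fin m → ℕ
  c : Fin n → ℕ
  u : Fin n → ℕ

namespace Knapsack

variable {m n : ℕ}

/-- Feasible integer points. -/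
def Feasible (I : Knapsack m n) (x : Fin n → ℕ) : Prop :=
  (∀ i, ∑ j, I.A i j * x j ≤ I.b i) ∧ ∀ j, x j ≤ I.u j

/-- The objective value `c · x`. -/
def value (I : Knapsack m n) (x : Fin n → ℕ) : ℕ := ∑ j, I.c j * x j

/-- The rank of the constraint matrix (over the field of rationals). -/
noncomputable def rank (I : Knapsack m n) : ℕ := (I.A.map (fun a => (a : ℚ))).rank

/-- The instance is `Δ`-modular: every minor of order `rank A` of the constraint matrix is at
most `Δ` in absolute value. Reordering rows and columns only changes the sign of a minor, and a
repeated row or column gives a zero minor, so all maps `f`, `g` may be allowed. -/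
def IsModular (I : Knapsack m n) (D : ℕ) : Prop :=
  ∀ (f : Fin I.rank → Fin m) (g : Fin I.rank → Fin n),
    |((I.A.map (fun a => (a : ℤ))).submatrix f g).det| ≤ (D : ℤ)

/-- The largest number occurring in `A`, `b`, `c`, `u`. -/
def maxEntry (I : Knapsack m n) : ℕ :=
  max (max (Finset.univ.sup fun i => Finset.univ.sup fun j => I.A i j) (Finset.univ.sup I.b))
    (max (Finset.univ.sup I.c) (Finset.univ.sup I.u))

/-- The binary encoding length of the instance together with the accuracy `ε`. -/
def inputLength (I : Knapsack m n) (ε : ℚ) : ℕ :=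
  m + n + (∑ i, ∑ j, (I.A i j).size) + (∑ i, (I.b i).size) + (∑ j, (I.c j).size)
    + (∑ j, (I.u j).size) + ε.num.natAbs.size + ε.den.size

end Knapsack

/-! ### Linear programs and linear programming solvers -/

/-- The linear program: maximize `c · x` subject to `A x ≤ b`, `0 ≤ x ≤ u`. -/
structure LP (m n : ℕ) where
  A : Matrix (Fin m) (Fin n) ℚ
  b : Fin m → ℚ
  c : Fin n → ℚ
  u : Fin n → ℚ

namespace LP

variable {m n : ℕ}

/-- The feasible polytope. -/
def feasible (P : LP m n) : Set (Fin n → ℚ) :=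
  {x | (∀ i, ∑ j, P.A i j * x j ≤ P.b i) ∧ ∀ j, 0 ≤ x j ∧ x j ≤ P.u j}

/-- The objective function. -/
def value (P : LP m n) (x : Fin n → ℚ) : ℚ := ∑ j, P.c j * x j

/-- `x` is an optimal vertex (optimal basic solution) of the linear program. -/
def IsOptimalVertex (P : LP m n) (x : Fin n → ℚ) : Prop :=
  x ∈ P.feasible.extremePoints ℚ ∧ ∀ y ∈ P.feasible, P.value y ≤ P.value x

/-- All numbers of the linear program are nonnegative integers not exceeding `N`. -/
def EntriesLE (P : LP m n) (N : ℕ) : Prop :=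
  (∀ i j, ∃ k : ℕ, k ≤ N ∧ P.A i j = k) ∧ (∀ i, ∃ k : ℕ, k ≤ N ∧ P.b i = k) ∧
    (∀ j, ∃ k : ℕ, k ≤ N ∧ P.c j = k) ∧ (∀ j, ∃ k : ℕ, k ≤ N ∧ P.u j = k)

end LP

/-- A linear programming solver: it finds an optimal vertex of every feasible linear program of
the above form, at the cost of `cost P` arithmetic operations for the program `P`. -/
structure LPSolver where
  sol : ∀ {m n : ℕ}, LP m n → Fin n → ℚ
  cost : ∀ {m n : ℕ}, LP m n → ℕ
  correct : ∀ {m n : ℕ} (P : LP m n), P.feasible.Nonempty → P.IsOptimalVertex (sol P)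

/-! ### The machine model

A random access machine with finitely many registers and arrays in use by each program, all of
them holding rational numbers, and programmed in a small imperative language. One operation (an
arithmetic operation, rounding down, a comparison, a memory access, a jump) costs one unit. So
that unit cost is meaningful, the numbers computed by a run must fit into words of a prescribed
length `B`: a run that computes a longer number is not a legal run. -/

namespace RAM

/-- The content of the registers and of the arrays; array cells are addressed by integers. -/
structure State where
  reg : ℕ → ℚ
  arr : ℕ → ℤ → ℚ

/-- Arithmetic expressions. -/
inductive Expr : Type
  | const (k : ℕ)
  | reg (r : ℕ)
  /-- The cell of array `a` whose address is the integer part of the value of `e`. -/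
  | read (a : ℕ) (e : Expr)
  | add (e₁ e₂ : Expr)
  | sub (e₁ e₂ : Expr)
  | mul (e₁ e₂ : Expr)
  | div (e₁ e₂ : Expr)
  | floor (e : Expr)

/-- The value of an expression. -/
def Expr.eval (σ : State) : Expr → ℚ
  | .const k => k
  | .reg r => σ.reg r
  | .read a e => σ.arr a ⌊e.eval σ⌋
  | .add e₁ e₂ => e₁.eval σ + e₂.eval σ
  | .sub e₁ e₂ => e₁.eval σ - e₂.eval σ
  | .mul e₁ e₂ => e₁.eval σ * e₂.eval σ
  | .div e₁ e₂ => e₁.eval σ / e₂.eval σ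
  | .floor e => (⌊e.eval σ⌋ : ℤ)

/-- The cost of evaluating an expression: one unit for each node. -/
def Expr.cost : Expr → ℕ
  | .const _ => 1
  | .reg _ => 1
  | .read _ e => e.cost + 1
  | .add e₁ e₂ => e₁.cost + e₂.cost + 1
  | .sub e₁ e₂ => e₁.cost + e₂.cost + 1
  | .mul e₁ e₂ => e₁.cost + e₂.cost + 1
  | .div e₁ e₂ => e₁.cost + e₂.cost + 1
  | .floor e => e.cost + 1

/-- Numerator and denominator of `q` have at most `B` bits. -/
def Fits (B : ℕ) (q : ℚ) : Prop := q.num.natAbs.size ≤ B ∧ q.den.size ≤ B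

/-- The expression can be evaluated with words of length `B`: all arithmetic results fit and no
division by zero occurs. -/
def Expr.Ok (B : ℕ) (σ : State) : Expr → Prop
  | .const k => Fits B k
  | .reg _ => True
  | .read _ e => e.Ok B σ
  | .add e₁ e₂ => e₁.Ok B σ ∧ e₂.Ok B σ ∧ Fits B (e₁.eval σ + e₂.eval σ)
  | .sub e₁ e₂ => e₁.Ok B σ ∧ e₂.Ok B σ ∧ Fits B (e₁.eval σ - e₂.eval σ)
  | .mul e₁ e₂ => e₁.Ok B σ ∧ e₂.Ok B σ ∧ Fits B (e₁.eval σ * e₂.eval σ)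
  | .div e₁ e₂ => e₁.Ok B σ ∧ e₂.Ok B σ ∧ e₂.eval σ ≠ 0 ∧ Fits B (e₁.eval σ / e₂.eval σ)
  | .floor e => e.Ok B σ ∧ Fits B (⌊e.eval σ⌋ : ℤ)

/-- Comparisons. -/
inductive Test : Type
  | le (e₁ e₂ : Expr)
  | lt (e₁ e₂ : Expr)
  | eq (e₁ e₂ : Expr)

/-- The truth value of a comparison. -/
def Test.Holds (σ : State) : Test → Prop
  | .le e₁ e₂ => e₁.eval σ ≤ e₂.eval σ
  | .lt e₁ e₂ => e₁.eval σ < e₂.eval σ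
  | .eq e₁ e₂ => e₁.eval σ = e₂.eval σ

/-- The cost of a comparison. -/
def Test.cost : Test → ℕ
  | .le e₁ e₂ => e₁.cost + e₂.cost + 1
  | .lt e₁ e₂ => e₁.cost + e₂.cost + 1
  | .eq e₁ e₂ => e₁.cost + e₂.cost + 1

/-- Both sides of a comparison can be evaluated with words of length `B`. -/
def Test.Ok (B : ℕ) (σ : State) : Test → Prop
  | .le e₁ e₂ => e₁.Ok B σ ∧ e₂.Ok B σ
  | .lt e₁ e₂ => e₁.Ok B σ ∧ e₂.Ok B σ
  | .eq e₁ e₂ => e₁.Ok B σ ∧ e₂.Ok B σ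

/-- Programs. -/
inductive Prog : Type
  | skip
  /-- Assign the value of `e` to register `r`. -/
  | assign (r : ℕ) (e : Expr)
  /-- Write the value of `e` into array `a` at the address given by the integer part of `i`. -/
  | write (a : ℕ) (i e : Expr)
  | seq (p q : Prog)
  | ite (t : Test) (p q : Prog)
  | while (t : Test) (p : Prog)
  /-- Solve a linear program. Its numbers of constraints and of variables are taken from the
  registers `rm`, `rn`, its data from the arrays `aA`, `ab`, `ac`, `au` (the matrix row by row);
  the solution is written to the array `ax`. -/
  | solveLP (rm rn aA ab ac au ax : ℕ)

/-- Change the content of a register. -/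
def State.setReg (σ : State) (r : ℕ) (q : ℚ) : State :=
  { σ with reg := Function.update σ.reg r q }

/-- Change the content of an array cell. -/
def State.setCell (σ : State) (a : ℕ) (z : ℤ) (q : ℚ) : State :=
  { σ with arr := Function.update σ.arr a (Function.update (σ.arr a) z q) }

/-- Write the vector `v` into the cells `0, …, n - 1` of array `a`. -/
def State.setVec (σ : State) (a : ℕ) {n : ℕ} (v : Fin n → ℚ) : State :=
  { σ with arr := Function.update σ.arr a fun z =>
      if h : 0 ≤ z ∧ z.toNat < n then v ⟨z.toNat, h.2⟩ else σ.arr a z }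

/-- The linear program with `m` constraints and `n` variables stored in the arrays
`aA`, `ab`, `ac`, `au`. -/
def State.getLP (σ : State) (m n aA ab ac au : ℕ) : LP m n where
  A := fun i j => σ.arr aA ((i : ℤ) * n + j)
  b := fun i => σ.arr ab (i : ℤ)
  c := fun j => σ.arr ac (j : ℤ)
  u := fun j => σ.arr au (j : ℤ)

/-- `Exec S B p σ σ' t`: with the linear programming solver `S` and words of length `B`, the
program `p` started in the state `σ` halts in the state `σ'` after `t` units of cost. A call of
the solver costs what the solver says, plus one. The solution that it writes is a vertex of the
polytope, so that its encoding length is polynomial in that of the linear program anyway. -/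
inductive Exec (S : LPSolver) (B : ℕ) : Prog → State → State → ℕ → Prop
  | skip (σ : State) : Exec S B .skip σ σ 1
  | assign (r : ℕ) (e : Expr) (σ : State) (h : e.Ok B σ) :
      Exec S B (.assign r e) σ (σ.setReg r (e.eval σ)) (e.cost + 1)
  | write (a : ℕ) (i e : Expr) (σ : State) (hi : i.Ok B σ) (he : e.Ok B σ) :
      Exec S B (.write a i e) σ (σ.setCell a ⌊i.eval σ⌋ (e.eval σ)) (i.cost + e.cost + 1)
  | seq {p q : Prog} {σ₁ σ₂ σ₃ : State} {t₁ t₂ : ℕ} (hp : Exec S B p σ₁ σ₂ t₁)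
      (hq : Exec S B q σ₂ σ₃ t₂) : Exec S B (.seq p q) σ₁ σ₃ (t₁ + t₂)
  | iteTrue {b : Test} {p q : Prog} {σ₁ σ₂ : State} {t : ℕ} (hOk : b.Ok B σ₁)
      (hb : b.Holds σ₁) (hp : Exec S B p σ₁ σ₂ t) : Exec S B (.ite b p q) σ₁ σ₂ (b.cost + t)
  | iteFalse {b : Test} {p q : Prog} {σ₁ σ₂ : State} {t : ℕ} (hOk : b.Ok B σ₁)
      (hb : ¬ b.Holds σ₁) (hq : Exec S B q σ₁ σ₂ t) : Exec S B (.ite b p q) σ₁ σ₂ (b.cost + t)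
  | whileTrue {b : Test} {p : Prog} {σ₁ σ₂ σ₃ : State} {t₁ t₂ : ℕ} (hOk : b.Ok B σ₁)
      (hb : b.Holds σ₁) (hp : Exec S B p σ₁ σ₂ t₁) (hw : Exec S B (.while b p) σ₂ σ₃ t₂) :
      Exec S B (.while b p) σ₁ σ₃ (b.cost + t₁ + t₂)
  | whileFalse {b : Test} {p : Prog} {σ : State} (hOk : b.Ok B σ) (hb : ¬ b.Holds σ) :
      Exec S B (.while b p) σ σ b.cost
  | solveLP (rm rn aA ab ac au ax : ℕ) (σ : State) (m n : ℕ) (hm : σ.reg rm = m)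
      (hn : σ.reg rn = n) :
      Exec S B (.solveLP rm rn aA ab ac au ax) σ
        (σ.setVec ax (S.sol (σ.getLP m n aA ab ac au)))
        (S.cost (σ.getLP m n aA ab ac au) + 1)

/-- The empty memory. -/
def State.zero : State := ⟨fun _ => 0, fun _ _ => 0⟩

/-- The initial state for a knapsack instance `I` and an accuracy `ε`: the registers `0`, `1`, `2`
hold `m`, `n`, `ε`; the arrays `0`, `1`, `2`, `3` hold `A` (row by row), `b`, `c`, `u`; everything
else is zero. -/
def State.init {m n : ℕ} (I : Knapsack m n) (ε : ℚ) : State :=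
  ((((((State.zero.setReg 0 m).setReg 1 n).setReg 2 ε).setVec 0
    (fun k : Fin (m * n) => (I.A (finProdFinEquiv.symm k).1 (finProdFinEquiv.symm k).2 : ℚ))).setVec
    1 (fun i => (I.b i : ℚ))).setVec 2 (fun j => (I.c j : ℚ))).setVec 3 (fun j => (I.u j : ℚ))

/-- The state `σ` presents the output `x` (in array `4`) and its objective value (in
register `0`). -/
def State.Outputs {m n : ℕ} (I : Knapsack m n) (σ : State) (x : Fin n → ℕ) : Prop :=
  (∀ j : Fin n, σ.arr 4 (j : ℤ) = x j) ∧ σ.reg 0 = I.value x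

end RAM

/-! ### Lattice points and the number of packings -/

/-! The optimum is first approximated within a factor `m + 1`. A vertex of the relaxation has at
most `m` coordinates strictly between their bounds (`LP.card_strict_le`), so rounding it down loses
at most `m` times the largest profit of an item. Discard the items that do not fit even alone, and
let `G` be the larger of the profit of the rounded vertex and the largest profit of a single item.
Then `G ≤ OPT ≤ (m + 1) G` (`guess_of_lp`).

Call an item light if its profit is at most `θ = ⌊ε G / m⌋`, and heavy otherwise. A heavy item
brings more than `ε G / m`, so a solution contains at most `K = ⌊m (m + 1) / ε⌋` copies of heavy
items (`Guess.sum_le`). Once the load of the heavy part of an optimal solution is fixed, its light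
part may be replaced by a rounded vertex of the relaxation with the remaining capacities, at a loss
of at most `m θ ≤ ε G ≤ ε OPT` (`profit_le_total`, `Guess.approx`). Hence it suffices to know, for
every load that heavy items can produce, a most profitable selection with this load. A dynamic
program over a list of at most `n K` copies of heavy items finds these, and one linear program per
load completes them.

The point is that there are few loads. Choose rows that span the row space, and as many columns such
that the resulting minor is largest in absolute value. By Cramer's rule, all columns of `A`,
restricted to these rows, have coordinates in `[-1, 1]` with respect to the chosen ones. A sum of at
most `K` columns then has coordinates in `[-K, K]`. Such an integer point is determined by its
rounded coordinates and its class modulo a lattice of index `|det|`, which leaves at most `(2 K + 1)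
^ rank * Δ` points (`card_le_of_abs_cramer_le`, `card_image_le`). With `X = (2 K + 1) ^ m * Δ` the
cost is `O(T_LP · X · m · K)`, and the bound on `K` gives the claim.

On the machine a load is a single number, written in a radix that exceeds all capacities, and this
number serves as an address. Unused cells are zero, so the table needs no initialization although
its address range is huge, and the numbers have quadratically many bits. Programs are verified by a
logic of runs with bounded cost (`Run`), in which `Run.forTo` treats all loops. -/

open Matrix in
/-- The number of integer points of the parallelepiped `B [-k, k]^r` is at most
`(2 k + 1) ^ r * |det B|`. -/
theorem card_le_of_abs_cramer_le {r : ℕ} (B : Matrix (Fin r) (Fin r) ℤ) (hB : B.det ≠ 0) (k : ℕ)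
    (Y : Finset (Fin r → ℤ)) (hY : ∀ y ∈ Y, ∀ i, |B.cramer y i| ≤ k * |B.det|) :
    Y.card ≤ (2 * k + 1) ^ r * B.det.natAbs := by
  have hpos : 0 < |B.det| := abs_pos.mpr hB
  -- `B.cramer y` is `det B` times the coordinate vector of `y` in the basis of columns, so it
  -- replaces the inverse matrix without leaving the integers.
  have hcr : ∀ w, B.cramer (B *ᵥ w) = B.det • w := by
    intro w
    rw [cramer_eq_adjugate_mulVec, mulVec_mulVec, adjugate_mul, smul_mulVec, one_mulVec]
  have hinj : Function.Injective (Matrix.toLin' B) := by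
    intro w w' h
    have h2 := congrArg B.cramer h
    simp only [toLin'_apply, hcr] at h2
    exact smul_right_injective _ hB h2
  let N := LinearMap.range (Matrix.toLin' B)
  let e : (Fin r → ℤ) ≃ₗ[ℤ] N := LinearEquiv.ofInjective _ hinj
  have hQ : Nat.card ((Fin r → ℤ) ⧸ N) = B.det.natAbs := by
    rw [← Submodule.natAbs_det_equiv N e]
    have : (N.subtype ∘ₗ AddMonoidHom.toIntLinearMap (e : (Fin r → ℤ) →+ N)) = Matrix.toLin' B := by
      ext1 i
      rfl
    rw [this, LinearMap.det_toLin']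
  have : Finite ((Fin r → ℤ) ⧸ N) :=
    Nat.finite_of_card_ne_zero (by rw [hQ]; exact Int.natAbs_ne_zero.mpr hB)
  have hmem : ∀ y ∈ Y, ∀ i, B.cramer y i / |B.det| ∈ Finset.Icc (-(k : ℤ)) k := by
    intro y hy i
    have h := abs_le.mp (hY y hy i)
    rw [Finset.mem_Icc]
    constructor
    · rw [Int.le_ediv_iff_mul_le hpos]; linarith
    · have := Int.ediv_le_ediv hpos h.2
      rwa [Int.mul_ediv_cancel _ hpos.ne'] at this
  -- A point is recorded by its rounded coordinates, with `2 k + 1` values each, and by its class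
  -- modulo the lattice of the columns, whose index is `|det B|`.
  let f : Y → (Fin r → Finset.Icc (-(k : ℤ)) k) × ((Fin r → ℤ) ⧸ N) := fun y =>
    (fun i => ⟨_, hmem y y.2 i⟩, Submodule.Quotient.mk (y : Fin r → ℤ))
  have hf : Function.Injective f := by
    rintro ⟨y, hy⟩ ⟨y', hy'⟩ h
    simp only [f, Prod.mk.injEq] at h
    obtain ⟨h1, h2⟩ := h
    rw [Submodule.Quotient.eq] at h2
    obtain ⟨w, hw⟩ := h2
    rw [toLin'_apply] at hw
    have h3 := hcr w
    rw [hw, map_sub] at h3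
    have hw0 : w = 0 := by
      ext i
      have h4 : B.cramer y i - B.cramer y' i = B.det * w i := by
        simpa using congrFun h3 i
      have h5 : B.cramer y i / |B.det| = B.cramer y' i / |B.det| := by
        simpa using congrFun h1 i
      have e1 := Int.emod_add_mul_ediv (B.cramer y i) |B.det|
      have e2 := Int.emod_add_mul_ediv (B.cramer y' i) |B.det|
      have l1 := Int.emod_nonneg (B.cramer y i) hpos.ne'
      have l2 := Int.emod_nonneg (B.cramer y' i) hpos.ne'
      have u1 := Int.emod_lt_of_pos (B.cramer y i) hpos
      have u2 := Int.emod_lt_of_pos (B.cramer y' i) hpos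
      rw [h5] at e1
      -- Two integers with the same quotient by `|det B|` differ by less than `|det B|`, but here
      -- the difference is a multiple of it.
      have : |B.det * w i| < |B.det| := by
        rw [← h4, abs_lt]; constructor <;> linarith
      rw [abs_mul] at this
      have h6 : |w i| < 1 := by
        by_contra hc
        push Not at hc
        nlinarith
      simpa using Int.abs_lt_one_iff.mp h6
    rw [hw0, mulVec_zero] at hw
    exact Subtype.ext (sub_eq_zero.mp hw.symm)
  have h := Nat.card_le_card_of_injective f hf
  rw [Nat.card_prod, hQ] at h
  simp only [Nat.card_eq_fintype_card, Fintype.card_coe, Fintype.card_pi, Finset.prod_const,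
    Finset.card_univ, Fintype.card_fin, Int.card_Icc] at h
  have h7 : ((k : ℤ) + 1 - -(k : ℤ)).toNat = 2 * k + 1 := by omega
  rwa [h7] at h

namespace Knapsack

variable {m n : ℕ}

/-- Rows `f` of the constraint matrix that span its row space. -/
theorem exists_rows (I : Knapsack m n) : ∃ f : Fin I.rank → Fin m,
    LinearIndependent ℚ (fun i => (I.A.map (fun a => (a : ℚ))).row (f i)) ∧
    ∀ i, (I.A.map (fun a => (a : ℚ))).row i ∈ Submodule.span ℚ
      (Set.range fun i => (I.A.map (fun a => (a : ℚ))).row (f i)) := by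
  set M := I.A.map (fun a => (a : ℚ)) with hM
  have hr : I.rank = Module.finrank ℚ (Submodule.span ℚ (Set.range M.row)) := by
    rw [rank, Matrix.rank_eq_finrank_span_row]
  rw [hr]
  obtain ⟨g, hg, hs, hl⟩ := Submodule.exists_fun_fin_finrank_span_eq ℚ (Set.range M.row)
  choose f hf using hg
  refine ⟨f, ?_, ?_⟩
  · simpa only [hf] using hl
  · intro i
    simp only [hf]
    rw [hs]
    exact Submodule.subset_span ⟨i, rfl⟩

/-- Independent rows form a matrix of full rank, and by equality of row and column rank its columns
contain a basis of the same size. -/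
theorem exists_minor_ne_zero (I : Knapsack m n) (f : Fin I.rank → Fin m)
    (hf : LinearIndependent ℚ (fun i => (I.A.map (fun a => (a : ℚ))).row (f i))) :
    ∃ g : Fin I.rank → Fin n, ((I.A.map (fun a => (a : ℤ))).submatrix f g).det ≠ 0 := by
  set M := I.A.map (fun a => (a : ℚ)) with hM
  let M' := M.submatrix f id
  have h1 : M'.rank = I.rank := by
    have := LinearIndependent.rank_matrix (M := M') hf
    simpa using this
  have h2 : Module.finrank ℚ (Submodule.span ℚ (Set.range M'.col)) = I.rank := by
    rw [← Matrix.rank_eq_finrank_span_cols, h1]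
  obtain ⟨c, hc, hl⟩ : ∃ c : Fin I.rank → Fin I.rank → ℚ, (∀ i, c i ∈ Set.range M'.col) ∧
      LinearIndependent ℚ c := by
    obtain ⟨c, hc, -, hl⟩ := Submodule.exists_fun_fin_finrank_span_eq ℚ (Set.range M'.col)
    exact ⟨c ∘ Fin.cast h2.symm, fun i => hc _, hl.comp _ (Fin.cast_injective _)⟩
  choose g hg using hc
  refine ⟨g, fun h0 => ?_⟩
  have h3 : (M.submatrix f g).det = 0 := by
    have : M.submatrix f g = ((I.A.map (fun a => (a : ℤ))).submatrix f g).map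
        (Int.castRingHom ℚ) := by
      ext i j; simp [hM]
    rw [this, ← RingHom.mapMatrix_apply, ← RingHom.map_det, h0, map_zero]
  have h4 : LinearIndependent ℚ (M.submatrix f g).col := by
    have : (M.submatrix f g).col = c := by
      ext i j
      rw [← hg i]; rfl
    rw [this]; exact hl
  have h5 := Matrix.linearIndependent_cols_iff_isUnit.mp h4
  rw [Matrix.isUnit_iff_isUnit_det, h3] at h5
  exact not_isUnit_zero h5

/-- The right-hand sides `A x` that can be reached with at most `k` items are few. -/
theorem card_image_le (I : Knapsack m n) {D : ℕ} (hD : I.IsModular D) (k : ℕ)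
    (V : Finset (Fin m → ℕ))
    (hV : ∀ v ∈ V, ∃ x : Fin n → ℕ, ∑ j, x j ≤ k ∧ ∀ i, v i = ∑ j, I.A i j * x j) :
    V.card ≤ (2 * k + 1) ^ I.rank * D := by
  obtain ⟨f, hfl, hfs⟩ := I.exists_rows
  obtain ⟨g₀, hg₀⟩ := I.exists_minor_ne_zero f hfl
  set Az := I.A.map (fun a => (a : ℤ)) with hAz
  -- A minor of maximal absolute value in the rows `f` makes all coordinates of the other columns at
  -- most one in absolute value.
  obtain ⟨g, -, hg⟩ := Finset.exists_max_image Finset.univ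
    (fun g : Fin I.rank → Fin n => |(Az.submatrix f g).det|) ⟨g₀, Finset.mem_univ _⟩
  set B := Az.submatrix f g with hB
  have hdet : B.det ≠ 0 := by
    have := hg g₀ (Finset.mem_univ _)
    intro h
    rw [h, abs_zero] at this
    exact hg₀ (abs_eq_zero.mp (le_antisymm this (abs_nonneg _)))
  have hdD : B.det.natAbs ≤ D := by
    have := hD f g
    rw [Int.abs_eq_natAbs] at this
    exact_mod_cast this
  let φ : (Fin m → ℕ) → Fin I.rank → ℤ := fun v i => (v (f i) : ℤ)
  have hφ : Set.InjOn φ V := by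
    intro v hv v' hv' h
    obtain ⟨x, -, hx⟩ := hV v hv
    obtain ⟨x', -, hx'⟩ := hV v' hv'
    set M := I.A.map (fun a => (a : ℚ)) with hM
    -- Pairing with `x - x'` is linear on the row space. If it vanishes on the spanning rows `f`, it
    -- vanishes on all rows, so the entries of `v` in the rows `f` determine `v`.
    let ψ : (Fin n → ℚ) →ₗ[ℚ] ℚ := ∑ j, ((x j : ℚ) - x' j) • LinearMap.proj j
    have hψ : ∀ i, ψ (M.row i) = v i - v' i := by
      intro i
      simp only [ψ, LinearMap.sum_apply, LinearMap.smul_apply, LinearMap.proj_apply, hx, hx']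
      push_cast
      rw [← Finset.sum_sub_distrib]
      refine Finset.sum_congr rfl fun j _ => ?_
      simp only [hM, Matrix.row, Matrix.map_apply, smul_eq_mul]
      ring
    have h0 : ∀ w ∈ Submodule.span ℚ (Set.range fun i => M.row (f i)), ψ w = 0 := by
      intro w hw
      induction hw using Submodule.span_induction with
      | mem w hw =>
        obtain ⟨i, rfl⟩ := hw
        have := congrFun h i
        simp only [φ] at this
        rw [hψ, sub_eq_zero]
        exact_mod_cast this
      | zero => simp
      | add a b _ _ ha hb => rw [map_add, ha, hb, add_zero]
      | smul a b _ hb => rw [map_smul, hb, smul_zero]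
    ext i
    have := h0 _ (hfs i)
    rw [hψ, sub_eq_zero] at this
    exact_mod_cast this
  rw [← Finset.card_image_of_injOn hφ]
  refine (card_le_of_abs_cramer_le B hdet k _ ?_).trans (Nat.mul_le_mul_left _ hdD)
  intro y hy i
  obtain ⟨v, hv, rfl⟩ := Finset.mem_image.mp hy
  obtain ⟨x, hxk, hx⟩ := hV v hv
  have hsum : φ v = ∑ j, (x j : ℤ) • (fun l => Az (f l) j) := by
    ext l
    simp only [φ, hx, Finset.sum_apply, Pi.smul_apply, smul_eq_mul]
    push_cast
    exact Finset.sum_congr rfl fun j _ => by simp [hAz, mul_comm]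
  -- By Cramer's rule a coordinate is a determinant in which one column of `B` is exchanged for
  -- another column of the matrix. This is again a minor in the rows `f`, so it cannot exceed the
  -- maximal one.
  have hcol : ∀ j, |B.cramer (fun l => Az (f l) j) i| ≤ |B.det| := by
    intro j
    have h := hg (Function.update g i j) (Finset.mem_univ _)
    rw [Matrix.cramer_apply]
    have he : (B.updateCol i fun l => Az (f l) j) =
        Az.submatrix f (Function.update g i j) := by
      refine Matrix.ext fun a b => ?_
      simp only [Matrix.updateCol_apply, Matrix.submatrix_apply, hB, Function.update_apply]
      split_ifs <;> rfl
    rw [he]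
    exact h
  rw [hsum, map_sum, Finset.sum_apply]
  calc |∑ j, (B.cramer ((x j : ℤ) • fun l => Az (f l) j)) i|
      ≤ ∑ j, |(B.cramer ((x j : ℤ) • fun l => Az (f l) j)) i| := Finset.abs_sum_le_sum_abs _ _
    _ ≤ ∑ j, (x j : ℤ) * |B.det| := by
        refine Finset.sum_le_sum fun j _ => ?_
        rw [map_smul, Pi.smul_apply, smul_eq_mul, abs_mul, Nat.abs_cast]
        exact mul_le_mul_of_nonneg_left (hcol j) (by positivity)
    _ = (∑ j, x j : ℕ) * |B.det| := by push_cast; rw [Finset.sum_mul]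
    _ ≤ k * |B.det| := by
        refine mul_le_mul_of_nonneg_right ?_ (abs_nonneg _)
        exact_mod_cast hxk

theorem rank_le (I : Knapsack m n) : I.rank ≤ m := by
  simpa [rank] using Matrix.rank_le_height (I.A.map (fun a => (a : ℚ)))

/-- Some minor of full rank is a nonzero integer. This makes the bound for the size of the tables
positive, so that cost terms without it can be absorbed. -/
theorem IsModular.one_le {I : Knapsack m n} {D : ℕ} (hD : I.IsModular D) : 1 ≤ D := by
  obtain ⟨f, hfl, -⟩ := I.exists_rows
  obtain ⟨g, hg⟩ := I.exists_minor_ne_zero f hfl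
  have h := hD f g
  have := abs_pos.mpr hg
  omega

end Knapsack

/-! ### Vertices of the relaxation -/

namespace LP

variable {m n : ℕ}

/-- A vertex has at most `m` coordinates strictly between their bounds. -/
theorem card_strict_le (P : LP m n) {x : Fin n → ℚ} (hx : x ∈ P.feasible.extremePoints ℚ)
    (F : Finset (Fin n)) (hF : ∀ j ∈ F, 0 < x j ∧ x j < P.u j) : F.card ≤ m := by
  by_contra hc
  push Not at hc
  -- With more strict coordinates than constraints there is a direction supported on `F` that
  -- changes no constraint.
  have hfin : Module.finrank ℚ (Fin m → ℚ) < Module.finrank ℚ (F → ℚ) := by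
    simpa using hc
  let M : Matrix (Fin m) F ℚ := fun i j => P.A i j
  obtain ⟨d, hd0, hd⟩ : ∃ d : F → ℚ, d ≠ 0 ∧ M.mulVec d = 0 := by
    have h := LinearMap.ker_ne_bot_of_finrank_lt (f := M.mulVecLin) hfin
    obtain ⟨d, hd, hd0⟩ := Submodule.exists_mem_ne_zero_of_ne_bot h
    exact ⟨d, hd0, by simpa using hd⟩
  let e : Fin n → ℚ := fun j => if h : j ∈ F then d ⟨j, h⟩ else 0
  have he : ∀ i, ∑ j, P.A i j * e j = 0 := by
    intro i
    have h1 := congrFun hd i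
    simp only [Matrix.mulVec, dotProduct, M, Pi.zero_apply] at h1
    rw [← h1, ← Finset.sum_subset (Finset.subset_univ F) (by
      intro j _ hj
      simp [e, hj]), ← Finset.sum_coe_sort F]
    exact Finset.sum_congr rfl fun j _ => by simp [e]
  -- A step small enough to respect the bounds of the coordinates in `F`, both forwards and
  -- backwards.
  obtain ⟨δ, hδ, hδb⟩ : ∃ δ : ℚ, 0 < δ ∧ ∀ j ∈ F, δ * |e j| ≤ x j ∧ δ * |e j| ≤ P.u j - x j := by
    have : ∀ j : Fin n, ∃ δ : ℚ, 0 < δ ∧ (j ∈ F → δ * |e j| ≤ x j ∧ δ * |e j| ≤ P.u j - x j) := by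
      intro j
      by_cases hj : j ∈ F
      · obtain ⟨h1, h2⟩ := hF j hj
        refine ⟨min (x j) (P.u j - x j) / (|e j| + 1), ?_, fun _ => ?_⟩
        · have : 0 < min (x j) (P.u j - x j) := lt_min h1 (by linarith)
          positivity
        · have h0 : 0 < min (x j) (P.u j - x j) := lt_min h1 (by linarith)
          have : min (x j) (P.u j - x j) / (|e j| + 1) * |e j| ≤ min (x j) (P.u j - x j) := by
            rw [div_mul_eq_mul_div, div_le_iff₀ (by positivity)]
            nlinarith
          exact ⟨this.trans (min_le_left _ _), this.trans (min_le_right _ _)⟩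
      · exact ⟨1, one_pos, fun h => absurd h hj⟩
    choose δ h1 h2 using this
    have hne : F.Nonempty := Finset.card_pos.mp (by omega)
    refine ⟨F.inf' hne δ, ?_, fun j hj => ?_⟩
    · rw [Finset.lt_inf'_iff]; exact fun j _ => h1 j
    · have h3 : F.inf' hne δ * |e j| ≤ δ j * |e j| :=
        mul_le_mul_of_nonneg_right (Finset.inf'_le _ hj) (abs_nonneg _)
      exact ⟨h3.trans (h2 j hj).1, h3.trans (h2 j hj).2⟩
  have hmem : ∀ s : ℚ, |s| = δ → (fun j => x j + s * e j) ∈ P.feasible := by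
    intro s hs
    refine ⟨fun i => ?_, fun j => ?_⟩
    · have : ∑ j, P.A i j * (x j + s * e j) = ∑ j, P.A i j * x j := by
        have h := he i
        calc _ = ∑ j, P.A i j * x j + s * ∑ j, P.A i j * e j := by
              rw [Finset.mul_sum, ← Finset.sum_add_distrib]
              exact Finset.sum_congr rfl fun j _ => by ring
          _ = _ := by rw [h]; ring
      rw [this]
      exact hx.1.1 i
    · by_cases hj : j ∈ F
      · have h := hδb j hj
        rw [← hs, ← abs_mul] at h
        have h1 := neg_abs_le (s * e j)
        have h2 := le_abs_self (s * e j)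
        constructor <;> linarith
      · simp only [e, hj, dite_false, mul_zero, add_zero]
        exact hx.1.2 j
  -- The vertex would be the midpoint of two feasible points, so both coincide with it.
  have hseg := hx.2 (hmem δ (abs_of_pos hδ)) (hmem (-δ) (by rw [abs_neg, abs_of_pos hδ]))
    ⟨1 / 2, 1 / 2, by norm_num, by norm_num, by norm_num, by
      ext j; simp only [Pi.add_apply, Pi.smul_apply, smul_eq_mul]; ring⟩
  apply hd0
  ext j
  have := congrFun hseg j
  simp only [e, j.2, dite_true] at this
  have h2 : δ * d j = 0 := by linarith
  exact (mul_eq_zero.mp h2).resolve_left hδ.ne'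

/-- Rounding down a vertex loses at most `m` times the largest profit. -/
theorem value_le_floor (P : LP m n) {x : Fin n → ℚ} (hx : x ∈ P.feasible.extremePoints ℚ)
    (c u : Fin n → ℕ) (hc : ∀ j, P.c j = c j) (hu : ∀ j, P.u j = u j) (θ : ℕ)
    (hθ : ∀ j, 0 < u j → c j ≤ θ) :
    P.value x ≤ (∑ j, c j * ⌊x j⌋₊ : ℕ) + (m * θ : ℕ) := by
  -- The upper bounds are integers, so a coordinate that is changed by rounding lies strictly
  -- between its bounds. At most `m` coordinates do, and each loses at most its profit.
  let F : Finset (Fin n) := Finset.univ.filter fun j => (⌊x j⌋₊ : ℚ) < x j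
  have hFj : ∀ j ∈ F, 0 < x j ∧ x j < P.u j := by
    intro j hj
    have h1 : (⌊x j⌋₊ : ℚ) < x j := (Finset.mem_filter.mp hj).2
    refine ⟨lt_of_le_of_lt (by positivity) h1, lt_of_le_of_ne (hx.1.2 j).2 fun h => ?_⟩
    rw [h, hu, Nat.floor_natCast] at h1
    exact lt_irrefl _ h1
  have hF := P.card_strict_le hx F hFj
  have hle : ∀ j, P.c j * x j ≤ (c j * ⌊x j⌋₊ : ℕ) + if j ∈ F then (θ : ℚ) else 0 := by
    intro j
    have h0 := (hx.1.2 j).1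
    rw [hc]
    push_cast
    by_cases hj : j ∈ F
    · rw [if_pos hj]
      have h1 := Nat.lt_floor_add_one (x j)
      have h2 : (c j : ℚ) ≤ θ := by
        have h3 := hFj j hj
        rw [hu] at h3
        exact_mod_cast hθ j (by exact_mod_cast h3.1.trans h3.2)
      have h4 : (0 : ℚ) ≤ c j := by positivity
      nlinarith
    · rw [if_neg hj, add_zero]
      have : ¬ (⌊x j⌋₊ : ℚ) < x j := fun h => hj (Finset.mem_filter.mpr ⟨Finset.mem_univ _, h⟩)
      exact mul_le_mul_of_nonneg_left (not_lt.mp this) (by positivity)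
  calc P.value x = ∑ j, P.c j * x j := rfl
    _ ≤ ∑ j, ((c j * ⌊x j⌋₊ : ℕ) + if j ∈ F then (θ : ℚ) else 0) :=
        Finset.sum_le_sum fun j _ => hle j
    _ = (∑ j, c j * ⌊x j⌋₊ : ℕ) + F.card * θ := by
        rw [Finset.sum_add_distrib, Finset.sum_ite_mem]
        simp
    _ ≤ _ := by
        push_cast
        have : (F.card : ℚ) ≤ m := by exact_mod_cast hF
        have h4 : (0 : ℚ) ≤ θ := by positivity
        nlinarith

end LP

namespace RAM

/-! ### A program logic with costs -/

/-! ### What a program leaves unchanged. -/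

section Frame

/-- The registers a program may write to. -/
def Prog.wr : Prog → List ℕ
  | .skip => []
  | .assign r _ => [r]
  | .write _ _ _ => []
  | .seq p q => p.wr ++ q.wr
  | .ite _ p q => p.wr ++ q.wr
  | .while _ p => p.wr
  | .solveLP _ _ _ _ _ _ _ => []

/-- The arrays a program may write to. -/
def Prog.wa : Prog → List ℕ
  | .skip => []
  | .assign _ _ => []
  | .write a _ _ => [a]
  | .seq p q => p.wa ++ q.wa
  | .ite _ p q => p.wa ++ q.wa
  | .while _ p => p.wa
  | .solveLP _ _ _ _ _ _ ax => [ax]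

/-- The states agree outside the registers `W` and the arrays `A`. -/
def Frame (W A : List ℕ) (σ σ' : State) : Prop :=
  (∀ r ∉ W, σ'.reg r = σ.reg r) ∧ ∀ a ∉ A, σ'.arr a = σ.arr a

theorem Frame.refl (W A : List ℕ) (σ : State) : Frame W A σ σ :=
  ⟨fun _ _ => rfl, fun _ _ => rfl⟩

theorem Frame.trans {W A : List ℕ} {σ₁ σ₂ σ₃ : State} (h : Frame W A σ₁ σ₂)
    (h' : Frame W A σ₂ σ₃) : Frame W A σ₁ σ₃ :=
  ⟨fun r hr => (h'.1 r hr).trans (h.1 r hr), fun a ha => (h'.2 a ha).trans (h.2 a ha)⟩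

theorem Frame.mono {W A W' A' : List ℕ} {σ σ' : State} (h : Frame W A σ σ') (hW : W ⊆ W')
    (hA : A ⊆ A') : Frame W' A' σ σ' :=
  ⟨fun r hr => h.1 r fun h' => hr (hW h'), fun a ha => h.2 a fun h' => ha (hA h')⟩

@[simp] theorem State.setReg_reg (σ : State) (r r' : ℕ) (q : ℚ) :
    (σ.setReg r q).reg r' = if r' = r then q else σ.reg r' := by
  simp [State.setReg, Function.update_apply]

@[simp] theorem State.setReg_arr (σ : State) (r : ℕ) (q : ℚ) : (σ.setReg r q).arr = σ.arr := rfl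

@[simp] theorem State.setCell_reg (σ : State) (a : ℕ) (z : ℤ) (q : ℚ) :
    (σ.setCell a z q).reg = σ.reg := rfl

@[simp] theorem State.setCell_arr (σ : State) (a a' : ℕ) (z z' : ℤ) (q : ℚ) :
    (σ.setCell a z q).arr a' z' = if a' = a ∧ z' = z then q else σ.arr a' z' := by
  by_cases h : a' = a
  · subst h; simp [State.setCell, Function.update_apply]
  · simp [State.setCell, h]

@[simp] theorem State.setVec_reg (σ : State) (a : ℕ) {n : ℕ} (v : Fin n → ℚ) :
    (σ.setVec a v).reg = σ.reg := rfl

theorem State.setVec_arr (σ : State) (a : ℕ) {n : ℕ} (v : Fin n → ℚ) (j : Fin n) :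
    (σ.setVec a v).arr a (j : ℤ) = v j := by
  simp [State.setVec]

theorem State.setVec_arr_ne (σ : State) {a a' : ℕ} (h : a' ≠ a) {n : ℕ} (v : Fin n → ℚ) :
    (σ.setVec a v).arr a' = σ.arr a' := by
  simp [State.setVec, h]

theorem frame_setReg (σ : State) (r : ℕ) (q : ℚ) : Frame [r] [] σ (σ.setReg r q) :=
  ⟨fun r' hr => by simp [List.mem_singleton.not.mp hr], fun _ _ => rfl⟩

/-- The possible effects of a program can be read off from its syntax, so that `decide` can settle
which registers and arrays survive it. -/
theorem Exec.frame {S : LPSolver} {B : ℕ} {p : Prog} {σ σ' : State} {t : ℕ}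
    (h : Exec S B p σ σ' t) : Frame p.wr p.wa σ σ' := by
  induction h with
  | skip σ => exact Frame.refl _ _ _
  | assign r e σ h => exact frame_setReg _ _ _
  | write a i e σ hi he =>
    refine ⟨fun _ _ => rfl, fun a' ha => ?_⟩
    simp only [Prog.wa, List.mem_singleton] at ha
    simp [State.setCell, ha]
  | seq _ _ h1 h2 =>
    exact (h1.mono (by simp [Prog.wr]) (by simp [Prog.wa])).trans
      (h2.mono (by simp [Prog.wr]) (by simp [Prog.wa]))
  | iteTrue _ _ _ h => exact h.mono (by simp [Prog.wr]) (by simp [Prog.wa])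
  | iteFalse _ _ _ h => exact h.mono (by simp [Prog.wr]) (by simp [Prog.wa])
  | whileTrue _ _ _ _ h1 h2 => exact h1.trans h2
  | whileFalse _ _ => exact Frame.refl _ _ _
  | solveLP rm rn aA ab ac au ax σ m n hm hn =>
    refine ⟨fun _ _ => rfl, fun a ha => ?_⟩
    simp only [Prog.wa, List.mem_singleton] at ha
    exact σ.setVec_arr_ne ha _

end Frame

/-! ### Evaluation of expressions and tests without overflow. -/

section Eval

variable {B : ℕ} {σ : State}

theorem fits_natCast [NeZero B] {k : ℕ} (h : k < 2 ^ B) : Fits B (k : ℚ) := by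
  refine ⟨?_, ?_⟩
  · simpa [Nat.size_le] using h
  · simpa using NeZero.one_le

/-- Cancelling only shrinks a fraction: the reduced numerator and denominator divide the given ones.
-/
theorem fits_div [NeZero B] {a b : ℕ} (ha : a < 2 ^ B) (hb : b < 2 ^ B) :
    Fits B ((a : ℚ) / b) := by
  rcases Nat.eq_zero_or_pos a with rfl | ha0
  · simpa using fits_natCast (B := B) (k := 0) (by positivity)
  rcases Nat.eq_zero_or_pos b with rfl | hb0
  · simpa using fits_natCast (B := B) (k := 0) (by positivity)
  have h1 := Rat.num_dvd (a : ℤ) (b := (b : ℤ)) (by exact_mod_cast hb0.ne')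
  have h2 := Rat.den_dvd (a : ℤ) (b : ℤ)
  rw [Rat.divInt_eq_div] at h1 h2
  push_cast at h1 h2
  constructor
  · rw [Nat.size_le]
    refine lt_of_le_of_lt ?_ ha
    exact Nat.le_of_dvd ha0 (Int.natAbs_dvd_natAbs.mpr h1)
  · rw [Nat.size_le]
    exact lt_of_le_of_lt (Nat.le_of_dvd hb0 (by exact_mod_cast h2)) hb

/-- The expression `e` can be evaluated and has the natural number `k` as its value. -/
def Ev (B : ℕ) (σ : State) (e : Expr) (k : ℕ) : Prop := e.Ok B σ ∧ e.eval σ = k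

theorem Ev.const [NeZero B] (k : ℕ) (h : k < 2 ^ B) : Ev B σ (.const k) k :=
  ⟨fits_natCast h, rfl⟩

theorem Ev.reg {r k : ℕ} (h : σ.reg r = k) : Ev B σ (.reg r) k := ⟨trivial, h⟩

theorem Ev.read {a z k : ℕ} {e : Expr} (he : Ev B σ e z) (h : σ.arr a (z : ℤ) = k) :
    Ev B σ (.read a e) k := by
  refine ⟨he.1, ?_⟩
  rw [Expr.eval, he.2, Int.floor_natCast, h]

theorem Ev.add [NeZero B] {e f : Expr} {a b : ℕ} (he : Ev B σ e a) (hf : Ev B σ f b)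
    (h : a + b < 2 ^ B) : Ev B σ (.add e f) (a + b) := by
  have : e.eval σ + f.eval σ = (a + b : ℕ) := by rw [he.2, hf.2]; push_cast; rfl
  exact ⟨⟨he.1, hf.1, this ▸ fits_natCast h⟩, this⟩

theorem Ev.mul [NeZero B] {e f : Expr} {a b : ℕ} (he : Ev B σ e a) (hf : Ev B σ f b)
    (h : a * b < 2 ^ B) : Ev B σ (.mul e f) (a * b) := by
  have : e.eval σ * f.eval σ = (a * b : ℕ) := by rw [he.2, hf.2]; push_cast; rfl
  exact ⟨⟨he.1, hf.1, this ▸ fits_natCast h⟩, this⟩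

theorem Ev.sub [NeZero B] {e f : Expr} {a b : ℕ} (he : Ev B σ e a) (hf : Ev B σ f b)
    (hba : b ≤ a) (h : a < 2 ^ B) : Ev B σ (.sub e f) (a - b) := by
  have : e.eval σ - f.eval σ = (a - b : ℕ) := by rw [he.2, hf.2]; push_cast [hba]; rfl
  exact ⟨⟨he.1, hf.1, this ▸ fits_natCast (lt_of_le_of_lt (Nat.sub_le _ _) h)⟩, this⟩

/-- Rounding down a nonnegative value. -/
theorem Ev.floor [NeZero B] {e : Expr} (he : e.Ok B σ) (h0 : 0 ≤ e.eval σ)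
    (h : ⌊e.eval σ⌋₊ < 2 ^ B) : Ev B σ (.floor e) ⌊e.eval σ⌋₊ := by
  have : ((⌊e.eval σ⌋ : ℤ) : ℚ) = (⌊e.eval σ⌋₊ : ℕ) := by
    rw [← Int.natCast_floor_eq_floor h0]; rfl
  exact ⟨⟨he, this ▸ fits_natCast h⟩, this⟩

theorem Ev.floorDiv [NeZero B] {e f : Expr} {a b : ℕ} (he : Ev B σ e a) (hf : Ev B σ f b)
    (hb0 : b ≠ 0) (ha : a < 2 ^ B) (hb : b < 2 ^ B) :
    Ev B σ (.floor (.div e f)) (a / b) := by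
  have h : e.eval σ / f.eval σ = (a : ℚ) / b := by rw [he.2, hf.2]
  have h2 : ⌊(Expr.div e f).eval σ⌋₊ = a / b := by
    rw [Expr.eval, h, Nat.floor_div_eq_div]
  rw [← h2]
  refine Ev.floor ⟨he.1, hf.1, ?_, h ▸ fits_div ha hb⟩ ?_ ?_
  · rw [hf.2]; exact_mod_cast hb0
  · rw [Expr.eval, h]; positivity
  · rw [h2]; exact lt_of_le_of_lt (Nat.div_le_self _ _) ha

/-- The test `t` can be evaluated and decides `P`. -/
def Tv (B : ℕ) (σ : State) (t : Test) (P : Prop) : Prop := t.Ok B σ ∧ (t.Holds σ ↔ P)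

theorem Tv.lt {e f : Expr} {a b : ℕ} (he : Ev B σ e a) (hf : Ev B σ f b) :
    Tv B σ (.lt e f) (a < b) :=
  ⟨⟨he.1, hf.1⟩, by rw [Test.Holds, he.2, hf.2]; exact Nat.cast_lt⟩

theorem Tv.le {e f : Expr} {a b : ℕ} (he : Ev B σ e a) (hf : Ev B σ f b) :
    Tv B σ (.le e f) (a ≤ b) :=
  ⟨⟨he.1, hf.1⟩, by rw [Test.Holds, he.2, hf.2]; exact Nat.cast_le⟩

theorem Tv.eq {e f : Expr} {a b : ℕ} (he : Ev B σ e a) (hf : Ev B σ f b) :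
    Tv B σ (.eq e f) (a = b) :=
  ⟨⟨he.1, hf.1⟩, by rw [Test.Holds, he.2, hf.2]; exact Nat.cast_inj⟩

end Eval

/-- The program `p`, started in `σ`, halts after at most `c` units of cost in a state that
satisfies `Q`. -/
def Run (S : LPSolver) (B : ℕ) (p : Prog) (σ : State) (c : ℕ) (Q : State → Prop) : Prop :=
  ∃ σ' t, Exec S B p σ σ' t ∧ t ≤ c ∧ Q σ'

/-! ### Rules for runs with bounded cost. -/

section Run

variable {S : LPSolver} {B : ℕ} {σ : State} {p q : Prog} {c c' : ℕ} {Q Q' : State → Prop}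

theorem Run.le (h : Run S B p σ c Q) (hc : c ≤ c') : Run S B p σ c' Q := by
  obtain ⟨σ', t, h1, h2, h3⟩ := h
  exact ⟨σ', t, h1, h2.trans hc, h3⟩

theorem Run.post (h : Run S B p σ c Q) (hQ : ∀ σ', Q σ' → Q' σ') : Run S B p σ c Q' := by
  obtain ⟨σ', t, h1, h2, h3⟩ := h
  exact ⟨σ', t, h1, h2, hQ _ h3⟩

theorem Run.framed (h : Run S B p σ c Q) :
    Run S B p σ c fun σ' => Q σ' ∧ Frame p.wr p.wa σ σ' := by
  obtain ⟨σ', t, h1, h2, h3⟩ := h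
  exact ⟨σ', t, h1, h2, h3, h1.frame⟩

theorem Run.skip (h : Q σ) : Run S B .skip σ 1 Q := ⟨σ, 1, .skip σ, le_rfl, h⟩

theorem Run.assign {r k : ℕ} {e : Expr} (he : Ev B σ e k) (h : Q (σ.setReg r k)) :
    Run S B (.assign r e) σ (e.cost + 1) Q :=
  ⟨_, _, .assign r e σ he.1, le_rfl, by rw [he.2]; exact h⟩

theorem Run.write {a z k : ℕ} {i e : Expr} (hi : Ev B σ i z) (he : Ev B σ e k)
    (h : Q (σ.setCell a z k)) : Run S B (.write a i e) σ (i.cost + e.cost + 1) Q :=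
  ⟨_, _, .write a i e σ hi.1 he.1, le_rfl, by rw [he.2, hi.2, Int.floor_natCast]; exact h⟩

theorem Run.seq (hp : Run S B p σ c Q) (hq : ∀ σ', Q σ' → Run S B q σ' c' Q') :
    Run S B (.seq p q) σ (c + c') Q' := by
  obtain ⟨σ', t, h1, h2, h3⟩ := hp
  obtain ⟨σ'', t', h1', h2', h3'⟩ := hq σ' h3
  exact ⟨σ'', t + t', .seq h1 h1', add_le_add h2 h2', h3'⟩

theorem Run.seq_assign {r k : ℕ} {e : Expr} (he : Ev B σ e k)
    (h : Run S B q (σ.setReg r k) c Q) : Run S B (.seq (.assign r e) q) σ (e.cost + 1 + c) Q :=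
  Run.seq (Q := fun σ' => σ' = σ.setReg r k) (Run.assign he rfl) fun _ h' => h' ▸ h

theorem Run.seq_write {a z k : ℕ} {i e : Expr} (hi : Ev B σ i z) (he : Ev B σ e k)
    (h : Run S B q (σ.setCell a z k) c Q) :
    Run S B (.seq (.write a i e) q) σ (i.cost + e.cost + 1 + c) Q :=
  Run.seq (Q := fun σ' => σ' = σ.setCell a z k) (Run.write hi he rfl) fun _ h' => h' ▸ h

/-- Adding the costs of the branches instead of taking their maximum is wasteful only by a constant
factor and keeps the bounds linear. -/
theorem Run.ite {t : Test} {P : Prop} (ht : Tv B σ t P) (hp : P → Run S B p σ c Q)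
    (hq : ¬ P → Run S B q σ c' Q) : Run S B (.ite t p q) σ (t.cost + (c + c')) Q := by
  by_cases h : P
  · obtain ⟨σ', s, h1, h2, h3⟩ := hp h
    exact ⟨σ', _, .iteTrue ht.1 (ht.2.mpr h) h1, by omega, h3⟩
  · obtain ⟨σ', s, h1, h2, h3⟩ := hq h
    exact ⟨σ', _, .iteFalse ht.1 (fun h' => h (ht.2.mp h')) h1, by omega, h3⟩

/-- `for r = 0, …, rb - 1` -/
def forTo (r rb : ℕ) (body : Prog) : Prog :=
  .seq (.assign r (.const 0))
    (.while (.lt (.reg r) (.reg rb)) (.seq body (.assign r (.add (.reg r) (.const 1)))))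

/-- Each pass adds 3 for the test and 4 for the increment; the remaining 5 pay for the
initialization and the last test. The frame with respect to the initial state is handed to the body,
so that the invariant need only mention what changes. -/
theorem Run.forTo [NeZero B] {r rb N : ℕ} (Inv : ℕ → State → Prop) (hr : r ∉ p.wr)
    (hrb : rb ∉ p.wr) (hne : rb ≠ r) (hN : σ.reg rb = N) (hNB : N < 2 ^ B)
    (h0 : Inv 0 (σ.setReg r 0))
    (hbody : ∀ i < N, ∀ σ', Inv i σ' → σ'.reg r = i → Frame (r :: p.wr) p.wa σ σ' →
      Run S B p σ' c fun σ'' => Inv (i + 1) (σ''.setReg r (i + 1 : ℕ))) :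
    Run S B (forTo r rb p) σ (N * (c + 7) + 5) (Inv N) := by
  -- The induction runs over the number `k` of passes that remain.
  have key : ∀ k i, i + k = N → ∀ σ', Inv i σ' → σ'.reg r = i → Frame (r :: p.wr) p.wa σ σ' →
      Run S B (.while (.lt (.reg r) (.reg rb)) (.seq p (.assign r (.add (.reg r) (.const 1))))) σ'
        (k * (c + 7) + 3) (Inv N) := by
    intro k
    induction k with
    | zero =>
      intro i hi σ' hInv hreg hfr
      have hb : σ'.reg rb = N := by rw [hfr.1 rb (by simp [hne, hrb]), hN]
      have ht : Tv B σ' (.lt (.reg r) (.reg rb)) (i < N) := .lt (.reg hreg) (.reg hb)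
      refine ⟨σ', _, .whileFalse ht.1 (fun h => ?_), by simp [Test.cost, Expr.cost], ?_⟩
      · have := ht.2.mp h; omega
      · obtain rfl : i = N := by omega
        exact hInv
    | succ k ih =>
      intro i hi σ' hInv hreg hfr
      have hb : σ'.reg rb = N := by rw [hfr.1 rb (by simp [hne, hrb]), hN]
      have ht : Tv B σ' (.lt (.reg r) (.reg rb)) (i < N) := .lt (.reg hreg) (.reg hb)
      obtain ⟨σ₁, t₁, he, ht₁, hQ⟩ := hbody i (by omega) σ' hInv hreg hfr
      have hfr₁ := he.frame
      have hreg₁ : σ₁.reg r = i := by rw [hfr₁.1 r hr, hreg]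
      have hE : Ev B σ₁ (.add (.reg r) (.const 1)) (i + 1) :=
        .add (.reg hreg₁) (.const 1 (Nat.one_lt_two_pow (NeZero.ne B))) (by omega)
      have hfr₂ : Frame (r :: p.wr) p.wa σ (σ₁.setReg r (i + 1 : ℕ)) :=
        (hfr.trans (hfr₁.mono (by simp) (by simp))).trans
          ((frame_setReg _ _ _).mono (by simp) (by simp))
      obtain ⟨σ₂, t₂, he₂, ht₂, hQ₂⟩ := ih (i + 1) (by omega) _ hQ (by simp) hfr₂
      have ha := Exec.assign (S := S) r _ _ hE.1
      rw [hE.2] at ha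
      refine ⟨σ₂, _, .whileTrue ht.1 (ht.2.mpr (by omega)) (.seq he ha) he₂, ?_, hQ₂⟩
      simp only [Test.cost, Expr.cost]
      rw [Nat.succ_mul]
      omega
  refine (Run.seq_assign (.const 0 (by positivity))
    (key N 0 (by omega) _ (by simpa using h0) (by simp)
    ((frame_setReg _ _ _).mono (by simp) (by simp)))).le ?_
  simp only [Expr.cost]
  omega

theorem Run.solveLP {rm rn aA ab ac au ax m n T : ℕ} (hm : σ.reg rm = m) (hn : σ.reg rn = n)
    (hT : S.cost (σ.getLP m n aA ab ac au) ≤ T)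
    (h : Q (σ.setVec ax (S.sol (σ.getLP m n aA ab ac au)))) :
    Run S B (.solveLP rm rn aA ab ac au ax) σ (T + 1) Q :=
  ⟨_, _, .solveLP rm rn aA ab ac au ax σ m n hm hn, by omega, h⟩

end Run

end RAM

section

open Finset

/-! ### Encoding of used capacities -/

/-- The data of a knapsack instance, indexed by natural numbers. -/
structure Data where
  m : ℕ
  n : ℕ
  a : ℕ → ℕ → ℕ
  b : ℕ → ℕ
  c : ℕ → ℕ
  u : ℕ → ℕ

namespace Data

variable (d : Data)

/-- The base in which vectors `v ≤ b` are encoded as natural numbers. -/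
def radix : ℕ := 1 + ∑ i ∈ range d.m, d.b i

/-- The entry `i` of the vector with code `s`. -/
def digit (s i : ℕ) : ℕ := s / d.radix ^ i % d.radix

/-- The code of a vector. -/
def code (v : ℕ → ℕ) : ℕ := ∑ i ∈ range d.m, v i * d.radix ^ i

/-- Item `j` still fits into the knapsack if the capacities encoded by `s` are in use. -/
def Adm (s j : ℕ) : Prop := ∀ i < d.m, d.digit s i + d.a i j ≤ d.b i

/-- The code after adding item `j`. -/
def next (s j : ℕ) : ℕ := s + d.code (d.a · j)

theorem radix_pos : 0 < d.radix := by unfold radix; omega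

theorem b_lt_radix {i : ℕ} (hi : i < d.m) : d.b i < d.radix := by
  have := single_le_sum (f := d.b) (fun _ _ => Nat.zero_le _) (mem_range.mpr hi)
  unfold radix; omega

/-- A code is linear in the vector whether or not entries exceed the radix, so carries never have to
be discussed. Only decoding needs small entries. -/
theorem code_add (v w : ℕ → ℕ) : d.code (fun i => v i + w i) = d.code v + d.code w := by
  simp only [code, ← sum_add_distrib, add_mul]

theorem code_congr {v w : ℕ → ℕ} (h : ∀ i < d.m, v i = w i) : d.code v = d.code w :=
  sum_congr rfl fun i hi => by rw [h i (mem_range.mp hi)]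

theorem sum_mul_pow_lt {R k : ℕ} {v : ℕ → ℕ} (hv : ∀ i < k, v i < R) :
    ∑ i ∈ range k, v i * R ^ i < R ^ k := by
  induction k with
  | zero => simp
  | succ k ih =>
    rw [sum_range_succ, pow_succ]
    have h1 := ih fun i hi => hv i (by omega)
    have h2 : (v k + 1) * R ^ k ≤ R * R ^ k := Nat.mul_le_mul_right _ (hv k (by omega))
    nlinarith

theorem radix_pow_le {i : ℕ} (hi : i ≤ d.m) : d.radix ^ i ≤ d.radix ^ d.m :=
  Nat.pow_le_pow_right d.radix_pos hi

theorem code_lt {v : ℕ → ℕ} (hv : ∀ i < d.m, v i ≤ d.b i) : d.code v < d.radix ^ d.m :=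
  sum_mul_pow_lt fun i hi => (hv i hi).trans_lt (d.b_lt_radix hi)

theorem digit_code {v : ℕ → ℕ} (hv : ∀ i < d.m, v i ≤ d.b i) {i : ℕ} (hi : i < d.m) :
    d.digit (d.code v) i = v i := by
  have hR := d.radix_pos
  have hlt : ∀ i < d.m, v i < d.radix := fun i hi => (hv i hi).trans_lt (d.b_lt_radix hi)
  -- The digits below, at and above position `i`: division removes the first group, the remainder
  -- removes the last.
  have hsplit : d.code v = ∑ l ∈ range i, v l * d.radix ^ l +
      d.radix ^ i * (v i + d.radix * ∑ l ∈ range (d.m - i - 1), v (i + 1 + l) * d.radix ^ l) := by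
    have hm : d.m = i + 1 + (d.m - i - 1) := by omega
    unfold code
    conv_lhs => rw [hm]
    rw [sum_range_add, sum_range_succ, mul_add, mul_sum, mul_sum, add_assoc, mul_comm (v i)]
    congr 2
    refine sum_congr rfl fun l _ => ?_
    rw [pow_add, pow_succ]; ring
  rw [digit, hsplit, Nat.add_mul_div_left _ _ (pow_pos hR i),
    Nat.div_eq_of_lt (sum_mul_pow_lt fun l hl => hlt l (by omega)), zero_add,
    Nat.add_mul_mod_self_left, Nat.mod_eq_of_lt (hlt i hi)]

/-- The magnitudes of the data, and the word length. -/
structure Bound (B E : ℕ) : Prop where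
  two : 2 ≤ E
  m_pos : 1 ≤ d.m
  m : d.m + 1 ≤ E
  n : d.n + 1 ≤ E
  a : ∀ i < d.m, ∀ j < d.n, d.a i j ≤ E
  c : ∀ j < d.n, d.c j ≤ E
  u : ∀ j < d.n, d.u j ≤ E
  big : E ^ 16 * d.radix ^ d.m < 2 ^ B

namespace Bound

variable {d} {B E : ℕ} (h : d.Bound B E)

include h

theorem pos : 0 < E := by have := h.two; omega

theorem radix_le : d.radix ≤ d.radix ^ d.m := by
  simpa using d.radix_pow_le h.m_pos

/-- Numbers are estimated by a small power of `E` times the bound for codes, so the single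
inequality `big` excludes overflow everywhere. -/
theorem lt_of_le (k : ℕ) {x : ℕ} (hk : k ≤ 16) (hx : x ≤ E ^ k * d.radix ^ d.m) : x < 2 ^ B :=
  (hx.trans (Nat.mul_le_mul_right _ (Nat.pow_le_pow_right h.pos hk))).trans_lt h.big

theorem lt_of_le_pow (k : ℕ) {x : ℕ} (hk : k ≤ 16) (hx : x ≤ E ^ k) : x < 2 ^ B :=
  h.lt_of_le k hk (hx.trans (Nat.le_mul_of_pos_right _ (pow_pos d.radix_pos _)))

theorem lt_of_le_radix {x : ℕ} (hx : x ≤ d.radix ^ d.m) : x < 2 ^ B :=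
  h.lt_of_le 0 (by norm_num) (by simpa using hx)

theorem neZero : NeZero B := ⟨by
  rintro rfl
  have h1 := h.lt_of_le_pow 1 (by norm_num) (x := E) (by simp)
  have := h.two
  omega⟩

end Bound

end Data

/-! ### Testing on the machine whether an item fits. -/

namespace RAM

/-- The arrays and registers that hold the instance. -/
structure Inp (d : Data) (σ : State) : Prop where
  m : σ.reg 0 = d.m
  n : σ.reg 1 = d.n
  a : ∀ i < d.m, ∀ j < d.n, σ.arr 0 ((i * d.n + j : ℕ) : ℤ) = d.a i j
  b : ∀ i < d.m, σ.arr 1 (i : ℤ) = d.b i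
  c : ∀ j < d.n, σ.arr 2 (j : ℤ) = d.c j

theorem Inp.frame {d : Data} {σ σ' : State} {W A : List ℕ} (h : Inp d σ) (hf : Frame W A σ σ')
    (hW : 0 ∉ W ∧ 1 ∉ W := by decide) (hA : 0 ∉ A ∧ 1 ∉ A ∧ 2 ∉ A := by decide) : Inp d σ' where
  m := by rw [hf.1 0 hW.1, h.m]
  n := by rw [hf.1 1 hW.2, h.n]
  a := by rw [hf.2 0 hA.1]; exact h.a
  b := by rw [hf.2 1 hA.2.1]; exact h.b
  c := by rw [hf.2 2 hA.2.2]; exact h.c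

/-- The remainder of `e` modulo `f`. -/
def modE (e f : Expr) : Expr := .sub e (.mul f (.floor (.div e f)))

theorem Ev.mod {B : ℕ} {σ : State} [NeZero B] {e f : Expr} {a b : ℕ} (he : Ev B σ e a)
    (hf : Ev B σ f b) (hb0 : b ≠ 0) (ha : a < 2 ^ B) (hb : b < 2 ^ B) :
    Ev B σ (modE e f) (a % b) := by
  have := Nat.mul_div_le a b
  have h := Ev.sub he (Ev.mul hf (Ev.floorDiv he hf hb0 ha hb) (by omega)) this ha
  rwa [← Nat.mod_def] at h

/-- The step of `check` for constraint `reg 8`. -/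
def checkBody : Prog :=
  .seq (.ite (.lt (.read 1 (.reg 8))
      (.add (modE (.reg 9) (.reg 3)) (.read 0 (.add (.mul (.reg 8) (.reg 1)) (.reg 4)))))
    (.assign 6 (.const 0)) .skip)
  (.seq (.assign 7 (.add (.reg 7)
    (.mul (.read 0 (.add (.mul (.reg 8) (.reg 1)) (.reg 4))) (.reg 10))))
  (.seq (.assign 9 (.floor (.div (.reg 9) (.reg 3))))
  (.assign 10 (.mul (.reg 10) (.reg 3)))))

/-- Check whether item `reg 4` fits in addition to the used capacities `reg 5` (result in `reg 6`)
and compute the new code of used capacities (`reg 7`). -/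
def check : Prog :=
  .seq (.assign 6 (.const 1)) (.seq (.assign 7 (.reg 5)) (.seq (.assign 9 (.reg 5))
    (.seq (.assign 10 (.const 1)) (forTo 8 0 checkBody))))

/-- Invariant of the loop of `check`. -/
def CheckInv (d : Data) (s j i : ℕ) (σ : State) : Prop :=
  σ.reg 7 = (s + ∑ l ∈ range i, d.a l j * d.radix ^ l : ℕ) ∧
  σ.reg 9 = (s / d.radix ^ i : ℕ) ∧ σ.reg 10 = (d.radix ^ i : ℕ) ∧
  ∃ f : ℕ, σ.reg 6 = f ∧ (f = 1 ↔ ∀ l < i, d.digit s l + d.a l j ≤ d.b l)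

variable {S : LPSolver} {B E : ℕ} {d : Data} {σ : State}

/-- One pass over the constraints peels the digits off `s` by division, while the power of the radix
is carried along to assemble the new code. -/
theorem run_check (hB : d.Bound B E) (hin : Inp d σ) (hR : σ.reg 3 = d.radix) {s j : ℕ}
    (hj : σ.reg 4 = j) (hjn : j < d.n) (hs : σ.reg 5 = s) (hs' : s < d.radix ^ d.m) :
    Run S B check σ (d.m * 60 + 20) fun σ' => σ'.reg 7 = d.next s j ∧
      ∃ f : ℕ, σ'.reg 6 = f ∧ (f = 1 ↔ d.Adm s j) := by
  have := hB.neZero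
  have hR0 := d.radix_pos
  have hRB : d.radix < 2 ^ B := hB.lt_of_le_radix hB.radix_le
  have hmn : d.m * d.n < E ^ 2 := by have := hB.m; have := hB.n; nlinarith
  refine Run.le (Run.seq_assign (.const 1 (Nat.one_lt_two_pow (NeZero.ne B)))
    (Run.seq_assign (k := s) (.reg (by simpa using hs)) (Run.seq_assign (k := s)
    (.reg (by simpa using hs)) (Run.seq_assign (.const 1 (Nat.one_lt_two_pow (NeZero.ne B)))
    (Run.post (Run.forTo (N := d.m) (c := 46) (CheckInv d s j) (by decide) (by decide) (by decide)
    (by simpa using hin.m) (hB.lt_of_le_pow 1 (by norm_num) (by have := hB.m; simp; omega))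
    (by simp [CheckInv]) ?_) ?_))))) ?_
  · rintro i hi σ' ⟨h7, h9, h10, f, h6, hf⟩ h8 hfr
    have hin' : Inp d σ' := by
      refine Inp.frame (W := [8, 6, 7, 9, 10]) (A := []) hin ⟨fun r hr => ?_, fun a ha => ?_⟩
      · rw [hfr.1 r (by simpa [checkBody, Prog.wr] using hr)]
        simp only [List.mem_cons, not_or] at hr
        simp [hr]
      · rw [hfr.2 a (by simp [checkBody, Prog.wa])]; simp
    have h3 : σ'.reg 3 = d.radix := by
      rw [hfr.1 3 (by decide)]; simpa using hR
    have h4 : σ'.reg 4 = j := by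
      rw [hfr.1 4 (by decide)]; simpa using hj
    have hidx : i * d.n + j < d.m * d.n := by nlinarith
    have hq : s / d.radix ^ i ≤ s := Nat.div_le_self _ _
    have hqB : s / d.radix ^ i < 2 ^ B := hB.lt_of_le_radix (by omega)
    have ha := hB.a i hi j hjn
    have hdig : d.digit s i < d.radix := Nat.mod_lt _ hR0
    have hRm := hB.radix_le
    have hE := hB.two
    -- The matrix entry is read twice, before and after the flag is written, so the evaluation is
    -- stated for both states at once.
    have hAe : ∀ τ : State, τ.reg 8 = i → τ.reg 1 = d.n → τ.reg 4 = j → τ.arr = σ'.arr →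
        Ev B τ (.read 0 (.add (.mul (.reg 8) (.reg 1)) (.reg 4))) (d.a i j) := by
      intro τ t8 t1 t4 ta
      refine .read (.add (.mul (.reg t8) (.reg t1) ?_) (.reg t4) ?_) ?_
      · exact hB.lt_of_le_pow 2 (by norm_num) (by omega)
      · exact hB.lt_of_le_pow 2 (by norm_num) (by omega)
      · rw [ta]; exact hin'.a i hi j hjn
    have hmod : Ev B σ' (modE (.reg 9) (.reg 3)) (d.digit s i) :=
      .mod (.reg h9) (.reg h3) hR0.ne' hqB hRB
    have hw : d.radix ^ i * d.radix ≤ d.radix ^ d.m := by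
      rw [← pow_succ]; exact d.radix_pow_le hi
    have haw : d.a i j * d.radix ^ i ≤ E * d.radix ^ d.m :=
      Nat.mul_le_mul ha (d.radix_pow_le hi.le)
    have hsum : ∀ k ≤ d.m, ∑ l ∈ range k, d.a l j * d.radix ^ l ≤ k * (E * d.radix ^ d.m) := by
      intro k hk
      refine (sum_le_card_nsmul _ _ (E * d.radix ^ d.m) fun l hl => ?_).trans (by simp)
      have := mem_range.mp hl
      exact Nat.mul_le_mul (hB.a l (by omega) j hjn) (d.radix_pow_le (by omega))
    have hnext : s + ∑ l ∈ range (i + 1), d.a l j * d.radix ^ l < 2 ^ B := by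
      refine hB.lt_of_le 3 (by norm_num) ?_
      have h1 := hsum (i + 1) hi
      have h2 : (i + 1) * (E * d.radix ^ d.m) ≤ E * (E * d.radix ^ d.m) :=
        Nat.mul_le_mul_right _ (by have := hB.m; omega)
      have h3 : d.radix ^ d.m ≤ E * (E * d.radix ^ d.m) := by
        have : 1 ≤ E * E := by nlinarith
        nlinarith [Nat.zero_le (d.radix ^ d.m)]
      have h4 : E ^ 3 * d.radix ^ d.m = E * (E * (E * d.radix ^ d.m)) := by ring
      rw [h4]
      nlinarith
    rw [sum_range_succ, ← add_assoc] at hnext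
    -- Both branches lead to `σ'` with some flag in register `6`, possibly the old one, so that the
    -- rest of the body is treated only once.
    refine Run.le (Run.seq (c' := 20) (Q := fun τ => ∃ f : ℕ, τ = σ'.setReg 6 f ∧
        (f = 1 ↔ ∀ l < i + 1, d.digit s l + d.a l j ≤ d.b l))
      (Run.ite (.lt (.read (.reg h8) (hin'.b i hi)) (.add hmod (hAe σ' h8 hin'.n h4 rfl) ?_))
        (fun hlt => Run.assign (.const 0 (by positivity)) ⟨0, rfl, ?_⟩)
        (fun hlt => Run.skip ⟨f, ?_, ?_⟩)) ?_) ?_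
    · refine hB.lt_of_le 1 (by norm_num) ?_
      nlinarith
    · simp only [zero_ne_one, false_iff, not_forall]
      exact ⟨i, by omega, by omega⟩
    · cases σ'
      simp only [State.setReg, State.mk.injEq, and_true]
      rw [← h6]; simp
    · rw [hf]
      constructor
      · intro h l hl
        rcases Nat.lt_succ_iff_lt_or_eq.mp hl with h1 | rfl
        · exact h l h1
        · omega
      · exact fun h l hl => h l (by omega)
    · rintro _ ⟨f', rfl, hf'⟩
      refine Run.le (Run.seq_assign (.add (.reg (by simpa using h7)) (.mul (hAe _ (by simpa using h8)
        (by simpa using hin'.n) (by simpa using h4) rfl) (.reg (by simpa using h10))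
        ?_) hnext) (Run.seq_assign (.floorDiv (.reg (by simpa using h9)) (.reg (by simpa using h3))
        hR0.ne' hqB hRB) (Run.assign (.mul (.reg (by simpa using h10)) (.reg (by simpa using h3))
        (hB.lt_of_le_radix hw)) ?_))) (by simp [Expr.cost])
      · exact hB.lt_of_le 1 (by norm_num) (by simpa using haw)
      · simp only [CheckInv, State.setReg_reg]
        refine ⟨?_, ?_, ?_, f', ?_, hf'⟩
        · simp [sum_range_succ, add_assoc]
        · simp [Nat.div_div_eq_div_mul, pow_succ]
        · simp [pow_succ]
        · simp
    · simp only [Test.cost, Expr.cost, modE]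
      omega
  · rintro σ' ⟨h7, -, -, f, h6, hf⟩
    exact ⟨h7, f, h6, hf⟩
  · simp only [Expr.cost]
    omega

end RAM

/-! ### The dynamic program -/

namespace Data

variable (d : Data)

/-- The capacities used by `x`. -/
def load (x : ℕ → ℕ) (i : ℕ) : ℕ := ∑ j ∈ range d.n, d.a i j * x j

/-- The profit of `x`. -/
def profit (x : ℕ → ℕ) : ℕ := ∑ j ∈ range d.n, d.c j * x j

/-- The selection `x` respects the capacities. -/
def Packs (x : ℕ → ℕ) : Prop := ∀ i < d.m, d.load x i ≤ d.b i

/-- The code of the capacities used by `x`. -/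
def key (x : ℕ → ℕ) : ℕ := d.code (d.load x)

end Data

/-- Add one copy of item `j` to `x`. -/
def addItem (x : ℕ → ℕ) (j j' : ℕ) : ℕ := x j' + if j' = j then 1 else 0

namespace Data

variable (d : Data)

theorem sum_addItem {n : ℕ} (f x : ℕ → ℕ) {j : ℕ} (hj : j < n) :
    ∑ j' ∈ range n, f j' * addItem x j j' = ∑ j' ∈ range n, f j' * x j' + f j := by
  simp only [addItem, mul_add, sum_add_distrib, mul_ite, mul_one, mul_zero]
  rw [sum_ite_eq' (range n) j f, if_pos (mem_range.mpr hj)]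

variable {d}

theorem load_addItem (x : ℕ → ℕ) {j : ℕ} (hj : j < d.n) (i : ℕ) :
    d.load (addItem x j) i = d.load x i + d.a i j := sum_addItem _ _ hj

theorem profit_addItem (x : ℕ → ℕ) {j : ℕ} (hj : j < d.n) :
    d.profit (addItem x j) = d.profit x + d.c j := sum_addItem _ _ hj

theorem key_addItem (x : ℕ → ℕ) {j : ℕ} (hj : j < d.n) :
    d.key (addItem x j) = d.next (d.key x) j := by
  unfold key next
  rw [← code_add]
  exact d.code_congr fun i _ => load_addItem x hj i

theorem Packs.digit_key {x : ℕ → ℕ} (hx : d.Packs x) {i : ℕ} (hi : i < d.m) :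
    d.digit (d.key x) i = d.load x i := d.digit_code hx hi

theorem Packs.key_lt {x : ℕ → ℕ} (hx : d.Packs x) : d.key x < d.radix ^ d.m := d.code_lt hx

/-- Decoding is exact for a selection that packs, so the digits tested are its true loads. -/
theorem Packs.adm_iff {x : ℕ → ℕ} (hx : d.Packs x) {j : ℕ} (hj : j < d.n) :
    d.Adm (d.key x) j ↔ d.Packs (addItem x j) := by
  refine forall₂_congr fun i hi => ?_
  rw [hx.digit_key hi, load_addItem x hj]

theorem load_mono {x y : ℕ → ℕ} (h : ∀ j < d.n, x j ≤ y j) (i : ℕ) : d.load x i ≤ d.load y i :=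
  sum_le_sum fun j hj => Nat.mul_le_mul_left _ (h j (mem_range.mp hj))

theorem Packs.mono {x y : ℕ → ℕ} (hy : d.Packs y) (h : ∀ j < d.n, x j ≤ y j) : d.Packs x :=
  fun i hi => (load_mono h i).trans (hy i hi)

theorem packs_zero : d.Packs 0 := fun i _ => by simp [load]

theorem key_zero : d.key 0 = 0 := by simp [key, code, load]

theorem profit_zero : d.profit 0 = 0 := by simp [profit]

end Data

/-- Change one entry of a table. -/
def upd (f : ℕ → ℕ → ℕ) (s l v : ℕ) : ℕ → ℕ → ℕ := fun s' l' => if s' = s ∧ l' = l then v else f s' l'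

/-- How often item `j` occurs among the first `l` items of the list `it`. -/
def mult (it : ℕ → ℕ) (l j : ℕ) : ℕ := ((range l).filter fun p => it p = j).card

theorem mult_succ (it : ℕ → ℕ) (l j : ℕ) :
    mult it (l + 1) j = mult it l j + if it l = j then 1 else 0 := by
  unfold mult
  rw [range_add_one, filter_insert]
  split_ifs
  · rw [card_insert_of_notMem (by simp)]
  · simp

/-- The tables of the dynamic program: in layer `l`, the entry `ls q l` is the code number `q` that
has been found; for a code `s` the entry `nv s l` is one plus the best profit (or zero, if `s` has
not been found), `pa s l` the code in layer `l - 1` that it stems from, and `tk s l` tells whether an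
item was added. -/
structure Table where
  ls : ℕ → ℕ → ℕ
  nv : ℕ → ℕ → ℕ
  pa : ℕ → ℕ → ℕ
  tk : ℕ → ℕ → ℕ
  cnt : ℕ

namespace Table

/-- Offer the code `s` with entry `v` to layer `l`. -/
def relax (T : Table) (l s v par fl : ℕ) : Table where
  -- Entries are one plus a profit, so zero means that the code is new. Only then is it listed,
  -- which keeps the list free of repetitions.
  ls := if T.nv s l = 0 then upd T.ls T.cnt l s else T.ls
  cnt := if T.nv s l = 0 then T.cnt + 1 else T.cnt
  nv := if T.nv s l < v then upd T.nv s l v else T.nv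
  pa := if T.nv s l < v then upd T.pa s l par else T.pa
  tk := if T.nv s l < v then upd T.tk s l fl else T.tk

/-- The selection that is recorded for the code `s` in layer `l`. -/
def wit (T : Table) (it : ℕ → ℕ) : ℕ → ℕ → ℕ → ℕ
  | 0, _ => 0
  | l + 1, s => if T.tk s (l + 1) = 1 then addItem (T.wit it l (T.pa s (l + 1))) (it l)
      else T.wit it l (T.pa s (l + 1))

/-- The recorded selections are correct in layer `l`. -/
def Sound (T : Table) (d : Data) (it : ℕ → ℕ) (l : ℕ) : Prop :=
  ∀ s, T.nv s l ≠ 0 → d.key (T.wit it l s) = s ∧ d.Packs (T.wit it l s) ∧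
    T.nv s l = 1 + d.profit (T.wit it l s) ∧ (∀ j, T.wit it l s j ≤ mult it l j) ∧
    (0 < l → T.nv (T.pa s l) (l - 1) ≠ 0)

/-- The list of codes is correct in layer `l`. -/
structure Lists (T : Table) (l cnt : ℕ) : Prop where
  ne : ∀ q < cnt, T.nv (T.ls q l) l ≠ 0
  ex : ∀ s, T.nv s l ≠ 0 → ∃ q < cnt, T.ls q l = s
  inj : ∀ q < cnt, ∀ q' < cnt, T.ls q l = T.ls q' l → q = q'

/-- The best selections have been found in layer `l`. -/
def Complete (T : Table) (d : Data) (it : ℕ → ℕ) (l : ℕ) : Prop :=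
  ∀ x : ℕ → ℕ, d.Packs x → (∀ j, x j ≤ mult it l j) → 1 + d.profit x ≤ T.nv (d.key x) l

/-- Layers `≤ l` are computed, the others are empty. -/
structure Done (T : Table) (d : Data) (it : ℕ → ℕ) (l cnt : ℕ) : Prop where
  sound : ∀ k ≤ l, T.Sound d it k
  lists : T.Lists l cnt
  complete : T.Complete d it l
  empty : ∀ k, l < k → ∀ s, T.nv s k = 0

/-- Layers `≤ l` are computed, and layer `l + 1` takes into account the first `q` codes of
layer `l`. -/
structure Partial (T : Table) (d : Data) (it : ℕ → ℕ) (l cnt q : ℕ) : Prop where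
  sound : ∀ k ≤ l + 1, T.Sound d it k
  lists : T.Lists l cnt
  lists_succ : T.Lists (l + 1) T.cnt
  complete : T.Complete d it l
  empty : ∀ k, l + 1 < k → ∀ s, T.nv s k = 0
  skip : ∀ p < q, T.nv (T.ls p l) l ≤ T.nv (T.ls p l) (l + 1)
  take : ∀ p < q, d.Adm (T.ls p l) (it l) →
    T.nv (T.ls p l) l + d.c (it l) ≤ T.nv (d.next (T.ls p l) (it l)) (l + 1)

variable {T : Table} {d : Data} {it : ℕ → ℕ} {l cnt q : ℕ}

/-- Layer `l + 1` is still empty, so resetting the counter is all that is needed to begin it. -/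
theorem Done.partial (h : T.Done d it l cnt) : Partial { T with cnt := 0 } d it l cnt 0 where
  sound k hk := by
    rcases Nat.lt_or_ge l k with h1 | h1
    · intro s hs
      exact absurd (h.empty k h1 s) hs
    · have key : ∀ k s, wit { T with cnt := 0 } it k s = T.wit it k s := by
        intro k
        induction k with
        | zero => intro s; rfl
        | succ k ih => intro s; simp only [wit, ih]
      intro s hs
      rw [key]
      exact h.sound k h1 s hs
  lists := ⟨h.lists.ne, h.lists.ex, h.lists.inj⟩
  lists_succ := ⟨by simp, fun s hs => absurd (h.empty _ (Nat.lt_succ_self l) s) hs, by simp⟩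
  complete := h.complete
  empty k hk := h.empty k (by omega)
  skip := by simp
  take := by simp

/-- A selection from `l + 1` list entries either is available in layer `l` already, or uses all
copies of `it l` listed so far. In the second case one copy is removed, and the `take` inequality is
applied to the code of the rest. -/
theorem Partial.done (h : T.Partial d it l cnt cnt) (hn : it l < d.n) :
    T.Done d it (l + 1) T.cnt where
  sound := h.sound
  lists := h.lists_succ
  empty := h.empty
  complete := by
    intro x hx hm
    by_cases hle : ∀ j, x j ≤ mult it l j
    · have h1 := h.complete x hx hle
      obtain ⟨p, hp, hps⟩ := h.lists.ex (d.key x) (by omega)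
      have h2 := h.skip p hp
      rw [hps] at h2
      omega
    · push Not at hle
      obtain ⟨j, hj⟩ := hle
      have hmj := hm j
      rw [mult_succ] at hmj
      have hitj : it l = j := by
        by_contra hne
        rw [if_neg hne] at hmj
        omega
      rw [if_pos hitj] at hmj
      let y : ℕ → ℕ := fun j' => if j' = j then x j - 1 else x j'
      have hxy : x = addItem y (it l) := by
        ext j'
        simp only [addItem, y, hitj]
        split_ifs with h'
        · subst h'; omega
        · omega
      have hyx : ∀ j', y j' ≤ x j' := by
        intro j'
        simp only [y]
        split_ifs with h'
        · subst h'; omega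
        · omega
      have hy : d.Packs y := hx.mono fun j' _ => hyx j'
      have hym : ∀ j', y j' ≤ mult it l j' := by
        intro j'
        have := hm j'
        rw [mult_succ] at this
        simp only [y]
        split_ifs with h'
        · subst h'; omega
        · rw [hitj, if_neg (Ne.symm h')] at this
          omega
      have h1 := h.complete y hy hym
      obtain ⟨p, hp, hps⟩ := h.lists.ex (d.key y) (by omega)
      have h2 := h.take p hp
      rw [hps] at h2
      have h3 := h2 ((hy.adm_iff hn).mpr (hxy ▸ hx))
      rw [← Data.key_addItem y hn, ← hxy] at h3
      rw [hxy, Data.profit_addItem y hn, ← hxy]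
      omega

section Relax

variable {s v par fl : ℕ}

theorem relax_nv_of_ne {l' : ℕ} (hl : l' ≠ l) (s' : ℕ) :
    (T.relax l s v par fl).nv s' l' = T.nv s' l' := by
  simp only [relax]
  split_ifs
  · simp [upd, hl]
  · rfl

theorem relax_pa_of_ne {l' : ℕ} (hl : l' ≠ l) (s' : ℕ) :
    (T.relax l s v par fl).pa s' l' = T.pa s' l' := by
  simp only [relax]
  split_ifs
  · simp [upd, hl]
  · rfl

theorem relax_tk_of_ne {l' : ℕ} (hl : l' ≠ l) (s' : ℕ) :
    (T.relax l s v par fl).tk s' l' = T.tk s' l' := by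
  simp only [relax]
  split_ifs
  · simp [upd, hl]
  · rfl

theorem relax_ls_of_ne {l' : ℕ} (hl : l' ≠ l) (q : ℕ) :
    (T.relax l s v par fl).ls q l' = T.ls q l' := by
  simp only [relax]
  split_ifs
  · simp [upd, hl]
  · rfl

theorem le_relax_nv (s' l' : ℕ) : T.nv s' l' ≤ (T.relax l s v par fl).nv s' l' := by
  simp only [relax]
  split_ifs with h
  · simp only [upd]
    split_ifs with h'
    · obtain ⟨rfl, rfl⟩ := h'
      exact h.le
    · exact le_rfl
  · exact le_rfl

theorem le_relax_nv_self : v ≤ (T.relax l s v par fl).nv s l := by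
  simp only [relax]
  split_ifs with h
  · simp [upd]
  · omega

/-- Parents lie in the preceding layer, so a change in layer `l` does not disturb selections
recorded below it. -/
theorem relax_wit_of_lt (k : ℕ) (hk : k < l) (s' : ℕ) :
    (T.relax l s v par fl).wit it k s' = T.wit it k s' := by
  induction k generalizing s' with
  | zero => rfl
  | succ k ih =>
    simp only [wit]
    rw [relax_tk_of_ne hk.ne, relax_pa_of_ne hk.ne, ih (by omega)]

theorem Lists.relax_of_ne {l' : ℕ} (hl : l' ≠ l) (h : T.Lists l' cnt) :
    (T.relax l s v par fl).Lists l' cnt := by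
  constructor
  · intro q hq
    rw [relax_ls_of_ne hl, relax_nv_of_ne hl]
    exact h.ne q hq
  · intro s'
    simp only [relax_ls_of_ne hl, relax_nv_of_ne hl]
    exact h.ex s'
  · intro q hq q' hq'
    rw [relax_ls_of_ne hl, relax_ls_of_ne hl]
    exact h.inj q hq q' hq'

/-- Positivity of `v` ensures that a newly listed code counts as found. -/
theorem Lists.relax_self (hv : 0 < v) (h : T.Lists l T.cnt) :
    (T.relax l s v par fl).Lists l (T.relax l s v par fl).cnt := by
  by_cases h0 : T.nv s l = 0
  · have hls : ∀ q, (T.relax l s v par fl).ls q l = if q = T.cnt then s else T.ls q l := by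
      intro q; simp [relax, h0, upd]
    have hcnt : (T.relax l s v par fl).cnt = T.cnt + 1 := by simp [relax, h0]
    have hnv : ∀ s', (T.relax l s v par fl).nv s' l = if s' = s then v else T.nv s' l := by
      intro s'; simp [relax, h0, hv, upd]
    rw [hcnt]
    have hneS : ∀ q < T.cnt, T.ls q l ≠ s := fun q hq he => h.ne q hq (he ▸ h0)
    constructor
    · intro q hq
      rw [hls, hnv]
      split_ifs with h1 h2 h2
      · omega
      · exact absurd rfl h2
      · omega
      · exact h.ne q (by omega)
    · intro s' hs'
      rw [hnv] at hs'
      split_ifs at hs' with h1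
      · exact ⟨T.cnt, by omega, by rw [hls, if_pos rfl, h1]⟩
      · obtain ⟨q, hq, hqs⟩ := h.ex s' hs'
        exact ⟨q, by omega, by rw [hls, if_neg (by omega), hqs]⟩
    · intro q hq q' hq'
      rw [hls, hls]
      split_ifs with h1 h2 h2
      · omega
      · exact fun he => absurd he.symm (hneS q' (by omega))
      · exact fun he => absurd he (hneS q (by omega))
      · exact h.inj q (by omega) q' (by omega)
  · have hls : (T.relax l s v par fl).ls = T.ls := by simp [relax, h0]
    have hcnt : (T.relax l s v par fl).cnt = T.cnt := by simp [relax, h0]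
    have hnv : ∀ s', (T.relax l s v par fl).nv s' l ≠ 0 ↔ T.nv s' l ≠ 0 := by
      intro s'
      have h1 := le_relax_nv (T := T) (l := l) (s := s) (v := v) (par := par) (fl := fl) s' l
      refine ⟨fun hne h2 => hne ?_, fun hne => by omega⟩
      simp only [relax]
      split_ifs with h3
      · simp only [upd]
        rw [if_neg (by rintro ⟨rfl, -⟩; exact h0 h2), h2]
      · exact h2
    rw [hcnt]
    constructor
    · intro q hq
      rw [hls, hnv]
      exact h.ne q hq
    · intro s' hs'
      rw [hls]
      exact h.ex s' ((hnv s').mp hs')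
    · rw [hls]
      exact h.inj

/-- The offer `s`, `v` from the code `par` in layer `l` to layer `l + 1` is justified. -/
structure Offer (T : Table) (d : Data) (it : ℕ → ℕ) (l s v par fl : ℕ) (x : ℕ → ℕ) : Prop where
  par_ne : T.nv par l ≠ 0
  wit : x = if fl = 1 then addItem (T.wit it l par) (it l) else T.wit it l par
  key : d.key x = s
  packs : d.Packs x
  val : v = 1 + d.profit x
  le : ∀ j, x j ≤ mult it (l + 1) j

/-- In the tables of values and pointers only the entry of `s` in layer `l + 1` can change, and only
to a strictly better offer. Its selection becomes `x`; all others keep theirs. Values never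
decrease, so `skip` and `take` persist. -/
theorem Partial.relax (h : T.Partial d it l cnt q) {x : ℕ → ℕ} (ho : T.Offer d it l s v par fl x) :
    (T.relax (l + 1) s v par fl).Partial d it l cnt q where
  sound k hk s' hs' := by
    have hl1 : l ≠ l + 1 := by omega
    rcases Nat.lt_or_ge k (l + 1) with hkl | hkl
    · rw [relax_nv_of_ne hkl.ne] at hs'
      rw [relax_wit_of_lt k hkl, relax_nv_of_ne hkl.ne, relax_pa_of_ne hkl.ne,
        relax_nv_of_ne (by omega)]
      exact h.sound k hk s' hs'
    · obtain rfl : k = l + 1 := by omega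
      by_cases hc : s' = s ∧ T.nv s (l + 1) < v
      · obtain ⟨rfl, hlt⟩ := hc
        have hw : (T.relax (l + 1) s' v par fl).wit it (l + 1) s' = x := by
          have htk : (T.relax (l + 1) s' v par fl).tk s' (l + 1) = fl := by
            simp [Table.relax, hlt, upd]
          have hpa : (T.relax (l + 1) s' v par fl).pa s' (l + 1) = par := by
            simp [Table.relax, hlt, upd]
          rw [Table.wit, htk, hpa, relax_wit_of_lt l (by omega), ho.wit]
        have hnv : (T.relax (l + 1) s' v par fl).nv s' (l + 1) = v := by
          simp [Table.relax, hlt, upd]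
        have hpa : (T.relax (l + 1) s' v par fl).pa s' (l + 1) = par := by
          simp [Table.relax, hlt, upd]
        rw [hw, hnv, hpa, Nat.add_sub_cancel, relax_nv_of_ne hl1]
        exact ⟨ho.key, ho.packs, ho.val, ho.le, fun _ => ho.par_ne⟩
      · have hneq : ∀ f g : ℕ → ℕ → ℕ, ∀ w, (if T.nv s (l + 1) < v then upd f s (l + 1) w else f)
            s' (l + 1) = f s' (l + 1) := by
          intro f g w
          split_ifs with h1
          · have : s' ≠ s := fun he => hc ⟨he, h1⟩
            simp [upd, this]
          · rfl
        have hnv : (T.relax (l + 1) s v par fl).nv s' (l + 1) = T.nv s' (l + 1) :=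
          hneq T.nv T.nv _
        have hpa : (T.relax (l + 1) s v par fl).pa s' (l + 1) = T.pa s' (l + 1) :=
          hneq T.pa T.pa _
        have htk : (T.relax (l + 1) s v par fl).tk s' (l + 1) = T.tk s' (l + 1) :=
          hneq T.tk T.tk _
        have hw : (T.relax (l + 1) s v par fl).wit it (l + 1) s' = T.wit it (l + 1) s' := by
          rw [Table.wit, Table.wit, htk, hpa, relax_wit_of_lt l (by omega)]
        rw [hnv] at hs'
        rw [hw, hnv, hpa, relax_nv_of_ne (by omega)]
        exact h.sound (l + 1) le_rfl s' hs'
  lists := h.lists.relax_of_ne (by omega)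
  lists_succ := h.lists_succ.relax_self (by rw [ho.val]; omega)
  complete := by
    intro y hy hm
    rw [relax_nv_of_ne (by omega)]
    exact h.complete y hy hm
  empty k hk s' := by
    rw [relax_nv_of_ne (by omega)]
    exact h.empty k hk s'
  skip p hp := by
    rw [relax_ls_of_ne (by omega), relax_nv_of_ne (by omega)]
    exact (h.skip p hp).trans (le_relax_nv _ _)
  take p hp hadm := by
    rw [relax_ls_of_ne (by omega)] at hadm ⊢
    rw [relax_nv_of_ne (by omega)]
    exact (h.take p hp hadm).trans (le_relax_nv _ _)

theorem Partial.offer_skip (h : T.Partial d it l cnt q) (hq : q < cnt) :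
    T.Offer d it l (T.ls q l) (T.nv (T.ls q l) l) (T.ls q l) 0 (T.wit it l (T.ls q l)) := by
  have hne := h.lists.ne q hq
  obtain ⟨h1, h2, h3, h4, -⟩ := h.sound l (by omega) _ hne
  exact ⟨hne, by simp, h1, h2, h3, fun j => (h4 j).trans (by rw [mult_succ]; omega)⟩

theorem Partial.offer_take (h : T.Partial d it l cnt q) (hq : q < cnt) (hn : it l < d.n)
    (ha : d.Adm (T.ls q l) (it l)) :
    T.Offer d it l (d.next (T.ls q l) (it l)) (T.nv (T.ls q l) l + d.c (it l)) (T.ls q l) 1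
      (addItem (T.wit it l (T.ls q l)) (it l)) := by
  have hne := h.lists.ne q hq
  obtain ⟨h1, h2, h3, h4, -⟩ := h.sound l (by omega) _ hne
  refine ⟨hne, by simp, ?_, ?_, ?_, fun j => ?_⟩
  · rw [Data.key_addItem _ hn, h1]
  · rw [← h2.adm_iff hn, h1]
    exact ha
  · rw [Data.profit_addItem _ hn, h3]; omega
  · rw [mult_succ, addItem]
    have := h4 j
    have h5 : (j = it l) = (it l = j) := propext eq_comm
    simp only [h5]
    omega

/-- Process the code number `q` of layer `l`. -/
noncomputable def process (T : Table) (d : Data) (it : ℕ → ℕ) (l q : ℕ) : Table :=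
  open Classical in
  let T' := T.relax (l + 1) (T.ls q l) (T.nv (T.ls q l) l) (T.ls q l) 0
  if d.Adm (T.ls q l) (it l) then
    T'.relax (l + 1) (d.next (T.ls q l) (it l)) (T.nv (T.ls q l) l + d.c (it l)) (T.ls q l) 1
  else T'

/-- The code is first offered unchanged and then, if the item fits, with the item added; these
offers yield `skip` and `take` for `p = q`. -/
theorem Partial.process (h : T.Partial d it l cnt q) (hq : q < cnt) (hn : it l < d.n) :
    (T.process d it l q).Partial d it l cnt (q + 1) := by
  have hl : l ≠ l + 1 := by omega
  have h1 := h.relax (h.offer_skip hq)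
  have hs : T.nv (T.ls q l) l ≤ (T.relax (l + 1) (T.ls q l) (T.nv (T.ls q l) l)
      (T.ls q l) 0).nv (T.ls q l) (l + 1) := le_relax_nv_self
  set T' := T.relax (l + 1) (T.ls q l) (T.nv (T.ls q l) l) (T.ls q l) 0 with hT'
  have hls : T'.ls q l = T.ls q l := relax_ls_of_ne hl q
  have hnv : T'.nv (T.ls q l) l = T.nv (T.ls q l) l := relax_nv_of_ne hl _
  unfold Table.process
  simp only [← hT']
  split_ifs with ha
  · have h2 := h1.offer_take hq hn (by rwa [hls])
    rw [hls, hnv] at h2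
    have h3 := h1.relax h2
    refine { h3 with skip := fun p hp => ?_, take := fun p hp hadm => ?_ }
    · rcases Nat.lt_succ_iff_lt_or_eq.mp hp with h4 | rfl
      · exact h3.skip p h4
      · rw [relax_ls_of_ne hl, relax_nv_of_ne hl, hls, hnv]
        exact hs.trans (le_relax_nv _ _)
    · rcases Nat.lt_succ_iff_lt_or_eq.mp hp with h4 | rfl
      · exact h3.take p h4 hadm
      · rw [relax_ls_of_ne hl, relax_nv_of_ne hl, hls, hnv]
        exact le_relax_nv_self
  · refine { h1 with skip := fun p hp => ?_, take := fun p hp hadm => ?_ }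
    · rcases Nat.lt_succ_iff_lt_or_eq.mp hp with h4 | rfl
      · exact h1.skip p h4
      · rw [hls, hnv]
        exact hs
    · rcases Nat.lt_succ_iff_lt_or_eq.mp hp with h4 | rfl
      · exact h1.take p h4 hadm
      · rw [hls] at hadm
        exact absurd hadm ha

end Relax

/-- Layer `0` contains only the empty selection: code zero, with entry one for profit zero. -/
theorem done_init : Done ⟨fun _ _ => 0, fun s l => if s = 0 ∧ l = 0 then 1 else 0, fun _ _ => 0,
    fun _ _ => 0, 1⟩ d it 0 1 where
  sound k hk s hs := by
    obtain rfl : k = 0 := by omega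
    have : s = 0 := by
      by_contra h
      simp [h] at hs
    subst this
    simp only [wit]
    refine ⟨Data.key_zero, Data.packs_zero, by simp [Data.profit_zero], by simp, by simp⟩
  lists := ⟨by simp, fun s hs => ⟨0, by omega, by by_contra h; simp [Ne.symm h] at hs⟩,
    fun q hq q' hq' _ => by omega⟩
  complete x hx hm := by
    have : x = 0 := by ext j; simpa [mult] using hm j
    subst this
    rw [Data.key_zero, Data.profit_zero]
    simp
  empty k hk s := by simp [hk.ne']

end Table

/-! ### The dynamic program on the machine -/

namespace Table

variable {T : Table} {d : Data} {it : ℕ → ℕ} {l cnt q : ℕ}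

theorem Sound.lt (h : T.Sound d it l) {s : ℕ} (hs : T.nv s l ≠ 0) : s < d.radix ^ d.m := by
  obtain ⟨h1, h2, -⟩ := h s hs
  rw [← h1]
  exact h2.key_lt

/-- A crude bound that serves only to see that counters fit into words. The running time rests on
the bound by minors. -/
theorem Lists.cnt_le (h : T.Lists l cnt) (hs : T.Sound d it l) : cnt ≤ d.radix ^ d.m := by
  have := card_le_card_of_injOn (s := range cnt) (t := range (d.radix ^ d.m)) (fun q => T.ls q l)
    (fun q hq => by
      simp only [coe_range, Set.mem_Iio]
      exact hs.lt (h.ne q (by simpa using hq)))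
    (fun q hq q' hq' he => h.inj q (by simpa using hq) q' (by simpa using hq') he)
  simpa using this

theorem Sound.nv_le (h : T.Sound d it l) {E : ℕ} (hn : d.n + 1 ≤ E) (hc : ∀ j < d.n, d.c j ≤ E)
    (hm : ∀ j, mult it l j ≤ E) (s : ℕ) : T.nv s l ≤ E ^ 3 := by
  by_cases hs : T.nv s l = 0
  · rw [hs]; exact Nat.zero_le _
  obtain ⟨-, -, h3, h4, -⟩ := h s hs
  have h5 : d.profit (T.wit it l s) ≤ d.n * (E * E) := by
    refine (sum_le_card_nsmul _ _ (E * E) fun j hj => ?_).trans (by simp)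
    exact Nat.mul_le_mul (hc j (mem_range.mp hj)) ((h4 j).trans (hm j))
  have h6 : (d.n + 1) * (E * E) ≤ E * (E * E) := Nat.mul_le_mul_right _ hn
  have h7 : 1 ≤ E * E := by nlinarith
  rw [h3, show E ^ 3 = E * (E * E) by ring]
  nlinarith

end Table

theorem mult_mono (it : ℕ → ℕ) {l l' : ℕ} (h : l ≤ l') (j : ℕ) : mult it l j ≤ mult it l' j :=
  card_le_card (filter_subset_filter _ (range_subset_range.mpr h))

namespace RAM

/-- The array `g` holds the table `f` with columns `0, …, L`. -/
def Rep2 (L : ℕ) (g : ℤ → ℚ) (f : ℕ → ℕ → ℕ) : Prop :=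
  ∀ s l, l ≤ L → g ((s * (L + 1) + l : ℕ) : ℤ) = f s l

theorem addr_inj {L s s' l l' : ℕ} (hl : l ≤ L) (hl' : l' ≤ L)
    (h : s * (L + 1) + l = s' * (L + 1) + l') : s = s' ∧ l = l' := by
  have h1 := congrArg (· % (L + 1)) h
  have h2 := congrArg (· / (L + 1)) h
  simp only [Nat.mul_add_mod_of_lt (Nat.lt_succ_of_le hl), Nat.mul_add_mod_self_right,
    Nat.mod_eq_of_lt (Nat.lt_succ_of_le hl')] at h1
  subst h1
  exact ⟨Nat.eq_of_mul_eq_mul_right (Nat.succ_pos L) (by simpa using h), rfl⟩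

theorem Rep2.upd {L : ℕ} {σ : State} {a a' : ℕ} {f : ℕ → ℕ → ℕ} (h : Rep2 L (σ.arr a) f)
    {s l v : ℕ} (hl : l ≤ L) (ha : a' = a) :
    Rep2 L ((σ.setCell a' ((s * (L + 1) + l : ℕ) : ℤ) v).arr a) (upd f s l v) := by
  intro s' l' hl'
  rw [State.setCell_arr, _root_.upd]
  by_cases hc : s' = s ∧ l' = l
  · obtain ⟨rfl, rfl⟩ := hc
    simp [ha]
  · rw [if_neg hc, if_neg, h s' l' hl']
    rintro ⟨-, he⟩
    exact hc (addr_inj hl' hl (by exact_mod_cast he))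

theorem Rep2.setCell {L : ℕ} {σ : State} {a a' : ℕ} {f : ℕ → ℕ → ℕ} (h : Rep2 L (σ.arr a) f)
    {z : ℤ} {v : ℚ} (ha : a ≠ a') : Rep2 L ((σ.setCell a' z v).arr a) f := by
  intro s' l' hl'
  rw [State.setCell_arr, if_neg (by simp [ha]), h s' l' hl']

/-- The tables of the dynamic program are held by the arrays `9`, `10`, `11`, `12`. -/
structure Rep (L : ℕ) (σ : State) (T : Table) : Prop where
  nv : Rep2 L (σ.arr 9) T.nv
  pa : Rep2 L (σ.arr 10) T.pa
  tk : Rep2 L (σ.arr 11) T.tk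
  ls : Rep2 L (σ.arr 12) T.ls

theorem Rep.frame {L : ℕ} {σ σ' : State} {T : Table} {W A : List ℕ} (h : Rep L σ T)
    (hf : Frame W A σ σ') (hA : 9 ∉ A ∧ 10 ∉ A ∧ 11 ∉ A ∧ 12 ∉ A := by decide) : Rep L σ' T where
  nv := by rw [hf.2 9 hA.1]; exact h.nv
  pa := by rw [hf.2 10 hA.2.1]; exact h.pa
  tk := by rw [hf.2 11 hA.2.2.1]; exact h.tk
  ls := by rw [hf.2 12 hA.2.2.2]; exact h.ls

/-- The address of the entry in row `s` and column `l` of a table with columns `0, …, reg 16`. -/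
def addrE (s l : Expr) : Expr := .add (.mul s (.add (.reg 16) (.const 1))) l

/-- Word length and magnitudes of the dynamic program with `L` items `it`. -/
structure DPBound (d : Data) (B E L : ℕ) (it : ℕ → ℕ) : Prop extends d.Bound B E where
  len_le : L + 1 ≤ E ^ 6
  it_lt : ∀ p < L, it p < d.n
  mult_le : ∀ j, mult it L j ≤ E

variable {S : LPSolver} {B E : ℕ} {d : Data} {σ : State} {L : ℕ} {it : ℕ → ℕ} {T : Table}

theorem DPBound.addr_lt (hB : DPBound d B E L it) {s l : ℕ} (hs : s ≤ d.radix ^ d.m)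
    (hl : l ≤ L) : s * (L + 1) + l < 2 ^ B := by
  refine hB.lt_of_le 7 (by norm_num) ?_
  have h1 : (s + 1) * (L + 1) ≤ (2 * d.radix ^ d.m) * E ^ 6 :=
    Nat.mul_le_mul (by have : 0 < d.radix ^ d.m := pow_pos d.radix_pos _
                       omega) hB.len_le
  have h2 := hB.two
  have h3 : E ^ 7 * d.radix ^ d.m = (E * d.radix ^ d.m) * E ^ 6 := by ring
  have h4 : (2 * d.radix ^ d.m) * E ^ 6 ≤ (E * d.radix ^ d.m) * E ^ 6 :=
    Nat.mul_le_mul_right _ (Nat.mul_le_mul_right _ h2)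
  have h5 : (s + 1) * (L + 1) = s * (L + 1) + (L + 1) := by ring
  omega

theorem DPBound.ev_addr (hB : DPBound d B E L it) {s l : ℕ} {e f : Expr} (he : Ev B σ e s)
    (hf : Ev B σ f l) (h16 : σ.reg 16 = L) (hs : s ≤ d.radix ^ d.m)
    (hl : l ≤ L) : Ev B σ (addrE e f) (s * (L + 1) + l) := by
  have := hB.neZero
  have h := hB.addr_lt hs hl
  refine .add (.mul he (.add (.reg h16) (.const 1 (Nat.one_lt_two_pow (NeZero.ne B))) ?_) ?_) hf h
  · exact hB.lt_of_le_pow 6 (by norm_num) hB.len_le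
  · omega

/-- Offer the code in register `rs` with entry `ve` to layer `reg 18 + 1`. -/
def relaxP (rs : ℕ) (ve : Expr) (fl : ℕ) : Prog :=
  .seq (.assign 24 (addrE (.reg rs) (.add (.reg 18) (.const 1))))
  (.seq (.ite (.eq (.read 9 (.reg 24)) (.const 0))
    (.seq (.write 12 (addrE (.reg 20) (.add (.reg 18) (.const 1))) (.reg rs))
      (.assign 20 (.add (.reg 20) (.const 1)))) .skip)
  (.ite (.lt (.read 9 (.reg 24)) ve)
    (.seq (.write 9 (.reg 24) ve) (.seq (.write 10 (.reg 24) (.reg 5))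
      (.write 11 (.reg 24) (.const fl)))) .skip))

/-- The entry `ve` is evaluated after the list and its counter may have changed, hence `hve` speaks
of all states that differ from `σ` only in the scratch registers and tables. -/
theorem run_relaxP (hB : DPBound d B E L it) (hT : Rep L σ T) {rs l s v par fl : ℕ} {ve : Expr}
    (hrs : rs ≠ 20 ∧ rs ≠ 24) (h16 : σ.reg 16 = L) (h18 : σ.reg 18 = l) (hl : l + 1 ≤ L)
    (h20 : σ.reg 20 = T.cnt) (hs : σ.reg rs = s) (h5 : σ.reg 5 = par)
    (hve : ∀ τ : State, Frame [20, 24] [9, 10, 11, 12] σ τ → Ev B τ ve v) (hfl : fl ≤ 1)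
    (hsB : s < d.radix ^ d.m) (hcB : T.cnt ≤ d.radix ^ d.m) :
    Run S B (relaxP rs ve fl) σ (50 + 2 * ve.cost) fun σ' =>
      Rep L σ' (T.relax (l + 1) s v par fl) ∧ σ'.reg 20 = (T.relax (l + 1) s v par fl).cnt := by
  have := hB.neZero
  have h1B := Nat.one_lt_two_pow (NeZero.ne B)
  have hlB : l + 1 < 2 ^ B := hB.lt_of_le_pow 6 (by norm_num) (by have := hB.len_le; omega)
  have hcB' : T.cnt + 1 < 2 ^ B := hB.lt_of_le 1 (by norm_num) (by
    have := hB.two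
    have : 0 < d.radix ^ d.m := pow_pos d.radix_pos _
    nlinarith)
  set z := s * (L + 1) + (l + 1) with hz
  refine Run.le (Run.seq_assign (k := z) (hB.ev_addr (.reg hs) (.add (.reg h18) (.const 1 h1B) hlB) h16
    hsB.le hl) (Run.seq (c' := 15 + 2 * ve.cost) (Q := fun τ => Frame [20, 24] [12] σ τ ∧
      τ.reg 24 = z ∧ τ.reg 20 = (T.relax (l + 1) s v par fl).cnt ∧
      Rep2 L (τ.arr 12) (T.relax (l + 1) s v par fl).ls) (Run.ite (c := 16) (c' := 1)
    (.eq (.read (z := z) (.reg (by simp)) (hT.nv s (l + 1) hl)) (.const 0 (by positivity)))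
    (fun h0 => ?_) (fun h0 => ?_)) ?_)) ?_
  · refine Run.le (Run.seq_write (hB.ev_addr (s := T.cnt) (.reg (by simpa using h20)) (.add (.reg (by simpa using h18))
      (.const 1 h1B) hlB) (by simpa using h16) hcB hl) (.reg (k := s) (by simpa [hrs] using hs))
      (Run.assign (.add (.reg (k := T.cnt) (by simpa using h20)) (.const 1 h1B) hcB') ⟨⟨?_, ?_⟩, ?_, ?_, ?_⟩))
      (by simp [Expr.cost, addrE])
    · intro r hr
      simp only [List.mem_cons, not_or] at hr
      simp [hr]
    · intro a ha
      simp only [List.mem_singleton] at ha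
      funext y
      simp [ha]
    · simp
    · simp [Table.relax, h0]
    · simp only [Table.relax, h0, if_true, State.setReg_arr]
      exact Rep2.upd (σ := σ.setReg 24 z) hT.ls hl rfl
  · refine Run.skip ⟨(frame_setReg _ _ _).mono (by simp) (by simp), by simp, ?_, ?_⟩
    · simp [Table.relax, h0, h20]
    · simpa [Table.relax, h0] using hT.ls
  · rintro τ ⟨hf, h24, hc, hls⟩
    have hnv : Rep2 L (τ.arr 9) T.nv := by rw [hf.2 9 (by simp)]; exact hT.nv
    have hpa : Rep2 L (τ.arr 10) T.pa := by rw [hf.2 10 (by simp)]; exact hT.pa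
    have htk : Rep2 L (τ.arr 11) T.tk := by rw [hf.2 11 (by simp)]; exact hT.tk
    have hve' := hve τ (hf.mono (by simp) (by simp))
    have h5' : τ.reg 5 = par := by rw [hf.1 5 (by simp), h5]
    refine Run.le (Run.ite (.lt (.read (z := z) (.reg h24) (hnv s (l + 1) hl)) hve')
      (fun hlt => Run.seq_write (z := z) (.reg h24) hve' (Run.seq_write (z := z) (.reg (by simpa using h24))
        (.reg (k := par) (by simpa using h5')) (Run.write (z := z) (.reg (by simpa using h24))
        (.const fl (by omega)) ⟨⟨?_, ?_, ?_, ?_⟩, ?_⟩)))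
      (fun hlt => Run.skip ⟨⟨?_, ?_, ?_, ?_⟩, ?_⟩)) ?_
    · simp only [Table.relax, hlt, if_true]
      exact ((hnv.upd hl rfl).setCell (by simp)).setCell (by simp)
    · simp only [Table.relax, hlt, if_true]
      exact (Rep2.upd (hpa.setCell (by simp)) hl rfl).setCell (by simp)
    · simp only [Table.relax, hlt, if_true]
      exact Rep2.upd ((htk.setCell (by simp)).setCell (by simp)) hl rfl
    · exact ((hls.setCell (by simp)).setCell (by simp)).setCell (by simp)
    · simpa using hc
    · simp only [Table.relax, hlt, if_false]
      exact hnv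
    · simp only [Table.relax, hlt, if_false]
      exact hpa
    · simp only [Table.relax, hlt, if_false]
      exact htk
    · exact hls
    · exact hc
    · simp only [Test.cost, Expr.cost]
      omega
  · simp only [Test.cost, Expr.cost, addrE]
    omega

/-- Process the code number `reg 21` of layer `reg 18`, with item `reg 4`. -/
def processP : Prog :=
  .seq (.assign 5 (.read 12 (addrE (.reg 21) (.reg 18))))
  (.seq (.assign 22 (.read 9 (addrE (.reg 5) (.reg 18))))
  (.seq (relaxP 5 (.reg 22) 0)
  (.seq check
  (.ite (.eq (.reg 6) (.const 1)) (relaxP 7 (.add (.reg 22) (.read 2 (.reg 4))) 1) .skip))))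

theorem run_processP (hB : DPBound d B E L it) (hin : Inp d σ) (h3 : σ.reg 3 = d.radix)
    (hT : Rep L σ T) {l cnt q : ℕ} (h16 : σ.reg 16 = L) (h18 : σ.reg 18 = l) (hl : l + 1 ≤ L)
    (h20 : σ.reg 20 = T.cnt) (h4 : σ.reg 4 = it l) (h21 : σ.reg 21 = q) (hq : q < cnt)
    (hp : T.Partial d it l cnt q) :
    Run S B processP σ (d.m * 60 + 200) fun σ' =>
      Rep L σ' (T.process d it l q) ∧ σ'.reg 20 = (T.process d it l q).cnt := by
  have := hB.neZero
  have h1B := Nat.one_lt_two_pow (NeZero.ne B)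
  have hsl := hp.sound l (by omega)
  have hnl : it l < d.n := hB.it_lt l (by omega)
  have hne := hp.lists.ne q hq
  have hsB : T.ls q l < d.radix ^ d.m := hsl.lt hne
  have hqB : q ≤ d.radix ^ d.m := by have := hp.lists.cnt_le hsl; omega
  have hcB : T.cnt ≤ d.radix ^ d.m := hp.lists_succ.cnt_le (hp.sound (l + 1) le_rfl)
  have hvB : T.nv (T.ls q l) l ≤ E ^ 3 := hsl.nv_le hB.n hB.c
    (fun j => (mult_mono it (by omega) j).trans (hB.mult_le j)) _
  have h22B : T.nv (T.ls q l) l + d.c (it l) < 2 ^ B := by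
    refine hB.lt_of_le_pow 4 (by norm_num) ?_
    have h1 := hB.c _ hnl
    have h2 := hB.two
    have h3 : E ≤ E ^ 3 := by nlinarith [Nat.pow_le_pow_right hB.pos (show 1 ≤ 3 by norm_num)]
    have h4 : E ^ 4 = E * E ^ 3 := by ring
    nlinarith
  set s := T.ls q l with hs
  set v := T.nv s l with hv
  set T' := T.relax (l + 1) s v s 0 with hT'
  have hp1 := hp.relax (hp.offer_skip hq)
  refine Run.le (Run.seq_assign (k := s) (.read (hB.ev_addr (.reg h21) (.reg h18) h16 hqB (by omega))
      (hT.ls q l (by omega)))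
    (Run.seq_assign (k := v) (.read (hB.ev_addr (s := s) (.reg (by simp)) (.reg (by simpa using h18))
      (by simpa using h16) hsB.le (by omega)) (hT.nv s l (by omega)))
    (Run.seq (c' := d.m * 60 + 120) (Run.framed (run_relaxP
      (σ := (σ.setReg 5 s).setReg 22 v) (T := T) (rs := 5) (l := l) (s := s) (v := v)
      (par := s) (fl := 0) hB ⟨hT.nv, hT.pa, hT.tk, hT.ls⟩ (by decide) (by simpa using h16)
      (by simpa using h18) hl (by simpa using h20) (by simp) (by simp)
      (fun τ hτ => .reg (by rw [hτ.1 22 (by decide)]; simp)) (by norm_num) hsB hcB)) ?_))) ?_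
  · rintro σ₁ ⟨⟨hT₁, h20₁⟩, hf⟩
    have hf₁ : Frame [5, 22, 20, 24] [9, 10, 11, 12] σ σ₁ :=
      (((frame_setReg σ 5 s).mono (by decide) (by decide)).trans
        ((frame_setReg _ 22 v).mono (by decide) (by decide))).trans (hf.mono (by decide) (by decide))
    have h5₁ : σ₁.reg 5 = s := by rw [hf.1 5 (by decide)]; simp
    have h22₁ : σ₁.reg 22 = v := by rw [hf.1 22 (by decide)]; simp
    have h4₁ : σ₁.reg 4 = it l := by rw [hf₁.1 4 (by decide), h4]
    refine Run.le (c := (d.m * 60 + 20) + 95) (Run.seq (Run.framed (run_check hB.toBound (hin.frame hf₁)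
      (by rw [hf₁.1 3 (by decide), h3]) h4₁ hnl h5₁ hsB)) ?_) (by omega)
    rintro σ₂ ⟨⟨h7, f, h6, hfa⟩, hf₂⟩
    have hT₂ : Rep L σ₂ T' := hT₁.frame hf₂
    have h20₂ : σ₂.reg 20 = T'.cnt := by rw [hf₂.1 20 (by decide), h20₁]
    refine Run.le (Run.ite (c := 50 + 2 * 4) (c' := 1) (.eq (.reg h6) (.const 1 h1B)) (fun h => ?_)
      (fun h => ?_)) (by simp [Test.cost, Expr.cost])
    · have ha := hfa.mp h
      have hpr : T.process d it l q = T'.relax (l + 1) (d.next s (it l)) (v + d.c (it l)) s 1 := by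
        simp only [Table.process]
        rw [if_pos ha]
      rw [hpr]
      have ho := hp.offer_take hq hnl ha
      refine run_relaxP (ve := .add (.reg 22) (.read 2 (.reg 4))) hB hT₂ (by decide) ?_ ?_ hl h20₂
        h7 ?_ ?_ le_rfl ?_ ?_
      · rw [hf₂.1 16 (by decide), hf₁.1 16 (by decide), h16]
      · rw [hf₂.1 18 (by decide), hf₁.1 18 (by decide), h18]
      · rw [hf₂.1 5 (by decide), h5₁]
      · intro τ hτ
        refine .add (.reg ?_) (.read (.reg (k := it l) ?_) ?_) h22B
        · rw [hτ.1 22 (by decide), hf₂.1 22 (by decide), h22₁]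
        · rw [hτ.1 4 (by decide), hf₂.1 4 (by decide), h4₁]
        · rw [hτ.2 2 (by decide), hf₂.2 2 (by decide), hf₁.2 2 (by decide), hin.c _ hnl]
      · rw [← ho.key]; exact ho.packs.key_lt
      · exact hp1.lists_succ.cnt_le (hp1.sound (l + 1) le_rfl)
    · have hpr : T.process d it l q = T' := by
        simp only [Table.process]
        rw [if_neg fun ha => h (hfa.mpr ha)]
      rw [hpr]
      exact Run.skip ⟨hT₂, h20₂⟩
  · simp only [Expr.cost, addrE]
    omega

/-- Compute layer `reg 18 + 1`. -/
def layerP : Prog :=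
  .seq (.assign 20 (.const 0)) (.seq (.assign 4 (.read 8 (.reg 18)))
    (.seq (forTo 21 19 processP) (.assign 19 (.reg 20))))

/-- The dynamic program. -/
def dpP : Prog :=
  .seq (.write 9 (.const 0) (.const 1)) (.seq (.assign 19 (.const 1)) (forTo 18 16 layerP))

theorem run_layerP (hB : DPBound d B E L it) (hin : Inp d σ) (h3 : σ.reg 3 = d.radix)
    (hT : Rep L σ T) {l cnt : ℕ} (h16 : σ.reg 16 = L) (h18 : σ.reg 18 = l) (hl : l < L)
    (h8 : σ.arr 8 (l : ℤ) = it l) (h19 : σ.reg 19 = cnt) (hd : T.Done d it l cnt) {X : ℕ}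
    (hX : cnt ≤ X) :
    Run S B layerP σ (X * (d.m * 60 + 207) + 12) fun σ' =>
      ∃ T' cnt', Rep L σ' T' ∧ T'.Done d it (l + 1) cnt' ∧ σ'.reg 19 = cnt' := by
  have := hB.neZero
  have hnl := hB.it_lt l hl
  have hcB : cnt < 2 ^ B := hB.lt_of_le_radix (hd.lists.cnt_le (hd.sound l le_rfl))
  refine Run.le (Run.seq_assign (.const 0 (by positivity)) (Run.seq_assign (k := it l)
    (.read (z := l) (.reg (by simpa using h18)) (by simpa using h8)) (Run.seq (c' := 2)
    (Run.forTo (N := cnt) (c := d.m * 60 + 200) (fun q σ' => ∃ T', Rep L σ' T' ∧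
      T'.Partial d it l cnt q ∧ σ'.reg 20 = T'.cnt) (by decide) (by decide)
      (by decide) (by simpa using h19) hcB ?_ ?_) ?_))) ?_
  · exact ⟨{ T with cnt := 0 }, ⟨hT.nv, hT.pa, hT.tk, hT.ls⟩, hd.partial, by simp⟩
  · rintro q hq σ' ⟨T', hT', hp, h20⟩ h21 hf
    have hf' : Frame [20, 4, 21, 5, 22, 24, 6, 7, 9, 10, 8] [12, 9, 10, 11] σ σ' :=
      (((frame_setReg _ _ _).mono (by decide) (by decide)).trans
        ((frame_setReg _ _ _).mono (by decide) (by decide))).trans (hf.mono (by decide) (by decide))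
    refine Run.post (run_processP hB (hin.frame hf') ?_ hT' ?_ ?_ hl h20 ?_ h21 hq hp) ?_
    · rw [hf'.1 3 (by decide), h3]
    · rw [hf'.1 16 (by decide), h16]
    · rw [hf'.1 18 (by decide), h18]
    · rw [hf.1 4 (by decide)]; simp
    · rintro σ'' ⟨hT'', h20''⟩
      exact ⟨_, ⟨hT''.nv, hT''.pa, hT''.tk, hT''.ls⟩, hp.process hq hnl, by simpa using h20''⟩
  · rintro σ' ⟨T', hT', hp, h20⟩
    exact Run.assign (.reg h20) ⟨T', _, ⟨hT'.nv, hT'.pa, hT'.tk, hT'.ls⟩, hp.done hnl, by simp⟩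
  · simp only [Expr.cost]
    have := Nat.mul_le_mul_right (d.m * 60 + 200 + 7) hX
    rw [show d.m * 60 + 207 = d.m * 60 + 200 + 7 from rfl]
    omega

/-- The bound `X` for the size of a layer is a hypothesis on correct tables, which separates the
machine from the counting of loads. -/
theorem run_dpP (hB : DPBound d B E L it) (hin : Inp d σ) (h3 : σ.reg 3 = d.radix)
    (h9 : σ.arr 9 = 0) (h10 : σ.arr 10 = 0) (h11 : σ.arr 11 = 0) (h12 : σ.arr 12 = 0)
    (h16 : σ.reg 16 = L) (h8 : ∀ p < L, σ.arr 8 (p : ℤ) = it p) {X : ℕ}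
    (hX : ∀ l ≤ L, ∀ (T : Table) (cnt : ℕ), T.Done d it l cnt → cnt ≤ X) :
    Run S B dpP σ (L * (X * (d.m * 60 + 207) + 19) + 10) fun σ' =>
      ∃ T cnt, Rep L σ' T ∧ T.Done d it L cnt ∧ σ'.reg 19 = cnt := by
  have := hB.neZero
  have h1B := Nat.one_lt_two_pow (NeZero.ne B)
  refine Run.le (Run.seq_write (.const 0 (by positivity)) (.const 1 h1B) (Run.seq_assign
    (.const 1 h1B) (Run.forTo (N := L) (c := X * (d.m * 60 + 207) + 12)
    (fun l σ' => ∃ T cnt, Rep L σ' T ∧ T.Done d it l cnt ∧ σ'.reg 19 = cnt) (by decide) (by decide)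
    (by decide) (by simpa using h16) (hB.lt_of_le_pow 6 (by norm_num) (by have := hB.len_le; omega))
    ?_ ?_))) ?_
  -- Zero memory with a single cell set is exactly the initial table, so no time is spent on
  -- clearing rows.
  · refine ⟨_, 1, ⟨?_, ?_, ?_, ?_⟩, Table.done_init, by simp⟩
    · intro s l hl
      have h0 : (((s * (L + 1) + l : ℕ) : ℤ) = 0) ↔ s = 0 ∧ l = 0 := by
        rw [Nat.cast_eq_zero]
        simp
      simp only [State.setReg_arr, State.setCell_arr, h9, Nat.cast_zero, h0, true_and]
      split_ifs <;> simp
    all_goals intro s l hl; simp [h10, h11, h12]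
  · rintro l hl σ' ⟨T, cnt, hT, hd, h19⟩ h18 hf
    have hf' : Frame [19, 18, 20, 4, 21, 5, 22, 24, 6, 7, 9, 10, 8] [12, 9, 10, 11] σ σ' := by
      refine Frame.trans ?_ (hf.mono (by decide) (by decide))
      refine ⟨fun r hr => ?_, fun a ha => ?_⟩
      · simp only [List.mem_cons, not_or] at hr
        simp [hr]
      · simp only [List.mem_cons, not_or] at ha
        funext z
        simp [ha]
    refine Run.post (run_layerP hB (hin.frame hf') ?_ hT ?_ h18 hl ?_ h19 hd
      (hX l hl.le T cnt hd)) ?_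
    · rw [hf'.1 3 (by decide), h3]
    · rw [hf'.1 16 (by decide), h16]
    · rw [hf'.2 8 (by decide), h8 l hl]
    · rintro σ'' ⟨T', cnt', hT', hd', h19'⟩
      exact ⟨T', cnt', ⟨hT'.nv, hT'.pa, hT'.tk, hT'.ls⟩, hd', by simpa using h19'⟩
  · simp only [Expr.cost]
    rw [show X * (d.m * 60 + 207) + 19 = X * (d.m * 60 + 207) + 12 + 7 from rfl]
    omega

end RAM

/-! ### Relaxation, upper bound and profit threshold -/

namespace Data

variable (d : Data)

/-- The bound on the number of copies of item `j`, zero if the item is too large. -/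
noncomputable def cap (j : ℕ) : ℕ := open Classical in if d.Adm 0 j then d.u j else 0

theorem cap_le (j : ℕ) : d.cap j ≤ d.u j := by
  unfold cap
  split_ifs <;> simp

/-- The linear programming relaxation with capacities `bb` and upper bounds `uu`. -/
def lp (bb uu : ℕ → ℕ) : LP d.m d.n where
  A := fun i j => d.a i j
  b := fun i => bb i
  c := fun j => d.c j
  u := fun j => uu j

end Data

/-- Round down a vector and extend it by zero. -/
def roundDown {n : ℕ} (x : Fin n → ℚ) (j : ℕ) : ℕ := if h : j < n then ⌊x ⟨j, h⟩⌋₊ else 0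

section Round

variable {d : Data} {S : LPSolver} {bb uu : ℕ → ℕ}

theorem natCast_mem_feasible {z : ℕ → ℕ} (hz : ∀ i < d.m, d.load z i ≤ bb i)
    (hu : ∀ j < d.n, z j ≤ uu j) : (fun j : Fin d.n => (z j : ℚ)) ∈ (d.lp bb uu).feasible := by
  refine ⟨fun i => ?_, fun j => ⟨by positivity, ?_⟩⟩
  · have := hz i i.2
    rw [Data.load, Finset.sum_range] at this
    simp only [Data.lp]
    exact_mod_cast this
  · simpa [Data.lp] using hu j j.2

theorem sol_isOptimalVertex : (d.lp bb uu).IsOptimalVertex (S.sol (d.lp bb uu)) :=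
  S.correct _ ⟨_, natCast_mem_feasible (z := 0) (by simp [Data.load]) (by simp)⟩

theorem sol_bounds (j : Fin d.n) :
    0 ≤ S.sol (d.lp bb uu) j ∧ S.sol (d.lp bb uu) j ≤ uu j :=
  (sol_isOptimalVertex (S := S) (d := d) (bb := bb) (uu := uu)).1.1.2 j

theorem load_roundDown_le {i : ℕ} (hi : i < d.m) :
    d.load (roundDown (S.sol (d.lp bb uu))) i ≤ bb i := by
  have h := (sol_isOptimalVertex (S := S) (d := d) (bb := bb) (uu := uu)).1.1.1 ⟨i, hi⟩
  have h2 : (d.load (roundDown (S.sol (d.lp bb uu))) i : ℚ) ≤ bb i := by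
    refine le_trans ?_ h
    rw [Data.load, Finset.sum_range]
    push_cast
    refine Finset.sum_le_sum fun j _ => ?_
    simp only [Data.lp, roundDown, j.2, dite_true]
    exact mul_le_mul_of_nonneg_left (Nat.floor_le (sol_bounds j).1) (by positivity)
  exact_mod_cast h2

theorem roundDown_le {j : ℕ} (hj : j < d.n) : roundDown (S.sol (d.lp bb uu)) j ≤ uu j := by
  rw [roundDown, dif_pos hj]
  exact Nat.floor_le_of_le (sol_bounds (S := S) ⟨j, hj⟩).2

/-- An integral solution is feasible for the relaxation, whose optimal vertex loses little by
rounding. This is applied to all items, to bound the optimum, and later to the light items, where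
`θ` is small. -/
theorem profit_le_roundDown {z : ℕ → ℕ} (hz : ∀ i < d.m, d.load z i ≤ bb i)
    (hu : ∀ j < d.n, z j ≤ uu j) {θ : ℕ} (hθ : ∀ j < d.n, 0 < uu j → d.c j ≤ θ) :
    d.profit z ≤ d.profit (roundDown (S.sol (d.lp bb uu))) + d.m * θ := by
  have hv := sol_isOptimalVertex (S := S) (d := d) (bb := bb) (uu := uu)
  have h1 := hv.2 _ (natCast_mem_feasible hz hu)
  have h2 := (d.lp bb uu).value_le_floor hv.1 (fun j => d.c j) (fun j => uu j) (fun _ => rfl)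
    (fun _ => rfl) θ (fun j hj => hθ j j.2 hj)
  have h3 : (d.lp bb uu).value (fun j : Fin d.n => (z j : ℚ)) = (d.profit z : ℕ) := by
    rw [Data.profit, Finset.sum_range]
    simp [LP.value, Data.lp]
  have h4 : d.profit (roundDown (S.sol (d.lp bb uu))) =
      ∑ j : Fin d.n, d.c j * ⌊S.sol (d.lp bb uu) j⌋₊ := by
    rw [Data.profit, Finset.sum_range]
    exact Finset.sum_congr rfl fun j _ => by simp [roundDown]
  rw [h4]
  rw [h3] at h1
  exact_mod_cast h1.trans h2

theorem profit_roundDown_le {E : ℕ} (hn : d.n + 1 ≤ E) (hc : ∀ j < d.n, d.c j ≤ E)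
    (hu : ∀ j < d.n, uu j ≤ E) (k : ℕ) (hk : k ≤ d.n) :
    ∑ j ∈ range k, d.c j * roundDown (S.sol (d.lp bb uu)) j ≤ E ^ 3 := by
  refine (sum_le_card_nsmul _ _ (E * E) fun j hj => ?_).trans ?_
  · have := mem_range.mp hj
    exact Nat.mul_le_mul (hc j (by omega)) ((roundDown_le (by omega)).trans (hu j (by omega)))
  · rw [card_range, smul_eq_mul, show E ^ 3 = E * (E * E) by ring]
    exact Nat.mul_le_mul_right _ (by omega)

end Round

/-! ### Programs for the radix, the caps, the profit bound and the threshold. -/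

namespace RAM

variable {S : LPSolver} {B E : ℕ} {d : Data} {σ : State}

theorem getLP_eq (hin : Inp d σ) {ab au : ℕ} {bb uu : ℕ → ℕ}
    (hb : ∀ i < d.m, σ.arr ab (i : ℤ) = bb i) (hu : ∀ j < d.n, σ.arr au (j : ℤ) = uu j) :
    σ.getLP d.m d.n 0 ab 2 au = d.lp bb uu := by
  unfold State.getLP Data.lp
  congr 1
  · funext i j
    have := hin.a i i.2 j j.2
    push_cast at this
    exact this
  · funext i; exact hb i i.2
  · funext j; exact hin.c j j.2
  · funext j; exact hu j j.2

/-- Compute the radix. -/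
def radixP : Prog :=
  .seq (.assign 3 (.const 1)) (forTo 8 0 (.assign 3 (.add (.reg 3) (.read 1 (.reg 8)))))

theorem run_radixP (hB : d.Bound B E) (hin : Inp d σ) :
    Run S B radixP σ (d.m * 12 + 7) fun σ' => σ'.reg 3 = d.radix := by
  have := hB.neZero
  have h1B := Nat.one_lt_two_pow (NeZero.ne B)
  have hmB : d.m < 2 ^ B := hB.lt_of_le_pow 1 (by norm_num) (by have := hB.m; simp; omega)
  refine Run.le (Run.seq_assign (.const 1 h1B) (Run.post (Run.forTo (N := d.m) (c := 5)
    (fun i σ' => σ'.reg 3 = (1 + ∑ l ∈ range i, d.b l : ℕ)) (by decide) (by decide) (by decide)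
    (by simpa using hin.m) hmB (by simp) ?_) fun _ h => h)) ?_
  · intro i hi σ' h3 h8 hf
    have hb : σ'.arr 1 (i : ℤ) = d.b i := by
      rw [hf.2 1 (by decide)]
      simpa using hin.b i hi
    have hle : 1 + ∑ l ∈ range i, d.b l + d.b i ≤ d.radix := by
      rw [add_assoc, ← sum_range_succ, Data.radix]
      exact Nat.add_le_add_left (sum_le_sum_of_subset (range_subset_range.mpr hi)) _
    refine Run.le (Run.assign (.add (.reg h3) (.read (z := i) (.reg h8) hb)
      (hB.lt_of_le_radix (hle.trans hB.radix_le))) ?_) (by simp [Expr.cost])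
    simp [sum_range_succ, add_assoc]
  · simp only [Expr.cost]
    omega

/-- Compute the bounds on the numbers of copies. -/
def capP : Prog :=
  forTo 11 1 (.seq (.assign 4 (.reg 11)) (.seq (.assign 5 (.const 0)) (.seq check
    (.ite (.eq (.reg 6) (.const 1)) (.write 5 (.reg 11) (.read 3 (.reg 11)))
      (.write 5 (.reg 11) (.const 0))))))

theorem run_capP (hB : d.Bound B E) (hin : Inp d σ) (h3 : σ.reg 3 = d.radix)
    (hu : ∀ j < d.n, σ.arr 3 (j : ℤ) = d.u j) :
    Run S B capP σ (d.n * (d.m * 60 + 50) + 5) fun σ' => ∀ j < d.n, σ'.arr 5 (j : ℤ) = d.cap j := by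
  have := hB.neZero
  have h1B := Nat.one_lt_two_pow (NeZero.ne B)
  have hnB : d.n < 2 ^ B := hB.lt_of_le_pow 1 (by norm_num) (by have := hB.n; simp; omega)
  refine Run.le (Run.forTo (N := d.n) (c := d.m * 60 + 43)
    (fun j σ' => ∀ j' < j, σ'.arr 5 (j' : ℤ) = d.cap j') (by decide) (by decide) (by decide) hin.n hnB
    (by simp) ?_) ?_
  · intro j hj σ' h5 h11 hf
    have hin' := hin.frame hf
    refine Run.le (Run.seq_assign (k := j) (.reg h11) (Run.seq_assign (.const 0 (by positivity))
      (Run.seq (c' := 13) (Run.framed (run_check (σ := (σ'.setReg 4 j).setReg 5 (0 : ℕ)) (s := 0)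
        (j := j) hB (hin'.frame (((frame_setReg σ' 4 j).mono (W' := [4, 5]) (A' := []) (by simp)
        (by simp)).trans ((frame_setReg _ 5 _).mono (by simp) (by simp)))) ?_ (by simp) hj (by simp) (pow_pos d.radix_pos _))) ?_))) ?_
    · simp only [State.setReg_reg]
      norm_num
      rw [hf.1 3 (by decide), h3]
    · rintro τ ⟨⟨-, f, h6, hfa⟩, hfr⟩
      have h11' : τ.reg 11 = j := by rw [hfr.1 11 (by decide)]; simpa using h11
      have harr : ∀ a, τ.arr a = σ'.arr a := fun a => by
        rw [hfr.2 a (by simp [check, checkBody, forTo, Prog.wa])]; simp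
      have hu' : τ.arr 3 (j : ℤ) = d.u j := by
        rw [harr, hf.2 3 (by decide), hu j hj]
      have key : ∀ k : ℕ, k = d.cap j → ∀ j' < j + 1,
          (τ.setCell 5 j k).arr 5 (j' : ℤ) = d.cap j' := by
        intro k hk j' hj'
        rw [State.setCell_arr]
        rcases Nat.lt_succ_iff_lt_or_eq.mp hj' with h | rfl
        · rw [if_neg (by simp [h.ne]), harr, h5 j' h]
        · simp [hk]
      refine Run.le (Run.ite (c := 5) (c' := 4) (.eq (.reg h6) (.const 1 h1B)) (fun h => Run.le (Run.write (z := j)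
        (.reg h11') (.read (z := j) (.reg h11') hu') ?_) (by simp [Expr.cost])) (fun h => Run.le
        (Run.write (z := j) (.reg h11') (.const 0 (by positivity)) ?_) (by simp [Expr.cost])))
        (by simp [Test.cost, Expr.cost])
      · exact key _ (by rw [Data.cap, if_pos (hfa.mp h)])
      · exact key _ (by rw [Data.cap, if_neg fun ha => h (hfa.mpr ha)])
    · simp only [Expr.cost]
      omega
  · rw [show d.m * 60 + 43 + 7 = d.m * 60 + 50 from rfl]

/-- Compute the profit of the rounded solution of the linear program. -/
def profitP : Prog :=
  .seq (.assign 12 (.const 0)) (forTo 11 1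
    (.assign 12 (.add (.reg 12) (.mul (.read 2 (.reg 11)) (.floor (.read 6 (.reg 11)))))))

/-- The array `6` holds a solution of the linear program. -/
def HasSol (S : LPSolver) (d : Data) (bb uu : ℕ → ℕ) (σ : State) : Prop :=
  ∀ j : Fin d.n, σ.arr 6 (j : ℤ) = S.sol (d.lp bb uu) j

/-- Reading a cell carries no condition on its length. The solution of the linear program enters
arithmetic only after rounding, as a number of size at most `E`. -/
theorem HasSol.ev {bb uu : ℕ → ℕ} (h : HasSol S d bb uu σ) (hB : d.Bound B E)
    (hu : ∀ j < d.n, uu j ≤ E) {e : Expr} {j : ℕ} (he : Ev B σ e j) (hj : j < d.n) :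
    Ev B σ (.floor (.read 6 e)) (roundDown (S.sol (d.lp bb uu)) j) := by
  have := hB.neZero
  have hv : (Expr.read 6 e).eval σ = S.sol (d.lp bb uu) ⟨j, hj⟩ := by
    rw [Expr.eval, he.2, Int.floor_natCast]
    exact h ⟨j, hj⟩
  have h2 : roundDown (S.sol (d.lp bb uu)) j = ⌊(Expr.read 6 e).eval σ⌋₊ := by
    rw [roundDown, dif_pos hj, hv]
  rw [h2]
  refine Ev.floor he.1 ?_ ?_
  · rw [hv]; exact (sol_bounds _).1
  · rw [← h2]
    exact hB.lt_of_le_pow 1 (by norm_num) (by simpa using (roundDown_le hj).trans (hu j hj))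

theorem run_profitP (hB : d.Bound B E) (hin : Inp d σ) {bb uu : ℕ → ℕ}
    (hs : HasSol S d bb uu σ) (hu : ∀ j < d.n, uu j ≤ E) :
    Run S B profitP σ (d.n * 16 + 7) fun σ' =>
      σ'.reg 12 = d.profit (roundDown (S.sol (d.lp bb uu))) := by
  have := hB.neZero
  have hnB : d.n < 2 ^ B := hB.lt_of_le_pow 1 (by norm_num) (by have := hB.n; simp; omega)
  refine Run.le (Run.seq_assign (.const 0 (by positivity)) (Run.post (Run.forTo (N := d.n) (c := 9)
    (fun i σ' => σ'.reg 12 = (∑ j ∈ range i, d.c j * roundDown (S.sol (d.lp bb uu)) j : ℕ))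
    (by decide) (by decide) (by decide) (by simpa using hin.n) hnB (by simp) ?_) fun _ h => h)) ?_
  · intro j hj σ' h12 h11 hf
    have hs' : HasSol S d bb uu σ' := fun j => by
      rw [hf.2 6 (by decide)]
      exact hs j
    have hc : σ'.arr 2 (j : ℤ) = d.c j := by
      rw [hf.2 2 (by decide)]
      exact hin.c j hj
    have hle := profit_roundDown_le (S := S) (bb := bb) hB.n hB.c hu (j + 1) hj
    have hBd := hB.lt_of_le_pow 3 (by norm_num) hle
    rw [sum_range_succ] at hBd
    refine Run.le (Run.assign (.add (.reg h12) (.mul (.read (z := j) (.reg h11) hc)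
      (hs'.ev hB hu (.reg h11) hj) (by omega)) hBd) ?_) (by simp [Expr.cost])
    simp [sum_range_succ]
  · simp only [Expr.cost]
    omega

/-- Compute a lower bound for the optimum. -/
def boundP : Prog :=
  .seq (.assign 13 (.reg 12)) (forTo 11 1 (.ite (.lt (.const 0) (.read 5 (.reg 11)))
    (.ite (.lt (.reg 13) (.read 2 (.reg 11))) (.assign 13 (.read 2 (.reg 11))) .skip) .skip))

/-- `G` is the maximum of `g` and the profits of items with a positive bound. The last clause
records where it is attained, which later yields a solution of profit exactly `G`. -/
theorem run_boundP (hB : d.Bound B E) (hin : Inp d σ) {cp : ℕ → ℕ}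
    (h5 : ∀ j < d.n, σ.arr 5 (j : ℤ) = cp j) {g : ℕ} (h12 : σ.reg 12 = g) :
    Run S B boundP σ (d.n * 22 + 7) fun σ' => ∃ G : ℕ, σ'.reg 13 = G ∧ g ≤ G ∧
      (∀ j < d.n, 0 < cp j → d.c j ≤ G) ∧ (G = g ∨ ∃ j < d.n, 0 < cp j ∧ G = d.c j) := by
  have := hB.neZero
  have hnB : d.n < 2 ^ B := hB.lt_of_le_pow 1 (by norm_num) (by have := hB.n; simp; omega)
  refine Run.le (Run.seq_assign (k := g) (.reg h12) (Run.post (Run.forTo (N := d.n) (c := 15)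
    (fun i σ' => ∃ G : ℕ, σ'.reg 13 = G ∧ g ≤ G ∧ (∀ j < i, 0 < cp j → d.c j ≤ G) ∧
      (G = g ∨ ∃ j < d.n, 0 < cp j ∧ G = d.c j))
    (by decide) (by decide) (by decide) (by simpa using hin.n) hnB ⟨g, by simp⟩ ?_) fun _ h => h)) ?_
  · rintro j hj σ' ⟨G, h13, hgG, hG, hG'⟩ h11 hf
    have hc : σ'.arr 2 (j : ℤ) = d.c j := by
      rw [hf.2 2 (by decide)]
      exact hin.c j hj
    have h5' : σ'.arr 5 (j : ℤ) = cp j := by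
      rw [hf.2 5 (by decide)]
      exact h5 j hj
    refine Run.le (Run.ite (c := 9) (c' := 1) (.lt (.const 0 (by positivity)) (.read (z := j) (.reg h11) h5'))
      (fun hp => Run.le (Run.ite (c := 3) (c' := 1) (.lt (.reg h13) (.read (z := j) (.reg h11) hc))
        (fun hlt => Run.le (Run.assign (.read (z := j) (.reg h11) hc) ⟨d.c j, by simp, by omega, ?_,
          .inr ⟨j, hj, hp, rfl⟩⟩)
          (by simp [Expr.cost])) (fun hlt => Run.skip ⟨G, by simpa using h13, hgG, ?_, hG'⟩))
          (by simp [Test.cost, Expr.cost]))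
      (fun hp => Run.skip ⟨G, by simpa using h13, hgG, ?_, hG'⟩)) (by simp [Test.cost, Expr.cost])
    · intro j' hj' hp'
      rcases Nat.lt_succ_iff_lt_or_eq.mp hj' with h | rfl
      · have := hG j' h hp'; omega
      · rfl
    · intro j' hj' hp'
      rcases Nat.lt_succ_iff_lt_or_eq.mp hj' with h | rfl
      · exact hG j' h hp'
      · omega
    · intro j' hj' hp'
      rcases Nat.lt_succ_iff_lt_or_eq.mp hj' with h | rfl
      · exact hG j' h hp'
      · omega
  · simp only [Expr.cost]
    omega

/-- Compute the profit threshold for light items and the bound on the number of heavy items. -/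
def thresholdP : Prog :=
  .seq (.assign 14 (.floor (.div (.mul (.reg 2) (.reg 13)) (.reg 0))))
    (.assign 15 (.floor (.div (.mul (.reg 0) (.add (.reg 0) (.const 1))) (.reg 2))))

/-- With `ε = p / r` both roundings become divisions of natural numbers, and the intermediate
fractions are seen to fit into words. -/
theorem run_thresholdP (hB : d.Bound B E) (hin : Inp d σ) {ε : ℚ} {p r G : ℕ} (h2 : σ.reg 2 = ε)
    (hε : ε = (p : ℚ) / r) (hp : 0 < p) (hr : 0 < r) (hpE : p ≤ E) (hrE : r ≤ E) (h13 : σ.reg 13 = G)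
    (hG : G ≤ E ^ 3) :
    Run S B thresholdP σ 20 fun σ' => σ'.reg 14 = (p * G / (r * d.m) : ℕ) ∧
      σ'.reg 15 = (d.m * (d.m + 1) * r / p : ℕ) := by
  have := hB.neZero
  have h1B := Nat.one_lt_two_pow (NeZero.ne B)
  have hm := hB.m
  have hm0 := hB.m_pos
  have hE := hB.pos
  have hpG : p * G < 2 ^ B := hB.lt_of_le_pow 4 (by norm_num) (by
    rw [show E ^ 4 = E * E ^ 3 by ring]; exact Nat.mul_le_mul hpE hG)
  have hrm : r * d.m < 2 ^ B := hB.lt_of_le_pow 2 (by norm_num) (by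
    rw [sq]; exact Nat.mul_le_mul hrE (by omega))
  have hmm : d.m * (d.m + 1) < 2 ^ B := hB.lt_of_le_pow 2 (by norm_num) (by
    rw [sq]; exact Nat.mul_le_mul (by omega) hm)
  have hmr : d.m * (d.m + 1) * r < 2 ^ B := hB.lt_of_le_pow 3 (by norm_num) (by
    rw [show E ^ 3 = E * E * E by ring]
    exact Nat.mul_le_mul (Nat.mul_le_mul (by omega) hm) hrE)
  have hpB : p < 2 ^ B := hB.lt_of_le_pow 1 (by norm_num) (by simpa using hpE)
  have hrB : r < 2 ^ B := hB.lt_of_le_pow 1 (by norm_num) (by simpa using hrE)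
  have hmB : d.m + 1 < 2 ^ B := hB.lt_of_le_pow 1 (by norm_num) (by simpa using hm)
  have e1 : ε * G = ((p * G : ℕ) : ℚ) / r := by rw [hε]; push_cast; ring
  have e2 : ε * G / d.m = ((p * G : ℕ) : ℚ) / (r * d.m : ℕ) := by
    rw [e1]; push_cast; rw [div_div]
  have e3 : ((d.m * (d.m + 1) : ℕ) : ℚ) / ε = ((d.m * (d.m + 1) * r : ℕ) : ℚ) / p := by
    rw [hε]; push_cast; rw [div_div_eq_mul_div]
  have hθ : Ev B σ (.floor (.div (.mul (.reg 2) (.reg 13)) (.reg 0))) (p * G / (r * d.m)) := by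
    have hv : (Expr.div (.mul (.reg 2) (.reg 13)) (.reg 0)).eval σ =
        ((p * G : ℕ) : ℚ) / (r * d.m : ℕ) := by
      simp only [Expr.eval, h2, h13, hin.m]
      exact e2
    have hfl : ⌊(Expr.div (.mul (.reg 2) (.reg 13)) (.reg 0)).eval σ⌋₊ = p * G / (r * d.m) := by
      rw [hv, Nat.floor_div_eq_div]
    rw [← hfl]
    refine Ev.floor ⟨⟨trivial, trivial, ?_⟩, trivial, ?_, ?_⟩ ?_ ?_
    · simp only [Expr.eval, h2, h13, e1]
      exact fits_div hpG hrB
    · simp only [Expr.eval, hin.m]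
      exact_mod_cast Nat.one_le_iff_ne_zero.mp hm0
    · have := hv
      simp only [Expr.eval] at this ⊢
      rw [this]
      exact fits_div hpG hrm
    · rw [hv]; positivity
    · rw [hfl]; exact (Nat.div_le_self _ _).trans_lt hpG
  have hK : Ev B (σ.setReg 14 (p * G / (r * d.m) : ℕ))
      (.floor (.div (.mul (.reg 0) (.add (.reg 0) (.const 1))) (.reg 2)))
      (d.m * (d.m + 1) * r / p) := by
    have hin' : Inp d (σ.setReg 14 (p * G / (r * d.m) : ℕ)) := hin.frame (frame_setReg _ _ _)
    have hmul : Ev B (σ.setReg 14 (p * G / (r * d.m) : ℕ))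
        (.mul (.reg 0) (.add (.reg 0) (.const 1))) (d.m * (d.m + 1)) :=
      .mul (.reg hin'.m) (.add (.reg hin'.m) (.const 1 h1B) hmB) hmm
    have h2' : (Expr.reg 2).eval (σ.setReg 14 (p * G / (r * d.m) : ℕ)) = ε := by
      simp [Expr.eval, h2]
    have hv : (Expr.div (.mul (.reg 0) (.add (.reg 0) (.const 1))) (.reg 2)).eval
        (σ.setReg 14 (p * G / (r * d.m) : ℕ)) = ((d.m * (d.m + 1) * r : ℕ) : ℚ) / p := by
      rw [Expr.eval, hmul.2, h2', e3]
    have hfl : ⌊(Expr.div (.mul (.reg 0) (.add (.reg 0) (.const 1))) (.reg 2)).eval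
        (σ.setReg 14 (p * G / (r * d.m) : ℕ))⌋₊ = d.m * (d.m + 1) * r / p := by
      rw [hv, Nat.floor_div_eq_div]
    rw [← hfl]
    refine Ev.floor ⟨hmul.1, trivial, ?_, ?_⟩ ?_ ?_
    · rw [h2', hε]; positivity
    · rw [hmul.2, h2', e3]
      exact fits_div hmr hpB
    · rw [hv]; positivity
    · rw [hfl]; exact (Nat.div_le_self _ _).trans_lt hmr
  refine Run.le (Run.seq_assign hθ (Run.assign hK ?_)) (by simp [Expr.cost])
  simp

end RAM

/-! ### Heavy and light items -/

theorem mult_congr {it it' : ℕ → ℕ} {l : ℕ} (h : ∀ p < l, it' p = it p) (j : ℕ) :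
    mult it' l j = mult it l j := by
  unfold mult
  congr 1
  refine filter_congr fun p hp => ?_
  rw [h p (mem_range.mp hp)]

theorem mult_update (it : ℕ → ℕ) (l j j' : ℕ) :
    mult (Function.update it l j) (l + 1) j' = mult it l j' + if j = j' then 1 else 0 := by
  rw [mult_succ, Function.update_self, mult_congr fun p hp => Function.update_of_ne hp.ne _ _]

namespace RAM

variable {S : LPSolver} {B E : ℕ} {d : Data} {σ : State}

/-- The number of copies of item `j` in the item list is `f j`. -/
structure ItemList (n : ℕ) (f : ℕ → ℕ) (L : ℕ) (it : ℕ → ℕ) (σ : State) : Prop where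
  len : σ.reg 16 = L
  arr : ∀ p < L, σ.arr 8 (p : ℤ) = it p
  lt : ∀ p < L, it p < n
  mult : ∀ j, mult it L j = f j

theorem ItemList.setReg {n L : ℕ} {f it : ℕ → ℕ} (h : ItemList n f L it σ) {r : ℕ} (hr : r ≠ 16)
    (v : ℚ) : ItemList n f L it (σ.setReg r v) :=
  ⟨by simpa [hr.symm] using h.len, h.arr, h.lt, h.mult⟩

/-- Append copies of item `reg 11` to the item list. -/
def copyBody : Prog :=
  .ite (.lt (.reg 17) (.read 5 (.reg 11)))
    (.seq (.write 8 (.reg 16) (.reg 11)) (.assign 16 (.add (.reg 16) (.const 1)))) .skip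

/-- The loop runs `K` times and not `u` times, since `u` may be too large for the time bound. Pass
`t` appends a copy if `t < u`, which makes `min K u` copies. -/
theorem run_copies (hB : d.Bound B E) {K j u L : ℕ} {f it : ℕ → ℕ} (hj : j < d.n)
    (h15 : σ.reg 15 = K) (h5 : σ.arr 5 (j : ℤ) = u) (h11 : σ.reg 11 = j)
    (hit : ItemList d.n f L it σ) (hL : L + K < 2 ^ B) :
    Run S B (forTo 17 15 copyBody) σ (K * 20 + 5) fun σ' => ∃ L' it', L' ≤ L + K ∧
      ItemList d.n (fun j' => f j' + if j = j' then min K u else 0) L' it' σ' := by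
  have := hB.neZero
  have h1B := Nat.one_lt_two_pow (NeZero.ne B)
  refine Run.forTo (N := K) (c := 13) (fun t σ' => ∃ L' it', L' ≤ L + t ∧
      ItemList d.n (fun j' => f j' + if j = j' then min t u else 0) L' it' σ') (by decide) (by decide)
      (by decide) h15 (by omega) ⟨L, it, by omega, by simpa using hit.setReg (by decide) 0⟩ ?_
  rintro t ht σ' ⟨L', it', hL', hit'⟩ h17 hf
  have h11' : σ'.reg 11 = j := by rw [hf.1 11 (by decide), h11]
  have h5' : σ'.arr 5 (j : ℤ) = u := by rw [hf.2 5 (by decide), h5]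
  refine Run.le (Run.ite (c := 7) (c' := 1) (.lt (.reg h17) (.read (z := j) (.reg h11') h5'))
    (fun hlt => Run.le (Run.seq_write (.reg hit'.len) (.reg h11') (Run.assign (.add (.reg
      (by simpa using hit'.len)) (.const 1 h1B) (by omega)) ⟨L' + 1, Function.update it' L' j,
        by omega, ?_⟩)) (by simp [Expr.cost]))
    (fun hlt => Run.skip ⟨L', it', by omega, ?_⟩)) (by simp [Test.cost, Expr.cost])
  · constructor
    · simp
    · intro p hp
      rcases Nat.lt_succ_iff_lt_or_eq.mp hp with h | rfl
      · simpa [h.ne] using hit'.arr p h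
      · simp
    · intro p hp
      rcases Nat.lt_succ_iff_lt_or_eq.mp hp with h | rfl
      · rw [Function.update_of_ne h.ne]; exact hit'.lt p h
      · rw [Function.update_self]; exact hj
    · intro j'
      rw [mult_update, hit'.mult]
      split_ifs
      · omega
      · rfl
  · refine (show ItemList _ _ _ _ σ' from ⟨hit'.len, hit'.arr, hit'.lt, fun j' => ?_⟩).setReg
      (by decide) _
    rw [hit'.mult]
    split_ifs
    · omega
    · rfl

/-- Put item `reg 11` on the list of heavy items, or record its bound as a light item. -/
def itemsBody : Prog :=
  .ite (.le (.read 2 (.reg 11)) (.reg 14)) (.write 7 (.reg 11) (.read 5 (.reg 11)))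
    (.seq (.write 7 (.reg 11) (.const 0)) (forTo 17 15 copyBody))

/-- Separate light and heavy items. -/
def itemsP : Prog := .seq (.assign 16 (.const 0)) (forTo 11 1 itemsBody)

/-- The bound on the number of copies of a light item. -/
def lightCap (d : Data) (cp : ℕ → ℕ) (θ j : ℕ) : ℕ := if d.c j ≤ θ then cp j else 0

/-- The bound on the number of copies of a heavy item. -/
def heavyCap (d : Data) (cp : ℕ → ℕ) (θ K j : ℕ) : ℕ :=
  if j < d.n ∧ θ < d.c j then min K (cp j) else 0

/-- No more than `K` copies of a heavy item are ever needed, so the length of the list does not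
depend on the upper bounds. For each item at most one of `lightCap` and `heavyCap` is nonzero. -/
theorem run_itemsP (hB : d.Bound B E) (hin : Inp d σ) {cp : ℕ → ℕ} {θ K : ℕ}
    (h5 : ∀ j < d.n, σ.arr 5 (j : ℤ) = cp j) (h14 : σ.reg 14 = θ) (h15 : σ.reg 15 = K)
    (hK : d.n * K < 2 ^ B) :
    Run S B itemsP σ (d.n * (K * 20 + 25) + 7) fun σ' =>
      (∀ j < d.n, σ'.arr 7 (j : ℤ) = lightCap d cp θ j) ∧
      ∃ L it, L ≤ d.n * K ∧ ItemList d.n (heavyCap d cp θ K) L it σ' := by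
  have := hB.neZero
  have hnB : d.n < 2 ^ B := hB.lt_of_le_pow 1 (by norm_num) (by have := hB.n; simp; omega)
  refine Run.le (Run.seq_assign (.const 0 (by positivity)) (Run.post (Run.forTo (N := d.n)
    (c := K * 20 + 18) (fun j σ' => (∀ j' < j, σ'.arr 7 (j' : ℤ) = lightCap d cp θ j') ∧
      ∃ L it, L ≤ j * K ∧ ItemList d.n (fun j' => if j' < j then heavyCap d cp θ K j' else 0) L it σ')
    (by decide) (by decide) (by decide) (by simpa using hin.n) hnB ?_ ?_) ?_)) ?_
  · refine ⟨by simp, 0, fun _ => 0, by simp, by simp, by simp, by simp, by simp [mult]⟩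
  · rintro j hj σ' ⟨h7, L, it, hL, hit⟩ h11 hf
    have hc : σ'.arr 2 (j : ℤ) = d.c j := by
      rw [hf.2 2 (by decide)]
      exact hin.c j hj
    have h5' : σ'.arr 5 (j : ℤ) = cp j := by
      rw [hf.2 5 (by decide)]
      exact h5 j hj
    have h14' : σ'.reg 14 = θ := by rw [hf.1 14 (by decide)]; simpa using h14
    have h15' : σ'.reg 15 = K := by rw [hf.1 15 (by decide)]; simpa using h15
    have h7' : ∀ k : ℕ, k = lightCap d cp θ j → ∀ j' < j + 1,
        (σ'.setCell 7 j k).arr 7 (j' : ℤ) = lightCap d cp θ j' := by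
      intro k hk j' hj'
      rw [State.setCell_arr]
      rcases Nat.lt_succ_iff_lt_or_eq.mp hj' with h | rfl
      · rw [if_neg (by simp [h.ne]), h7 j' h]
      · simp [hk]
    have hjK : (j + 1) * K ≤ d.n * K := Nat.mul_le_mul_right _ hj
    rw [Nat.succ_mul] at hjK
    refine Run.le (Run.ite (c := 4) (c' := K * 20 + 8) (.le (.read (z := j) (.reg h11) hc) (.reg h14'))
      (fun hle => Run.le (Run.write (z := j) (.reg h11) (.read (z := j) (.reg h11) h5')
        ⟨h7' _ (by rw [lightCap, if_pos hle]), L, it, hL.trans (Nat.mul_le_mul_right _ (by omega)),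
          (show ItemList _ _ _ _ (σ'.setCell 7 j (cp j)) from
            ⟨hit.len, by simpa using hit.arr, hit.lt, ?_⟩).setReg (by decide) _⟩)
        (by simp [Expr.cost]))
      (fun hle => Run.le (Run.seq_write (z := j) (.reg h11) (.const 0 (by positivity))
        (Run.post (Run.framed (run_copies (K := K) (u := cp j) (L := L) (it := it)
        (f := fun j' => if j' < j then heavyCap d cp θ K j' else 0) hB hj
        (by simpa using h15') (by simpa using h5') (by simpa using h11)
        ⟨by simpa using hit.len, by simpa using hit.arr, hit.lt, hit.mult⟩ (by omega))) ?_))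
        (by simp [Expr.cost]; omega))) ?_
    · intro j'
      rw [hit.mult]
      by_cases h1 : j' < j
      · rw [if_pos h1, if_pos (by omega)]
      · rw [if_neg h1]
        split_ifs with h2
        · obtain rfl : j' = j := by omega
          rw [heavyCap, if_neg (by omega)]
        · rfl
    · rintro τ ⟨⟨L', it', hL', hit'⟩, hfr⟩
      refine ⟨?_, L', it', ?_, (show ItemList _ _ _ _ τ from
        ⟨hit'.len, hit'.arr, hit'.lt, fun j' => ?_⟩).setReg (by decide) _⟩
      · intro j' hj'
        rw [State.setReg_arr, hfr.2 7 (by decide)]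
        exact h7' 0 (by rw [lightCap, if_neg hle]) j' hj'
      · rw [Nat.succ_mul]; omega
      · rw [hit'.mult]
        by_cases h1 : j' < j
        · rw [if_pos h1, if_neg (by omega), if_pos (by omega), add_zero]
        · rw [if_neg h1, zero_add]
          by_cases h2 : j = j'
          · subst h2
            rw [if_pos rfl, if_pos (by omega), heavyCap, if_pos (by omega)]
          · rw [if_neg h2, if_neg (by omega)]
    · simp only [Test.cost, Expr.cost]
      omega
  · rintro τ ⟨h7, L, it, hL, hit⟩
    refine ⟨h7, L, it, hL, hit.len, hit.arr, hit.lt, fun j => ?_⟩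
    rw [hit.mult]
    split_ifs with h
    · rfl
    · rw [heavyCap, if_neg (by omega)]
  · simp only [Expr.cost]
    rw [show K * 20 + 25 = K * 20 + 18 + 7 from rfl]
    omega

/-- The capacity that `reg 5` leaves in constraint `reg 8`. -/
def lightBody : Prog :=
  .seq (.write 13 (.reg 8) (.sub (.read 1 (.reg 8)) (modE (.reg 9) (.reg 3))))
    (.assign 9 (.floor (.div (.reg 9) (.reg 3))))

/-- The linear programming relaxation with the capacities that `reg 5` leaves. -/
def lightP : Prog :=
  .seq (.assign 9 (.reg 5)) (.seq (forTo 8 0 lightBody) (.seq (.solveLP 0 1 0 13 2 7 6) profitP))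

/-- The capacities that are left by the vector with code `s`. -/
def residual (d : Data) (s i : ℕ) : ℕ := d.b i - d.digit s i

/-- The rounded solution of the linear programming relaxation with the capacities left by `s`. -/
def lightSol (S : LPSolver) (d : Data) (ul : ℕ → ℕ) (s : ℕ) : ℕ → ℕ :=
  roundDown (S.sol (d.lp (residual d s) ul))

/-- The digits of `s` are peeled off and subtracted from the capacities; `hsb` keeps the differences
nonnegative, so that the linear program has natural data. -/
theorem run_lightP (hB : d.Bound B E) (hb : ∀ i < d.m, d.b i ≤ E) (hin : Inp d σ)
    (h3 : σ.reg 3 = d.radix) {ul : ℕ → ℕ}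
    (h7 : ∀ j < d.n, σ.arr 7 (j : ℤ) = ul j) (hul : ∀ j < d.n, ul j ≤ E) {s : ℕ}
    (h5 : σ.reg 5 = s) (hs : s < d.radix ^ d.m) (hsb : ∀ i < d.m, d.digit s i ≤ d.b i) {T : ℕ}
    (hT : S.cost (d.lp (residual d s) ul) ≤ T) :
    Run S B lightP σ (d.m * 30 + d.n * 16 + T + 20) fun σ' =>
      σ'.reg 12 = d.profit (lightSol S d ul s) ∧ HasSol S d (residual d s) ul σ' := by
  have := hB.neZero
  have hR0 := d.radix_pos
  have hRB : d.radix < 2 ^ B := hB.lt_of_le_radix hB.radix_le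
  have hmB : d.m < 2 ^ B := hB.lt_of_le_pow 1 (by norm_num) (by have := hB.m; simp; omega)
  refine Run.le (Run.seq_assign (k := s) (.reg h5) (Run.seq (c' := d.n * 16 + T + 10) (Run.framed
    (Run.forTo (N := d.m) (c := 23)
    (fun i σ' => σ'.reg 9 = (s / d.radix ^ i : ℕ) ∧ ∀ i' < i, σ'.arr 13 (i' : ℤ) = residual d s i')
    (by decide) (by decide) (by decide) (by simpa using hin.m) hmB (by simp) ?_)) ?_)) ?_
  · rintro i hi σ' ⟨h9, h13⟩ h8 hf
    have hqB : s / d.radix ^ i < 2 ^ B :=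
      hB.lt_of_le_radix ((Nat.div_le_self _ _).trans hs.le)
    have hbi : σ'.arr 1 (i : ℤ) = d.b i := by
      rw [hf.2 1 (by decide)]
      simpa using hin.b i hi
    have h3' : σ'.reg 3 = d.radix := by rw [hf.1 3 (by decide)]; simpa using h3
    refine Run.le (Run.seq_write (z := i) (k := residual d s i) (.reg h8) (.sub (.read (z := i) (.reg h8) hbi)
      (.mod (.reg h9) (.reg h3') hR0.ne' hqB hRB) (hsb i hi)
      (hB.lt_of_le_pow 1 (by norm_num) (by simpa using hb i hi)))
      (Run.assign (.floorDiv (.reg (by simpa using h9)) (.reg (by simpa using h3')) hR0.ne' hqB hRB)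
      ⟨?_, ?_⟩)) (by simp [Expr.cost, modE])
    · simp [Nat.div_div_eq_div_mul, pow_succ]
    · intro i' hi'
      simp only [State.setReg_arr]
      rw [State.setCell_arr]
      rcases Nat.lt_succ_iff_lt_or_eq.mp hi' with h | rfl
      · rw [if_neg (by simp [h.ne]), h13 i' h]
      · simp
  · rintro τ ⟨⟨-, h13⟩, hf⟩
    have hf' : Frame [9, 8] [13] σ τ :=
      ((frame_setReg σ 9 s).mono (by decide) (by decide)).trans (hf.mono (by decide) (by decide))
    have hin' := hin.frame hf'
    have h7' : ∀ j < d.n, τ.arr 7 (j : ℤ) = ul j := by rw [hf'.2 7 (by decide)]; exact h7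
    have hlp := getLP_eq hin' h13 h7'
    refine Run.le (Run.seq (c' := d.n * 16 + 7) (Q := fun σ' => Inp d σ' ∧
      HasSol S d (residual d s) ul σ') (Run.solveLP (T := T) hin'.m hin'.n (by rw [hlp]; exact hT) ⟨?_, ?_⟩) ?_)
      (by omega)
    · refine hin'.frame (W := []) (A := [6]) ⟨fun r _ => rfl, fun a ha => ?_⟩
      exact State.setVec_arr_ne _ (by simpa using ha) _
    · intro j
      rw [State.setVec_arr, hlp]
    · rintro σ' ⟨hin'', hs'⟩
      refine Run.post (Run.framed (run_profitP hB hin'' hs' hul)) ?_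
      rintro σ'' ⟨h12, hfr⟩
      refine ⟨h12, fun j => ?_⟩
      rw [hfr.2 6 (by decide)]
      exact hs' j
  · simp only [Expr.cost]
    omega

end RAM

/-! ### Choice of the best solution and output -/

namespace RAM

variable {S : LPSolver} {B E : ℕ} {d : Data} {σ : State} {L : ℕ} {it : ℕ → ℕ} {T : Table}

/-- Complete the code number `reg 21` of the last layer by light items and compare with the best
solution. -/
def scanBody : Prog :=
  .seq (.assign 5 (.read 12 (addrE (.reg 21) (.reg 16)))) (.seq lightP
    (.ite (.lt (.reg 23) (.add (.reg 12) (.read 9 (addrE (.reg 5) (.reg 16)))))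
      (.seq (.assign 23 (.add (.reg 12) (.read 9 (addrE (.reg 5) (.reg 16))))) (.assign 26 (.reg 5)))
      .skip))

/-- Find the best completion of a code of the last layer. -/
def scanP : Prog := .seq (.assign 23 (.const 0)) (.seq (.assign 26 (.const 0)) (forTo 21 19 scanBody))

/-- One plus the profit of the solution that stems from the code `s` of the last layer. -/
def total (S : LPSolver) (d : Data) (ul : ℕ → ℕ) (T : Table) (L s : ℕ) : ℕ :=
  d.profit (lightSol S d ul s) + T.nv s L

/-- The hypotheses of the last phase of the algorithm. -/
structure Final (S : LPSolver) (d : Data) (B E L : ℕ) (it : ℕ → ℕ) (T : Table) (cnt : ℕ)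
    (ul : ℕ → ℕ) (TL : ℕ) : Prop extends DPBound d B E L it where
  b_le : ∀ i < d.m, d.b i ≤ E
  ul_le : ∀ j < d.n, ul j ≤ E
  done : T.Done d it L cnt
  cost : ∀ s, S.cost (d.lp (residual d s) ul) ≤ TL

variable {cnt TL : ℕ} {ul : ℕ → ℕ}

theorem Final.digit_le (hF : Final S d B E L it T cnt ul TL) {s : ℕ} (hs : T.nv s L ≠ 0) {i : ℕ}
    (hi : i < d.m) : d.digit s i ≤ d.b i := by
  obtain ⟨h1, h2, -⟩ := hF.done.sound L le_rfl s hs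
  rw [← h1, h2.digit_key hi]
  exact h2 i hi

theorem Final.total_lt (hF : Final S d B E L it T cnt ul TL) (s : ℕ) :
    total S d ul T L s < 2 ^ B := by
  have h1 := profit_roundDown_le (S := S) (bb := residual d s) hF.n hF.c hF.ul_le d.n le_rfl
  have h2 := (hF.done.sound L le_rfl).nv_le hF.n hF.c hF.mult_le s
  have h3 : d.profit (lightSol S d ul s) ≤ E ^ 3 := h1
  refine hF.lt_of_le_pow 4 (by norm_num) ?_
  have h4 : E ^ 4 = E * E ^ 3 := by ring
  have h5 : 2 * E ^ 3 ≤ E * E ^ 3 := Nat.mul_le_mul_right _ hF.two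
  unfold total
  omega

/-- Zero is a safe initial value, because entries of found codes are positive and so every total
exceeds it. By `h0` the scan is not vacuous. -/
theorem run_scanP (hF : Final S d B E L it T cnt ul TL) (hin : Inp d σ)
    (h3 : σ.reg 3 = d.radix) (hT : Rep L σ T) (h16 : σ.reg 16 = L) (h19 : σ.reg 19 = cnt)
    (h7 : ∀ j < d.n, σ.arr 7 (j : ℤ) = ul j) (h0 : T.nv 0 L ≠ 0) :
    Run S B scanP σ (cnt * (d.m * 30 + d.n * 16 + TL + 80) + 10) fun σ' =>
      ∃ s, T.nv s L ≠ 0 ∧ σ'.reg 26 = s ∧ σ'.reg 23 = total S d ul T L s ∧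
        ∀ s', T.nv s' L ≠ 0 → total S d ul T L s' ≤ total S d ul T L s := by
  have := hF.neZero
  have hsound := hF.done.sound L le_rfl
  have hcR := hF.done.lists.cnt_le hsound
  refine Run.le (Run.seq_assign (.const 0 (by positivity)) (Run.seq_assign (.const 0 (by positivity))
    (Run.post (Run.forTo (N := cnt) (c := d.m * 30 + d.n * 16 + TL + 73)
    (fun q σ' => ∃ v s : ℕ, σ'.reg 23 = v ∧ σ'.reg 26 = s ∧ (∀ p < q, total S d ul T L (T.ls p L) ≤ v) ∧
      ((q = 0 ∧ v = 0) ∨ (T.nv s L ≠ 0 ∧ v = total S d ul T L s)))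
    (by decide) (by decide) (by decide) (by simpa using h19) (hF.lt_of_le_radix hcR)
    ⟨0, 0, by simp⟩ ?_) ?_))) ?_
  · rintro q hq σ' ⟨v, s₀, h23, h26, hmax, hcase⟩ h21 hf
    have hf' : Frame [23, 26, 21, 5, 9, 8, 12, 11] [13, 6] σ σ' :=
      (((frame_setReg σ 23 _).mono (by decide) (by decide)).trans
        ((frame_setReg _ 26 _).mono (by decide) (by decide))).trans (hf.mono (by decide) (by decide))
    have hT' : Rep L σ' T := hT.frame hf'
    have h16' : σ'.reg 16 = L := by rw [hf'.1 16 (by decide), h16]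
    have hne := hF.done.lists.ne q hq
    set s := T.ls q L with hs
    have hsR : s < d.radix ^ d.m := hsound.lt hne
    refine Run.le (Run.seq_assign (k := s) (.read (hF.ev_addr (.reg h21) (.reg h16') h16'
      (by omega) le_rfl) (hT'.ls q L le_rfl)) (Run.seq (c' := 40) (Run.framed
      (run_lightP (σ := σ'.setReg 5 s) (s := s) hF.toBound hF.b_le
      ((hin.frame hf').frame (frame_setReg _ _ _)) ?_ ?_ hF.ul_le (by simp) hsR
      (fun i hi => hF.digit_le hne hi) (hF.cost s))) ?_)) ?_
    · rw [State.setReg_reg, if_neg (by decide), hf'.1 3 (by decide), h3]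
    · rw [State.setReg_arr, hf'.2 7 (by decide)]; exact h7
    · rintro τ ⟨⟨h12, -⟩, hfr⟩
      have hT₂ : Rep L τ T := Rep.frame (σ := σ'.setReg 5 s) ⟨hT'.nv, hT'.pa, hT'.tk, hT'.ls⟩ hfr
      have h5 : τ.reg 5 = s := by rw [hfr.1 5 (by decide)]; simp
      have h16'' : τ.reg 16 = L := by rw [hfr.1 16 (by decide)]; simpa using h16'
      have h23' : τ.reg 23 = v := by rw [hfr.1 23 (by decide)]; simpa using h23
      have h26' : τ.reg 26 = s₀ := by rw [hfr.1 26 (by decide)]; simpa using h26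
      have hE : Ev B τ (.add (.reg 12) (.read 9 (addrE (.reg 5) (.reg 16)))) (total S d ul T L s) :=
        .add (.reg h12) (.read (hF.ev_addr (.reg h5) (.reg h16'') h16'' hsR.le le_rfl)
          (hT₂.nv s L le_rfl)) (hF.total_lt s)
      refine Run.le (Run.ite (c := 15) (c' := 1) (.lt (.reg h23') hE)
        (fun hlt => Run.le (Run.seq_assign hE (Run.assign (k := s) (.reg (by simpa using h5))
          ⟨total S d ul T L s, s, by simp, by simp, ?_, .inr ⟨hne, rfl⟩⟩)) (by simp [Expr.cost, addrE]))
        (fun hlt => Run.skip ⟨v, s₀, by simpa using h23', by simpa using h26', ?_, ?_⟩))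
        (by simp [Expr.cost, addrE, Test.cost])
      · intro p hp
        rcases Nat.lt_succ_iff_lt_or_eq.mp hp with h | rfl
        · exact (hmax p h).trans hlt.le
        · exact le_rfl
      · intro p hp
        rcases Nat.lt_succ_iff_lt_or_eq.mp hp with h | rfl
        · exact hmax p h
        · exact not_lt.mp hlt
      · rcases hcase with ⟨-, rfl⟩ | h
        · exfalso
          have : 0 < T.nv s L := Nat.pos_of_ne_zero hne
          unfold total at hlt
          omega
        · exact .inr h
    · simp only [Expr.cost, addrE]
      omega
  · rintro τ ⟨v, s, h23, h26, hmax, hcase⟩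
    have hall : ∀ s', T.nv s' L ≠ 0 → total S d ul T L s' ≤ v := by
      intro s' hs'
      obtain ⟨q, hq, rfl⟩ := hF.done.lists.ex s' hs'
      exact hmax q hq
    rcases hcase with ⟨-, rfl⟩ | ⟨hs, rfl⟩
    · exfalso
      have := hall 0 h0
      unfold total at this
      omega
    · exact ⟨s, hs, h26, h23, hall⟩
  · simp only [Expr.cost]
    rw [show d.m * 30 + d.n * 16 + TL + 80 = d.m * 30 + d.n * 16 + TL + 73 + 7 from rfl]
    omega

/-- Add the items that are recorded for the code `reg 5` of layer `reg 27`. -/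
def backBody : Prog :=
  .seq (.assign 24 (addrE (.reg 5) (.reg 27)))
  (.seq (.assign 27 (.sub (.reg 27) (.const 1)))
  (.seq (.ite (.eq (.read 11 (.reg 24)) (.const 1))
    (.seq (.assign 4 (.read 8 (.reg 27))) (.write 4 (.reg 4) (.add (.read 4 (.reg 4)) (.const 1)))) .skip)
  (.assign 5 (.read 10 (.reg 24)))))

/-- Write the best solution to array `4` and its value to register `0`. -/
def outP : Prog :=
  .seq (.assign 5 (.reg 26)) (.seq lightP
  (.seq (forTo 11 1 (.write 4 (.reg 11) (.floor (.read 6 (.reg 11)))))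
  (.seq (.assign 27 (.reg 16)) (.seq (forTo 21 16 backBody) (.assign 0 (.sub (.reg 23) (.const 1)))))))

/-- Following one parent pointer moves at most one copy from the recorded selection to the output,
so the sum of both is preserved. -/
theorem run_backBody (hB : DPBound d B E L it) (hd : T.Done d it L cnt) (hT : Rep L σ T)
    (h16 : σ.reg 16 = L) (h8 : ∀ p < L, σ.arr 8 (p : ℤ) = it p) {l s : ℕ} {z : ℕ → ℕ} (hl : l + 1 ≤ L)
    (h5 : σ.reg 5 = s) (h27 : σ.reg 27 = (l + 1 : ℕ)) (hs : T.nv s (l + 1) ≠ 0)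
    (h4 : ∀ j < d.n, σ.arr 4 (j : ℤ) = z j) (hz : ∀ j < d.n, z j ≤ 2 * E) :
    Run S B backBody σ 40 fun σ' => ∃ s' : ℕ, σ'.reg 5 = s' ∧ σ'.reg 27 = l ∧ T.nv s' l ≠ 0 ∧
      ∃ z' : ℕ → ℕ, (∀ j < d.n, σ'.arr 4 (j : ℤ) = z' j) ∧
        ∀ j, z' j + T.wit it l s' j = z j + T.wit it (l + 1) s j := by
  have := hB.neZero
  have h1B := Nat.one_lt_two_pow (NeZero.ne B)
  obtain ⟨-, -, -, -, hpar⟩ := hd.sound (l + 1) hl s hs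
  have hpar := hpar (by omega)
  rw [Nat.add_sub_cancel] at hpar
  have hsR := (hd.sound (l + 1) hl).lt hs
  have hlB : l + 1 < 2 ^ B := hB.lt_of_le_pow 6 (by norm_num) (by have := hB.len_le; omega)
  have hitn := hB.it_lt l (by omega)
  set a := s * (L + 1) + (l + 1) with ha
  have hsub : Ev B (σ.setReg 24 a) (.sub (.reg 27) (.const 1)) l := by
    have h := Ev.sub (B := B) (σ := σ.setReg 24 a) (e := .reg 27) (a := l + 1)
      (.reg (by simpa using h27)) (.const 1 h1B) (by omega) hlB
    rwa [Nat.add_sub_cancel] at h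
  refine Run.le (Run.seq_assign (k := a) (hB.ev_addr (.reg h5) (.reg h27) h16 hsR.le hl)
    (Run.seq_assign hsub (Run.seq (c' := 3) (Q := fun τ => τ.reg 24 = a ∧ τ.reg 27 = l ∧
      τ.arr 10 = σ.arr 10 ∧ ∃ z' : ℕ → ℕ, (∀ j < d.n, τ.arr 4 (j : ℤ) = z' j) ∧
        ∀ j, z' j + T.wit it l (T.pa s (l + 1)) j = z j + T.wit it (l + 1) s j)
      (Run.ite (c := 11) (c' := 1) (.eq (.read (z := a) (.reg (by simp)) (hT.tk s (l + 1) hl))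
        (.const 1 h1B)) (fun h => ?_) (fun h => ?_)) ?_))) ?_
  · refine Run.le (Run.seq_assign (k := it l) (.read (z := l) (.reg (by simp)) (h8 l (by omega)))
      (Run.write (z := it l) (.reg (by simp)) (.add (.read (z := it l) (.reg (by simp)) (h4 (it l) hitn))
        (.const 1 h1B) ?_) ⟨by simp, by simp, ?_, addItem z (it l), ?_, ?_⟩)) (by simp [Expr.cost])
    · refine hB.lt_of_le_pow 3 (by norm_num) ?_
      have h1 := hz (it l) hitn
      have h2 := hB.two
      have h3 : E ^ 3 = E * (E * E) := by ring
      nlinarith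
    · funext y; simp
    · intro j hj
      simp only [State.setCell_arr, State.setReg_arr, addItem, true_and, Nat.cast_inj]
      split_ifs with h'
      · rw [h']
      · rw [h4 j hj, add_zero]
    · intro j
      rw [Table.wit, if_pos h]
      simp only [addItem]
      omega
  · refine Run.skip ⟨by simp, by simp, rfl, z, h4, fun j => ?_⟩
    rw [Table.wit, if_neg h]
  · rintro τ ⟨h24, h27', h10, z', h4', hz'⟩
    refine Run.assign (k := T.pa s (l + 1)) (.read (z := a) (.reg h24) ?_)
      ⟨T.pa s (l + 1), by simp, by simpa using h27', hpar, z', h4', hz'⟩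
    rw [h10]
    exact hT.pa s (l + 1) hl
  · simp only [Expr.cost, Test.cost, addrE]
    omega

/-- The linear program of the best code is solved once more instead of storing all solutions. At
layer `0` nothing is left of the recorded selection, and the final subtraction undoes the offset of
the table entries. -/
theorem run_outP (hF : Final S d B E L it T cnt ul TL) (hin : Inp d σ)
    (h3 : σ.reg 3 = d.radix) (hT : Rep L σ T) (h16 : σ.reg 16 = L)
    (h7 : ∀ j < d.n, σ.arr 7 (j : ℤ) = ul j) (h8 : ∀ p < L, σ.arr 8 (p : ℤ) = it p) {s : ℕ}
    (hs : T.nv s L ≠ 0) (h26 : σ.reg 26 = s) (h23 : σ.reg 23 = total S d ul T L s) :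
    Run S B outP σ (d.m * 30 + d.n * 30 + L * 47 + TL + 60) fun σ' =>
      (∀ j < d.n, σ'.arr 4 (j : ℤ) = (lightSol S d ul s j + T.wit it L s j : ℕ)) ∧
      σ'.reg 0 = (d.profit (lightSol S d ul s) + d.profit (T.wit it L s) : ℕ) := by
  have := hF.neZero
  have h1B := Nat.one_lt_two_pow (NeZero.ne B)
  have hsound := hF.done.sound L le_rfl
  have hsR := hsound.lt hs
  have hnB : d.n < 2 ^ B := hF.lt_of_le_pow 1 (by norm_num) (by have := hF.n; simp; omega)
  have hLB : L < 2 ^ B := hF.lt_of_le_pow 6 (by norm_num) (by have := hF.len_le; omega)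
  have hyE : ∀ j < d.n, lightSol S d ul s j ≤ E := fun j hj => (roundDown_le hj).trans (hF.ul_le j hj)
  have hwE : ∀ j, T.wit it L s j ≤ E := fun j => ((hsound s hs).2.2.2.1 j).trans (hF.mult_le j)
  refine Run.le (Run.seq_assign (k := s) (.reg h26) (Run.seq (c' := d.n * 14 + L * 47 + 38) (Run.framed
    (run_lightP (σ := σ.setReg 5 s) (s := s) hF.toBound hF.b_le (hin.frame (frame_setReg _ _ _))
      (by simpa using h3) h7 hF.ul_le (by simp) hsR (fun i hi => hF.digit_le hs hi) (hF.cost s))) ?_)) ?_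
  · rintro σ₁ ⟨⟨-, hsol⟩, hf₁'⟩
    have hf₁ : Frame [5, 9, 8, 12, 11] [13, 6] σ σ₁ :=
      ((frame_setReg σ 5 s).mono (by decide) (by decide)).trans (hf₁'.mono (by decide) (by decide))
    have hin₁ := hin.frame hf₁
    have h5₁ : σ₁.reg 5 = s := by rw [hf₁'.1 5 (by decide)]; simp
    refine Run.le (Run.seq (c' := L * 47 + 32) (Run.framed (Run.forTo (N := d.n) (c := 5)
      (fun k σ' => ∀ j < k, σ'.arr 4 (j : ℤ) = lightSol S d ul s j) (by decide) (by decide) (by decide)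
      hin₁.n hnB (by simp) ?_)) ?_) (by omega)
    · intro j hj σ' h4 h11 hf
      have hsol' : HasSol S d (residual d s) ul σ' := fun j => by
        rw [hf.2 6 (by decide)]
        exact hsol j
      refine Run.le (Run.write (z := j) (.reg h11) (hsol'.ev hF.toBound hF.ul_le (.reg h11) hj) ?_)
        (by simp [Expr.cost])
      intro j' hj'
      rw [State.setReg_arr, State.setCell_arr]
      rcases Nat.lt_succ_iff_lt_or_eq.mp hj' with h | rfl
      · rw [if_neg (by simp [h.ne]), h4 j' h]
      · simp [lightSol]
    · rintro σ₂ ⟨h4, hf₂'⟩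
      have hf₂ : Frame [5, 9, 8, 12, 11] [13, 6, 4] σ σ₂ :=
        (hf₁.mono (by decide) (by decide)).trans (hf₂'.mono (by decide) (by decide))
      have h16₂ : σ₂.reg 16 = L := by rw [hf₂.1 16 (by decide), h16]
      have h5₂ : σ₂.reg 5 = s := by rw [hf₂'.1 5 (by decide), h5₁]
      refine Run.le (Run.seq_assign (k := L) (.reg h16₂) (Run.seq (c' := 10) (Run.framed (Run.forTo (N := L)
        (c := 40) (fun k σ' => ∃ s' : ℕ, σ'.reg 5 = s' ∧ σ'.reg 27 = (L - k : ℕ) ∧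
          T.nv s' (L - k) ≠ 0 ∧ ∃ z' : ℕ → ℕ, (∀ j < d.n, σ'.arr 4 (j : ℤ) = z' j) ∧
          ∀ j, z' j + T.wit it (L - k) s' j = lightSol S d ul s j + T.wit it L s j)
        (by decide) (by decide) (by decide) (by simpa using h16₂) hLB ?_ ?_)) ?_)) ?_
      · exact ⟨s, by simpa using h5₂, by simp, by simpa using hs, _, by simpa using h4, by simp⟩
      · rintro k hk σ' ⟨s', h5, h27, hs', z', h4', hz'⟩ h21 hf
        have hf₃ : Frame [27, 21, 5, 9, 8, 12, 11, 24, 4] [13, 6, 4] σ σ' :=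
          ((hf₂.mono (by decide) (by decide)).trans ((frame_setReg σ₂ 27 L).mono (by decide)
            (by decide))).trans (hf.mono (by decide) (by decide))
        obtain ⟨l, hl⟩ : ∃ l, L - k = l + 1 := ⟨L - k - 1, by omega⟩
        rw [hl] at h27 hs' hz'
        have hl' : L - (k + 1) = l := by omega
        rw [hl']
        refine Run.post (run_backBody hF.toDPBound hF.done (hT.frame hf₃)
          (by rw [hf₃.1 16 (by decide), h16]) (by rw [hf₃.2 8 (by decide)]; exact h8) (by omega)
          h5 h27 hs' h4' ?_) ?_
        · intro j hj
          have h1 := hz' j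
          have h2 := hyE j hj
          have h3 := hwE j
          omega
        · rintro τ ⟨s'', h5'', h27'', hs'', z'', h4'', hz''⟩
          exact ⟨s'', by simpa using h5'', by simpa using h27'', hs'', z'', h4'',
            fun j => (hz'' j).trans (hz' j)⟩
      · rintro τ ⟨⟨s', -, -, -, z', h4', hz'⟩, hfr⟩
        have h23' : τ.reg 23 = total S d ul T L s := by
          rw [hfr.1 23 (by decide), State.setReg_reg, if_neg (by decide), hf₂.1 23 (by decide), h23]
        have hnv := (hsound s hs).2.2.1
        refine Run.le (Run.assign (.sub (.reg h23') (.const 1 h1B) ?_ (hF.total_lt s)) ⟨?_, ?_⟩)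
          (by simp [Expr.cost])
        · unfold total; omega
        · intro j hj
          rw [State.setReg_arr, h4' j hj]
          have h1 := hz' j
          simp only [Nat.sub_self, Table.wit, Pi.zero_apply, add_zero] at h1
          rw [h1]
        · rw [State.setReg_reg, if_pos rfl]
          congr 1
          unfold total
          omega
      · simp only [Expr.cost]
        omega
  · simp only [Expr.cost]
    omega

end RAM

/-! ### Analysis of the approximation -/

namespace Data

variable {d : Data}

theorem load_add (x y : ℕ → ℕ) (i : ℕ) : d.load (fun j => x j + y j) i = d.load x i + d.load y i := by
  simp only [load, mul_add, sum_add_distrib]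

theorem profit_add (x y : ℕ → ℕ) : d.profit (fun j => x j + y j) = d.profit x + d.profit y := by
  simp only [profit, mul_add, sum_add_distrib]

theorem adm_zero_iff (j : ℕ) : d.Adm 0 j ↔ ∀ i < d.m, d.a i j ≤ d.b i := by
  simp [Adm, digit]

/-- An item that does not fit alone occurs in no solution, so passing from `d.u` to `d.cap` loses
none. -/
theorem Packs.le_cap {z : ℕ → ℕ} (hz : d.Packs z) {j : ℕ} (hj : j < d.n) (hu : z j ≤ d.u j) :
    z j ≤ d.cap j := by
  unfold cap
  split_ifs with h
  · exact hu
  · by_contra h0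
    refine h ((adm_zero_iff j).mpr fun i hi => le_trans ?_ (hz i hi))
    have h1 : d.a i j * z j ≤ d.load z i :=
      single_le_sum (f := fun j => d.a i j * z j) (fun _ _ => Nat.zero_le _) (mem_range.mpr hj)
    have h2 : 1 ≤ z j := by omega
    nlinarith

theorem packs_single {j : ℕ} (hj : j < d.n) (h : 0 < d.cap j) :
    d.Packs (addItem 0 j) ∧ d.profit (addItem 0 j) = d.c j ∧ ∀ j', addItem 0 j j' ≤ d.cap j' := by
  refine ⟨?_, ?_, ?_⟩
  · unfold cap at h
    split_ifs at h with ha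
    · intro i hi
      rw [load_addItem _ hj]
      have : d.load 0 i = 0 := by simp [load]
      rw [this, zero_add]
      exact (adm_zero_iff j).mp ha i hi
    · exact absurd h (lt_irrefl 0)
  · rw [profit_addItem _ hj, profit_zero, zero_add]
  · intro j'
    simp only [addItem, Pi.zero_apply, zero_add]
    split_ifs with h'
    · rw [h']; omega
    · exact Nat.zero_le _

end Data

/-- The data that the algorithm derives: `p / r` is the accuracy, `cp` are the bounds on the numbers
of copies and `G` approximates the optimum. -/
structure Guess (d : Data) (cp : ℕ → ℕ) (p r G : ℕ) : Prop where
  m_pos : 0 < d.m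
  p_pos : 0 < p
  r_pos : 0 < r
  upper : ∀ z, d.Packs z → (∀ j < d.n, z j ≤ cp j) → d.profit z ≤ (d.m + 1) * G
  item : ∀ j < d.n, 0 < cp j → d.c j ≤ G
  lower : ∃ z, d.Packs z ∧ (∀ j < d.n, z j ≤ cp j) ∧ d.profit z = G

namespace Guess

variable {d : Data} {cp : ℕ → ℕ} {p r G : ℕ} (h : Guess d cp p r G)

include h

/-- A solution has few heavy items. -/
theorem sum_le {x : ℕ → ℕ} (hx : d.Packs x)
    (hxc : ∀ j < d.n, x j ≤ if p * G / (r * d.m) < d.c j then cp j else 0) :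
    ∑ j ∈ range d.n, x j ≤ d.m * (d.m + 1) * r / p := by
  have hcp : ∀ j < d.n, x j ≤ cp j := fun j hj => (hxc j hj).trans (by split_ifs <;> simp)
  have hheavy : ∀ j < d.n, 0 < x j → p * G / (r * d.m) < d.c j := by
    intro j hj h0
    by_contra hc
    have := hxc j hj
    rw [if_neg hc] at this
    omega
  -- For `G = 0` the threshold is zero and every usable item has profit zero, so none is heavy.
  rcases Nat.eq_zero_or_pos G with rfl | hG
  · rw [sum_eq_zero]
    · exact Nat.zero_le _
    · intro j hj
      have hj := mem_range.mp hj
      by_contra h0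
      have h1 := hheavy j hj (Nat.pos_of_ne_zero h0)
      have h2 := h.item j hj (by have := hcp j hj; omega)
      exact absurd (lt_of_le_of_lt (Nat.zero_le _) h1) (by omega)
  · rw [Nat.le_div_iff_mul_le h.p_pos]
    -- Every copy in `x` is heavy. Profits are integers, so exceeding the rounded threshold means
    -- exceeding `p G / (r m)` itself.
    have h1 : (∑ j ∈ range d.n, x j) * (p * G) ≤ d.profit x * (r * d.m) := by
      rw [Data.profit, sum_mul, sum_mul]
      refine sum_le_sum fun j hj => ?_
      have hj := mem_range.mp hj
      rcases Nat.eq_zero_or_pos (x j) with h0 | h0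
      · simp [h0]
      · have h2 := hheavy j hj h0
        rw [Nat.div_lt_iff_lt_mul (Nat.mul_pos h.r_pos h.m_pos)] at h2
        calc x j * (p * G) ≤ x j * (d.c j * (r * d.m)) := Nat.mul_le_mul_left _ h2.le
          _ = _ := by ring
    have h2 := h.upper x hx hcp
    refine Nat.le_of_mul_le_mul_right (c := G) ?_ hG
    calc (∑ j ∈ range d.n, x j) * p * G = (∑ j ∈ range d.n, x j) * (p * G) := by ring
      _ ≤ d.profit x * (r * d.m) := h1
      _ ≤ (d.m + 1) * G * (r * d.m) := Nat.mul_le_mul_right _ h2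
      _ = _ := by ring

/-- If the profit of every solution is at most `V` plus the loss that is due to light items, then
`V` is a good approximation of the optimum. -/
theorem approx {V : ℕ} (hV : ∀ z, d.Packs z → (∀ j < d.n, z j ≤ cp j) →
    d.profit z ≤ V + d.m * (p * G / (r * d.m))) {z : ℕ → ℕ} (hz : d.Packs z)
    (hzc : ∀ j < d.n, z j ≤ cp j) (hpr : p ≤ r) : (1 - (p : ℚ) / r) * d.profit z ≤ V := by
  have hr : (0 : ℚ) < r := by exact_mod_cast h.r_pos
  -- Passing to the better of `z` and the solution of profit `G` makes the profit at least `G`, so a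
  -- loss of `ε G` is at most a fraction `ε` of it.
  obtain ⟨z', hz', hz'V, hzz'⟩ : ∃ z', G ≤ d.profit z' ∧
      d.profit z' ≤ V + d.m * (p * G / (r * d.m)) ∧ d.profit z ≤ d.profit z' := by
    obtain ⟨g, hg, hgc, hgG⟩ := h.lower
    rcases le_total G (d.profit z) with hle | hle
    · exact ⟨z, hle, hV z hz hzc, le_rfl⟩
    · exact ⟨g, hgG.ge, hV g hg hgc, hgG ▸ hle⟩
  have h1 : d.m * (p * G / (r * d.m)) * r ≤ p * G := by
    calc d.m * (p * G / (r * d.m)) * r = p * G / (r * d.m) * (r * d.m) := by ring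
      _ ≤ p * G := Nat.div_mul_le_self _ _
  have h2 : d.profit z' * r ≤ V * r + p * d.profit z' := by
    calc d.profit z' * r ≤ (V + d.m * (p * G / (r * d.m))) * r := Nat.mul_le_mul_right _ hz'V
      _ = V * r + d.m * (p * G / (r * d.m)) * r := by ring
      _ ≤ V * r + p * d.profit z' :=
        Nat.add_le_add_left (h1.trans (Nat.mul_le_mul_left _ hz')) _
  have h3 : (d.profit z' * r : ℚ) ≤ V * r + p * d.profit z' := by exact_mod_cast h2
  have h4 : (1 - (p : ℚ) / r) * d.profit z' ≤ V := by
    rw [one_sub_div hr.ne', div_mul_eq_mul_div, div_le_iff₀ hr]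
    linarith
  have h5 : (0 : ℚ) ≤ 1 - (p : ℚ) / r := by
    rw [sub_nonneg, div_le_one hr]; exact_mod_cast hpr
  exact (mul_le_mul_of_nonneg_left (by exact_mod_cast hzz') h5).trans h4

end Guess

namespace RAM

variable {S : LPSolver} {d : Data} {cp : ℕ → ℕ} {p r G L cnt : ℕ} {it : ℕ → ℕ} {T : Table}

/-- The solution that is found loses only light items. -/
theorem profit_le_total (h : Guess d cp p r G) {θ K V : ℕ} (hθ : θ = p * G / (r * d.m))
    (hK : K = d.m * (d.m + 1) * r / p) (hd : T.Done d it L cnt)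
    (hm : ∀ j, mult it L j = heavyCap d cp θ K j)
    (hV : ∀ s, T.nv s L ≠ 0 → total S d (lightCap d cp θ) T L s ≤ V + 1) {z : ℕ → ℕ}
    (hz : d.Packs z) (hzc : ∀ j < d.n, z j ≤ cp j) : d.profit z ≤ V + d.m * θ := by
  let zH : ℕ → ℕ := fun j => if j < d.n ∧ θ < d.c j then z j else 0
  let zL : ℕ → ℕ := fun j => if j < d.n ∧ θ < d.c j then 0 else z j
  have hsplit : ∀ j, z j = zL j + zH j := by
    intro j
    simp only [zL, zH]
    split_ifs <;> simp
  have hzfun : z = fun j => zL j + zH j := funext hsplit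
  have hHle : ∀ j, zH j ≤ z j := fun j => by rw [hsplit j]; omega
  have hHp : d.Packs zH := hz.mono fun j _ => hHle j
  have hsum := h.sum_le hHp (fun j hj => by
    rw [← hθ]
    simp only [zH, hj, true_and]
    split_ifs
    · exact hzc j hj
    · exact le_rfl)
  rw [← hK] at hsum
  have hHm : ∀ j, zH j ≤ mult it L j := by
    intro j
    rw [hm, heavyCap]
    by_cases hj : j < d.n ∧ θ < d.c j
    · rw [if_pos hj, le_min_iff]
      refine ⟨?_, (hHle j).trans (hzc j hj.1)⟩
      exact (single_le_sum (f := zH) (fun _ _ => Nat.zero_le _) (mem_range.mpr hj.1)).trans hsum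
    · simp only [zH, if_neg hj]
      exact Nat.zero_le _
  -- The table may hold another selection than `zH` under this code. It has the same loads and at
  -- least the same profit, so `zL` still fits beside it.
  have h1 := hd.complete zH hHp hHm
  have h2 : d.profit zL ≤ d.profit (lightSol S d (lightCap d cp θ) (d.key zH)) + d.m * θ := by
    refine profit_le_roundDown ?_ ?_ ?_
    · intro i hi
      rw [residual, hHp.digit_key hi]
      have h3 := hz i hi
      rw [hzfun, Data.load_add] at h3
      omega
    · intro j hj
      simp only [zL, lightCap, hj, true_and]
      split_ifs with h3 h4 h4
      · omega
      · exact le_rfl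
      · exact hzc j hj
      · omega
    · intro j hj h3
      unfold lightCap at h3
      split_ifs at h3 with h4
      · exact h4
      · exact absurd h3 (lt_irrefl 0)
  have h3 := hV (d.key zH) (by omega)
  rw [hzfun, Data.profit_add]
  unfold total at h3
  omega

/-- The solution that is found is feasible. -/
theorem packs_final {θ K s : ℕ} (hd : T.Done d it L cnt)
    (hm : ∀ j, mult it L j = heavyCap d cp θ K j) (hs : T.nv s L ≠ 0) :
    d.Packs (fun j => lightSol S d (lightCap d cp θ) s j + T.wit it L s j) ∧
      ∀ j < d.n, lightSol S d (lightCap d cp θ) s j + T.wit it L s j ≤ cp j := by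
  obtain ⟨h1, h2, -, h4, -⟩ := hd.sound L le_rfl s hs
  constructor
  · intro i hi
    rw [Data.load_add]
    have h5 : d.load (lightSol S d (lightCap d cp θ) s) i ≤ residual d s i :=
      load_roundDown_le hi
    have h6 := h2 i hi
    rw [residual, ← h1, h2.digit_key hi] at h5
    rw [h1] at h5
    omega
  · intro j hj
    have h5 : lightSol S d (lightCap d cp θ) s j ≤ lightCap d cp θ j := roundDown_le hj
    have h6 := h4 j
    rw [hm] at h6
    -- A light item does not occur in the list, and the linear program has upper bound zero for a
    -- heavy one, so the two bounds never add up.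
    generalize lightSol S d (lightCap d cp θ) s j = y at h5 ⊢
    unfold heavyCap at h6
    unfold lightCap at h5
    split_ifs at h5 h6 <;> omega

end RAM

/-! ### The approximation scheme -/

namespace RAM

/-- The approximation scheme. -/
def knapsackP : Prog :=
  .seq radixP (.seq capP (.seq (.solveLP 0 1 0 1 2 5 6) (.seq profitP (.seq boundP (.seq thresholdP
    (.seq itemsP (.seq dpP (.seq scanP outP))))))))

variable {S : LPSolver} {B E : ℕ} {d : Data} {σ : State}

/-- Any solution is worth at most the rounded vertex plus `m` times the largest profit, and both are
at most `G`. Conversely `G` is the profit of the rounded vertex or of a single item. -/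
theorem guess_of_lp {p r G : ℕ} (hm : 0 < d.m) (hp : 0 < p) (hr : 0 < r)
    (hgG : d.profit (roundDown (S.sol (d.lp d.b d.cap))) ≤ G)
    (hG : ∀ j < d.n, 0 < d.cap j → d.c j ≤ G)
    (hG' : G = d.profit (roundDown (S.sol (d.lp d.b d.cap))) ∨
      ∃ j < d.n, 0 < d.cap j ∧ G = d.c j) : Guess d d.cap p r G where
  m_pos := hm
  p_pos := hp
  r_pos := hr
  item := hG
  upper z hz hzc := by
    have := profit_le_roundDown (S := S) hz hzc hG
    rw [Nat.add_mul, one_mul]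
    omega
  lower := by
    rcases hG' with h | ⟨j, hj, hcp, h⟩
    · exact ⟨_, fun i hi => load_roundDown_le hi, fun j hj => roundDown_le hj, h.symm⟩
    · obtain ⟨h1, h2, h3⟩ := Data.packs_single hj hcp
      exact ⟨_, h1, fun j' _ => h3 j', h2.trans h.symm⟩

-- The cost still to be spent is carried from phase to phase as `c'`. The bound `X` is assumed only
-- for tables whose selections have at most `K` items; the determinants enter later through `hX`.
set_option maxRecDepth 8000 in
theorem run_knapsackP (hB : d.Bound B E) (hb : ∀ i < d.m, d.b i ≤ E) (hin : Inp d σ)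
    (hu : ∀ j < d.n, σ.arr 3 (j : ℤ) = d.u j) {ε : ℚ} {p r : ℕ} (hε : σ.reg 2 = ε)
    (hεpr : ε = (p : ℚ) / r) (hp : 0 < p) (hpr : p ≤ r) (hrE : r ≤ E)
    (h9 : σ.arr 9 = 0) (h10 : σ.arr 10 = 0) (h11 : σ.arr 11 = 0) (h12 : σ.arr 12 = 0) {TL : ℕ}
    (hTL : ∀ bb uu : ℕ → ℕ, (∀ i < d.m, bb i ≤ d.b i) → (∀ j < d.n, uu j ≤ d.u j) →
      S.cost (d.lp bb uu) ≤ TL) {K X : ℕ} (hK : K = d.m * (d.m + 1) * r / p)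
    (hX : ∀ (it : ℕ → ℕ) (l : ℕ) (T : Table) (cnt : ℕ), T.Done d it l cnt →
      (∀ x : ℕ → ℕ, d.Packs x → (∀ j, x j ≤ mult it l j) → ∑ j ∈ range d.n, x j ≤ K) → cnt ≤ X) :
    Run S B knapsackP σ (d.m * 12 + d.n * (d.m * 60 + 50) + TL + d.n * 38 + d.n * (K * 20 + 25) +
      d.n * K * (X * (d.m * 60 + 207) + 19) + X * (d.m * 30 + d.n * 16 + TL + 80) +
      (d.m * 30 + d.n * 30 + d.n * K * 47 + TL + 60) + 80) fun σ' =>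
      ∃ x : ℕ → ℕ, (∀ j < d.n, σ'.arr 4 (j : ℤ) = x j) ∧ σ'.reg 0 = d.profit x ∧ d.Packs x ∧
        (∀ j < d.n, x j ≤ d.u j) ∧ ∀ z, d.Packs z → (∀ j < d.n, z j ≤ d.u j) →
          (1 - ε) * d.profit z ≤ d.profit x := by
  have hr : 0 < r := by omega
  have hEm := hB.m
  have hEn := hB.n
  have hE2 := hB.two
  have hcapE : ∀ j < d.n, d.cap j ≤ E := fun j hj => (d.cap_le j).trans (hB.u j hj)
  have hKE : K ≤ E ^ 3 := by
    rw [hK, show E ^ 3 = E * E * E by ring]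
    exact (Nat.div_le_self _ _).trans (Nat.mul_le_mul (Nat.mul_le_mul (by omega) hEm) hrE)
  have hnKE : d.n * K ≤ E ^ 4 := by
    rw [show E ^ 4 = E * E ^ 3 by ring]
    exact Nat.mul_le_mul (by omega) hKE
  unfold knapsackP
  refine Run.le (Run.seq (c' := d.n * (d.m * 60 + 50) + TL + d.n * 38 + d.n * (K * 20 + 25) +
      d.n * K * (X * (d.m * 60 + 207) + 19) + X * (d.m * 30 + d.n * 16 + TL + 80) +
      (d.m * 30 + d.n * 30 + d.n * K * 47 + TL + 60) + 73) (Run.framed (run_radixP hB hin)) ?_)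
      (by omega)
  rintro σ₁ ⟨h3, f₁⟩
  refine Run.le (Run.seq (c' := TL + d.n * 38 + d.n * (K * 20 + 25) +
      d.n * K * (X * (d.m * 60 + 207) + 19) + X * (d.m * 30 + d.n * 16 + TL + 80) +
      (d.m * 30 + d.n * 30 + d.n * K * 47 + TL + 60) + 68) (Run.framed (run_capP hB (hin.frame f₁) h3
        (by rw [f₁.2 3 (by decide)]; exact hu))) ?_) (by omega)
  rintro σ₂ ⟨h5, f₂'⟩
  have f₂ := (f₁.mono (W' := [3, 8, 11, 4, 5, 6, 7, 9, 10]) (A' := [5]) (by decide) (by decide)).trans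
    (f₂'.mono (by decide) (by decide))
  have hin₂ := hin.frame f₂
  have hlp := getLP_eq hin₂ hin₂.b h5
  refine Run.le (Run.seq (c' := d.n * 38 + d.n * (K * 20 + 25) +
      d.n * K * (X * (d.m * 60 + 207) + 19) + X * (d.m * 30 + d.n * 16 + TL + 80) +
      (d.m * 30 + d.n * 30 + d.n * K * 47 + TL + 60) + 67) (Q := fun τ => Frame [] [6] σ₂ τ ∧
      HasSol S d d.b d.cap τ) (Run.solveLP (T := TL) hin₂.m hin₂.n
      (by rw [hlp]; exact hTL _ _ (fun _ _ => le_rfl) (fun j _ => d.cap_le j))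
      ⟨⟨fun _ _ => rfl, fun a ha => State.setVec_arr_ne _ (by simpa using ha) _⟩,
      fun j => by rw [State.setVec_arr, hlp]⟩) ?_) (by omega)
  rintro σ₃ ⟨f₃', hsol⟩
  have f₃ := (f₂.mono (W' := [3, 8, 11, 4, 5, 6, 7, 9, 10]) (A' := [5, 6]) (by decide)
    (by decide)).trans (f₃'.mono (by decide) (by decide))
  refine Run.le (Run.seq (c' := d.n * 22 + d.n * (K * 20 + 25) +
      d.n * K * (X * (d.m * 60 + 207) + 19) + X * (d.m * 30 + d.n * 16 + TL + 80) +
      (d.m * 30 + d.n * 30 + d.n * K * 47 + TL + 60) + 60) (Run.framed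
      (run_profitP hB (hin.frame f₃) hsol hcapE)) ?_) (by omega)
  rintro σ₄ ⟨h12', f₄'⟩
  have f₄ := (f₃.mono (W' := [3, 8, 11, 4, 5, 6, 7, 9, 10, 12]) (A' := [5, 6]) (by decide)
    (by decide)).trans (f₄'.mono (by decide) (by decide))
  have h5₄ : ∀ j < d.n, σ₄.arr 5 (j : ℤ) = d.cap j := by
    rw [f₄'.2 5 (by decide), f₃'.2 5 (by decide)]; exact h5
  refine Run.le (Run.seq (c' := d.n * (K * 20 + 25) +
      d.n * K * (X * (d.m * 60 + 207) + 19) + X * (d.m * 30 + d.n * 16 + TL + 80) +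
      (d.m * 30 + d.n * 30 + d.n * K * 47 + TL + 60) + 53) (Run.framed
      (run_boundP hB (hin.frame f₄) h5₄ h12')) ?_) (by omega)
  rintro σ₅ ⟨⟨G, h13, hgG, hGi, hG'⟩, f₅'⟩
  have hguess : Guess d d.cap p r G := guess_of_lp hB.m_pos hp hr hgG hGi hG'
  have hGE : G ≤ E ^ 3 := by
    rcases hG' with h | ⟨j, hj, -, h⟩
    · rw [h]; exact profit_roundDown_le hB.n hB.c hcapE d.n le_rfl
    · rw [h]; exact (hB.c j hj).trans (Nat.le_self_pow (by norm_num) E)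
  have f₅ := (f₄.mono (W' := [3, 8, 11, 4, 5, 6, 7, 9, 10, 12, 13]) (A' := [5, 6]) (by decide)
    (by decide)).trans (f₅'.mono (by decide) (by decide))
  refine Run.le (Run.seq (c' := d.n * (K * 20 + 25) +
      d.n * K * (X * (d.m * 60 + 207) + 19) + X * (d.m * 30 + d.n * 16 + TL + 80) +
      (d.m * 30 + d.n * 30 + d.n * K * 47 + TL + 60) + 33) (Run.framed
      (run_thresholdP hB (hin.frame f₅) (by rw [f₅.1 2 (by decide)]; exact hε) hεpr hp hr
        (by omega) hrE h13 hGE)) ?_) (by omega)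
  rintro σ₆ ⟨⟨h14, h15⟩, f₆'⟩
  rw [← hK] at h15
  obtain ⟨θ, hθ⟩ : ∃ θ, θ = p * G / (r * d.m) := ⟨_, rfl⟩
  rw [← hθ] at h14
  have f₆ := (f₅.mono (W' := [3, 8, 11, 4, 5, 6, 7, 9, 10, 12, 13, 14, 15]) (A' := [5, 6]) (by decide)
    (by decide)).trans (f₆'.mono (by decide) (by decide))
  have h5₆ : ∀ j < d.n, σ₆.arr 5 (j : ℤ) = d.cap j := by
    rw [f₆'.2 5 (by decide), f₅'.2 5 (by decide)]; exact h5₄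
  refine Run.le (Run.seq (c' := d.n * K * (X * (d.m * 60 + 207) + 19) +
      X * (d.m * 30 + d.n * 16 + TL + 80) + (d.m * 30 + d.n * 30 + d.n * K * 47 + TL + 60) + 26)
      (Run.framed (run_itemsP hB (hin.frame f₆) h5₆ h14 h15 (hB.lt_of_le_pow 4 (by norm_num) hnKE)))
      ?_) (by omega)
  rintro σ₇ ⟨⟨h7, L, it, hL, hit⟩, f₇'⟩
  have f₇ := (f₆.mono (W' := [3, 8, 11, 4, 5, 6, 7, 9, 10, 12, 13, 14, 15, 16, 17]) (A' := [5, 6, 7, 8])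
    (by decide) (by decide)).trans (f₇'.mono (by decide) (by decide))
  have h3₇ : σ₇.reg 3 = d.radix := by
    rw [f₇'.1 3 (by decide), f₆'.1 3 (by decide), f₅'.1 3 (by decide), f₄'.1 3 (by decide),
      f₃'.1 3 (by decide), f₂'.1 3 (by decide), h3]
  have hDP : DPBound d B E L it :=
    { hB with
      len_le := by
        have h1 : E ^ 6 = E ^ 4 * E ^ 2 := by ring
        have h2 : 1 ≤ E ^ 4 := Nat.one_le_pow _ _ hB.pos
        have h3 : 2 ≤ E ^ 2 := by nlinarith
        nlinarith
      it_lt := hit.lt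
      mult_le := fun j => by
        rw [hit.mult, heavyCap]
        split_ifs with hj
        · exact (min_le_right _ _).trans (hcapE j hj.1)
        · exact Nat.zero_le _ }
  -- The list contains heavy items only, so in every layer the selections have at most `K` items.
  have hcnt : ∀ l ≤ L, ∀ (T : Table) (cnt : ℕ), T.Done d it l cnt → cnt ≤ X := by
    intro l hl T cnt hd
    refine hX it l T cnt hd fun x hx hxm => ?_
    rw [hK]
    refine hguess.sum_le hx fun j hj => ?_
    have h1 := (hxm j).trans (mult_mono it hl j)
    rw [hit.mult, heavyCap] at h1
    rw [← hθ]
    by_cases hc : θ < d.c j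
    · rw [if_pos ⟨hj, hc⟩] at h1
      rw [if_pos hc]
      exact h1.trans (min_le_right _ _)
    · rw [if_neg fun h => hc h.2] at h1
      rw [if_neg hc]
      exact h1
  have hdpcost : L * (X * (d.m * 60 + 207) + 19) ≤ d.n * K * (X * (d.m * 60 + 207) + 19) :=
    Nat.mul_le_mul_right _ hL
  refine Run.le (Run.seq (c' := X * (d.m * 30 + d.n * 16 + TL + 80) +
      (d.m * 30 + d.n * 30 + d.n * K * 47 + TL + 60) + 16) (Run.framed (run_dpP hDP (hin.frame f₇) h3₇
      (by rw [f₇.2 9 (by decide), h9]) (by rw [f₇.2 10 (by decide), h10])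
      (by rw [f₇.2 11 (by decide), h11]) (by rw [f₇.2 12 (by decide), h12]) hit.len hit.arr hcnt))
      ?_) (by linarith)
  rintro σ₈ ⟨⟨T, cnt, hT, hd, h19⟩, f₈'⟩
  have f₈ := (f₇.mono (W' := [3, 8, 11, 4, 5, 6, 7, 9, 10, 12, 13, 14, 15, 16, 17, 18, 19, 20, 21, 22, 24])
    (A' := [5, 6, 7, 8, 9, 10, 11, 12]) (by decide) (by decide)).trans (f₈'.mono (by decide) (by decide))
  have hulc : ∀ j, lightCap d d.cap θ j ≤ d.cap j := fun j => by
    unfold lightCap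
    split_ifs <;> simp
  have hF : Final S d B E L it T cnt (lightCap d d.cap θ) TL :=
    { hDP with
      b_le := hb
      ul_le := fun j hj => (hulc j).trans (hcapE j hj)
      done := hd
      cost := fun s => hTL _ _ (fun i _ => Nat.sub_le _ _)
        (fun j _ => (hulc j).trans (d.cap_le j)) }
  have h0 : T.nv 0 L ≠ 0 := by
    have := hd.complete 0 Data.packs_zero (fun j => Nat.zero_le _)
    rw [Data.key_zero] at this
    omega
  have hsc : cnt * (d.m * 30 + d.n * 16 + TL + 80) ≤ X * (d.m * 30 + d.n * 16 + TL + 80) :=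
    Nat.mul_le_mul_right _ (hcnt L le_rfl T cnt hd)
  refine Run.le (Run.seq (c' := d.m * 30 + d.n * 30 + d.n * K * 47 + TL + 60) (Run.framed
      (run_scanP hF (hin.frame f₈) (by rw [f₈'.1 3 (by decide), h3₇]) hT
      (by rw [f₈'.1 16 (by decide), hit.len]) h19 (by rw [f₈'.2 7 (by decide)]; exact h7) h0)) ?_)
      (by linarith)
  rintro σ₉ ⟨⟨s, hs, h26, h23, hmax⟩, f₉'⟩
  have f₉ := (f₈.mono (W' := [3, 8, 11, 4, 5, 6, 7, 9, 10, 12, 13, 14, 15, 16, 17, 18, 19, 20, 21, 22, 24,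
      23, 26]) (A' := [5, 6, 7, 8, 9, 10, 11, 12, 13]) (by decide) (by decide)).trans
      (f₉'.mono (by decide) (by decide))
  have hLcost : L * 47 ≤ d.n * K * 47 := Nat.mul_le_mul_right _ hL
  refine Run.le (Run.post (run_outP hF (hin.frame f₉) (by rw [f₉'.1 3 (by decide), f₈'.1 3 (by decide), h3₇])
    (hT.frame f₉') (by rw [f₉'.1 16 (by decide), f₈'.1 16 (by decide), hit.len])
    (by rw [f₉'.2 7 (by decide), f₈'.2 7 (by decide)]; exact h7)
    (by rw [f₉'.2 8 (by decide), f₈'.2 8 (by decide)]; exact hit.arr) hs h26 h23) ?_) (by linarith)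
  rintro σ' ⟨hx, hval⟩
  obtain ⟨hpk, hxc⟩ := packs_final (S := S) hd hit.mult hs
  refine ⟨_, hx, by rw [Data.profit_add]; exact hval, hpk, fun j hj => (hxc j hj).trans (d.cap_le j),
    fun z hz hzu => ?_⟩
  rw [hεpr]
  -- Any competitor within the bounds `d.u` also obeys `d.cap`; the role of `V` is played by the
  -- profit of the output.
  refine hguess.approx (fun z hz hzc => ?_) hz (fun j hj => hz.le_cap hj (hzu j hj)) hpr
  rw [← hθ]
  refine profit_le_total (S := S) hguess hθ hK hd hit.mult (fun s' hs' => ?_) hz hzc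
  have h1 := hmax s' hs'
  have h2 := (hd.sound L le_rfl s hs).2.2.1
  rw [Data.profit_add]
  refine h1.trans ?_
  unfold total
  omega

end RAM

/-! ### Correctness and cost for an instance -/

namespace Knapsack

variable {m n : ℕ} (I : Knapsack m n)

/-- The data of an instance, extended by zero. -/
def data : Data where
  m := m
  n := n
  a i j := if h : i < m ∧ j < n then I.A ⟨i, h.1⟩ ⟨j, h.2⟩ else 0
  b i := if h : i < m then I.b ⟨i, h⟩ else 0
  c j := if h : j < n then I.c ⟨j, h⟩ else 0
  u j := if h : j < n then I.u ⟨j, h⟩ else 0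

theorem data_a (i : Fin m) (j : Fin n) : I.data.a i j = I.A i j := by simp [data]

theorem data_b (i : Fin m) : I.data.b i = I.b i := by simp [data]

theorem data_c (j : Fin n) : I.data.c j = I.c j := by simp [data]

theorem data_u (j : Fin n) : I.data.u j = I.u j := by simp [data]

theorem load_data (x : ℕ → ℕ) (i : Fin m) : I.data.load x i = ∑ j : Fin n, I.A i j * x j := by
  rw [Data.load, show I.data.n = n from rfl, sum_range]
  exact sum_congr rfl fun j _ => by rw [data_a]

theorem profit_data (x : ℕ → ℕ) : I.data.profit x = I.value fun j => x j := by
  rw [Data.profit, show I.data.n = n from rfl, sum_range, value]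
  exact sum_congr rfl fun j _ => by rw [data_c]

theorem feasible_iff (x : ℕ → ℕ) :
    I.Feasible (fun j => x j) ↔ I.data.Packs x ∧ ∀ j < n, x j ≤ I.data.u j := by
  refine and_congr ⟨fun h i hi => ?_, fun h i => ?_⟩ ⟨fun h j hj => ?_, fun h j => ?_⟩
  · have := h ⟨i, hi⟩
    rw [← I.load_data, ← data_b] at this
    exact this
  · rw [← I.load_data, ← data_b]
    exact h i i.2
  · have := h ⟨j, hj⟩
    rwa [← data_u] at this
  · rw [← data_u]
    exact h j j.2

theorem exists_extend (y : Fin n → ℕ) : ∃ x : ℕ → ℕ, (fun j : Fin n => x j) = y :=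
  ⟨fun j => if h : j < n then y ⟨j, h⟩ else 0, by simp⟩

theorem le_maxEntry : (∀ i j, I.A i j ≤ I.maxEntry) ∧ (∀ i, I.b i ≤ I.maxEntry) ∧
    (∀ j, I.c j ≤ I.maxEntry) ∧ ∀ j, I.u j ≤ I.maxEntry := by
  refine ⟨fun i j => ?_, fun i => ?_, fun j => ?_, fun j => ?_⟩
  · refine le_max_of_le_left (le_max_of_le_left ?_)
    exact (le_sup (f := fun j => I.A i j) (mem_univ j)).trans
      (le_sup (f := fun i => univ.sup fun j => I.A i j) (mem_univ i))
  · exact le_max_of_le_left (le_max_of_le_right (le_sup (f := I.b) (mem_univ i)))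
  · exact le_max_of_le_right (le_max_of_le_left (le_sup (f := I.c) (mem_univ j)))
  · exact le_max_of_le_right (le_max_of_le_right (le_sup (f := I.u) (mem_univ j)))

/-- Residual capacities and reduced upper bounds never exceed the original ones, so every linear
program that is solved falls under the cost bound for the solver. -/
theorem entriesLE_lp {bb uu : ℕ → ℕ} (hb : ∀ i < m, bb i ≤ I.data.b i)
    (hu : ∀ j < n, uu j ≤ I.data.u j) : (I.data.lp bb uu).EntriesLE I.maxEntry := by
  obtain ⟨h1, h2, h3, h4⟩ := I.le_maxEntry
  exact ⟨fun i j => ⟨_, h1 i j, congrArg Nat.cast (I.data_a i j)⟩,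
    fun i => ⟨bb i, (hb i i.2).trans ((I.data_b i).trans_le (h2 i)), rfl⟩,
    fun j => ⟨_, h3 j, congrArg Nat.cast (I.data_c j)⟩,
    fun j => ⟨uu j, (hu j j.2).trans ((I.data_u j).trans_le (h4 j)), rfl⟩⟩

/-- Different codes of a layer have witnesses with different loads. Each load is `A x` for a
selection with at most `k` items, so the bound by minors applies. -/
theorem cnt_le {D k : ℕ} (hD : I.IsModular D) {it : ℕ → ℕ} {l cnt : ℕ} {T : Table}
    (h : T.Done I.data it l cnt)
    (hk : ∀ x, I.data.Packs x → (∀ j, x j ≤ mult it l j) → ∑ j ∈ range n, x j ≤ k) :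
    cnt ≤ (2 * k + 1) ^ m * D := by
  have hs : ∀ q < cnt, _ := fun q hq => h.sound l le_rfl _ (h.lists.ne q hq)
  let F : ℕ → Fin m → ℕ := fun q i => I.data.load (T.wit it l (T.ls q l)) i
  have hinj : Set.InjOn F (range cnt) := by
    intro q hq q' hq' he
    have hq := mem_range.mp (mem_coe.mp hq)
    have hq' := mem_range.mp (mem_coe.mp hq')
    refine h.lists.inj q hq q' hq' ?_
    rw [← (hs q hq).1, ← (hs q' hq').1]
    exact I.data.code_congr fun i hi => congrFun he ⟨i, hi⟩
  have h1 := I.card_image_le hD k ((range cnt).image F) (by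
    intro v hv
    obtain ⟨q, hq, rfl⟩ := mem_image.mp hv
    obtain ⟨-, h2, -, h4, -⟩ := hs q (mem_range.mp hq)
    refine ⟨fun j => T.wit it l (T.ls q l) j, ?_, fun i => I.load_data _ i⟩
    have := hk _ h2 h4
    rwa [sum_range] at this)
  rw [card_image_of_injOn hinj, card_range] at h1
  exact h1.trans (Nat.mul_le_mul_right _ (Nat.pow_le_pow_right (by omega) I.rank_le))

theorem inp_init (ε : ℚ) : RAM.Inp I.data (RAM.State.init I ε) where
  m := by simp [RAM.State.init, data]
  n := by simp [RAM.State.init, data]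
  a i hi j hj := by
    have hk : (i * n + j : ℕ) = ((finProdFinEquiv (⟨i, hi⟩, ⟨j, hj⟩) : Fin (m * n)) : ℕ) := by
      simp [finProdFinEquiv]; ring
    rw [RAM.State.init, RAM.State.setVec_arr_ne _ (by decide), RAM.State.setVec_arr_ne _ (by decide),
      RAM.State.setVec_arr_ne _ (by decide)]
    change _ = ((I.data.a (⟨i, hi⟩ : Fin m) (⟨j, hj⟩ : Fin n) : ℕ) : ℚ)
    rw [data_a]
    change RAM.State.arr _ 0 ((i * n + j : ℕ) : ℤ) = _
    rw [hk, RAM.State.setVec_arr, Equiv.symm_apply_apply]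
  b i hi := by
    rw [RAM.State.init, RAM.State.setVec_arr_ne _ (by decide), RAM.State.setVec_arr_ne _ (by decide)]
    exact (RAM.State.setVec_arr _ _ _ (⟨i, hi⟩ : Fin m)).trans (by rw [← data_b])
  c j hj := by
    rw [RAM.State.init, RAM.State.setVec_arr_ne _ (by decide)]
    exact (RAM.State.setVec_arr _ _ _ (⟨j, hj⟩ : Fin n)).trans (by rw [← data_c])

theorem init_arr_three (ε : ℚ) {j : ℕ} (hj : j < n) :
    (RAM.State.init I ε).arr 3 (j : ℤ) = I.data.u j := by
  rw [RAM.State.init]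
  exact (RAM.State.setVec_arr _ _ _ (⟨j, hj⟩ : Fin n)).trans (by rw [← data_u])

theorem init_arr {a : ℕ} (ha : 3 < a) (ε : ℚ) : (RAM.State.init I ε).arr a = 0 := by
  rw [RAM.State.init, RAM.State.setVec_arr_ne _ (by omega), RAM.State.setVec_arr_ne _ (by omega),
    RAM.State.setVec_arr_ne _ (by omega), RAM.State.setVec_arr_ne _ (by omega)]
  rfl

theorem le_two_pow_inputLength (ε : ℚ) : m + 1 ≤ 2 ^ I.inputLength ε ∧
    n + 1 ≤ 2 ^ I.inputLength ε ∧ (∀ i j, I.A i j ≤ 2 ^ I.inputLength ε) ∧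
    (∀ i, I.b i ≤ 2 ^ I.inputLength ε) ∧ (∀ j, I.c j ≤ 2 ^ I.inputLength ε) ∧
    (∀ j, I.u j ≤ 2 ^ I.inputLength ε) ∧ ε.den ≤ 2 ^ I.inputLength ε := by
  have key : ∀ k l : ℕ, k.size ≤ l → k ≤ 2 ^ l := fun k l h =>
    (Nat.lt_size_self k).le.trans (Nat.pow_le_pow_right (by norm_num) h)
  have key' : ∀ k l : ℕ, k ≤ l → k + 1 ≤ 2 ^ l := fun k l h =>
    Nat.lt_two_pow_self.trans_le (Nat.pow_le_pow_right (by norm_num) h)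
  refine ⟨key' _ _ ?_, key' _ _ ?_, fun i j => key _ _ ?_, fun i => key _ _ ?_, fun j => key _ _ ?_,
    fun j => key _ _ ?_, key _ _ ?_⟩
  · unfold inputLength; omega
  · unfold inputLength; omega
  · have h1 := single_le_sum (f := fun j => (I.A i j).size) (fun _ _ => Nat.zero_le _) (mem_univ j)
    have h2 := single_le_sum (f := fun i => ∑ j, (I.A i j).size) (fun _ _ => Nat.zero_le _)
      (mem_univ i)
    unfold inputLength; omega
  · have h1 := single_le_sum (f := fun j => (I.b j).size) (fun _ _ => Nat.zero_le _) (mem_univ i)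
    unfold inputLength; omega
  · have h1 := single_le_sum (f := fun j => (I.c j).size) (fun _ _ => Nat.zero_le _) (mem_univ j)
    unfold inputLength; omega
  · have h1 := single_le_sum (f := fun j => (I.u j).size) (fun _ _ => Nat.zero_le _) (mem_univ j)
    unfold inputLength; omega
  · unfold inputLength; omega

/-- For input length `s` all data are at most `2 ^ s`, the radix is at most `2 ^ (2 s)` and `m ≤ s`.
Hence numbers stay below `2 ^ (16 s + 2 s²)`, and a quadratic word length suffices. -/
theorem bound_data (hm : 1 ≤ m) (ε : ℚ) :
    I.data.Bound (100 * (I.inputLength ε + 1) ^ 2) (2 ^ I.inputLength ε) := by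
  obtain ⟨h1, h2, h3, h4, h5, h6, -⟩ := I.le_two_pow_inputLength ε
  have hms : m ≤ I.inputLength ε := by unfold inputLength; omega
  set s := I.inputLength ε with hs
  have hE : 2 ≤ 2 ^ s := by omega
  refine ⟨hE, hm, h1, h2, fun i hi j hj => ?_, fun j hj => ?_, fun j hj => ?_, ?_⟩
  · exact (I.data_a ⟨i, hi⟩ ⟨j, hj⟩).trans_le (h3 _ _)
  · exact (I.data_c ⟨j, hj⟩).trans_le (h5 _)
  · exact (I.data_u ⟨j, hj⟩).trans_le (h6 _)
  · have hr : I.data.radix ≤ 2 ^ (2 * s) := by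
      have : ∑ i ∈ range m, I.data.b i ≤ m * 2 ^ s := by
        refine (sum_le_card_nsmul _ _ (2 ^ s) fun i hi => ?_).trans (by simp)
        exact (I.data_b ⟨i, mem_range.mp hi⟩).trans_le (h4 _)
      have h7 : I.data.radix ≤ 1 + m * 2 ^ s := Nat.add_le_add_left this 1
      have h8 : (m + 1) * 2 ^ s ≤ 2 ^ s * 2 ^ s := Nat.mul_le_mul_right _ h1
      rw [two_mul, pow_add]
      nlinarith
    calc (2 ^ s) ^ 16 * I.data.radix ^ m
        ≤ (2 ^ s) ^ 16 * (2 ^ (2 * s)) ^ s := by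
          refine Nat.mul_le_mul_left _ ((Nat.pow_le_pow_left hr m).trans ?_)
          exact Nat.pow_le_pow_right (by positivity) hms
      _ = 2 ^ (s * 16 + 2 * s * s) := by rw [← pow_mul, ← pow_mul, ← pow_add]
      _ < 2 ^ (100 * (s + 1) ^ 2) := Nat.pow_lt_pow_right (by norm_num) (by nlinarith)



/-! ### Arithmetic of the cost bound. -/

theorem two_mul_sq_add_pow_le {m : ℕ} (hm : 1 ≤ m) :
    (2 * m ^ 2 + 2 * m + 1) ^ m ≤ 2 * (2 * m) ^ (2 * m) := by
  -- The factor `2` is needed only for `m = 1`, where `5 > 4`; from `m = 2` on, `2 m² + 2 m + 1 ≤ 4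
  -- m²`.
  rcases hm.eq_or_lt with rfl | h
  · norm_num
  · rw [pow_mul]
    have h1 : 2 * m ^ 2 + 2 * m + 1 ≤ (2 * m) ^ 2 := by nlinarith
    have := Nat.pow_le_pow_left h1 m
    omega

/-- Every monomial on the left is dominated by the product on the right, and the coefficients add up
to 867. -/
theorem total_cost_le {m n T X : ℕ} (K : ℕ) (hm : 1 ≤ m) (hT : 1 ≤ T) (hn : n ≤ T) (hX : 1 ≤ X) :
    m * 12 + n * (m * 60 + 50) + T + n * 38 + n * (K * 20 + 25) +
      n * K * (X * (m * 60 + 207) + 19) + X * (m * 30 + n * 16 + T + 80) +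
      (m * 30 + n * 30 + n * K * 47 + T + 60) + 80 ≤ 1000 * (T * X * (m + 1) * (K + 1)) := by
  set P := T * X * (m + 1) * (K + 1) with hP
  have key : ∀ a b c e : ℕ, a ≤ T → b ≤ X → c ≤ m + 1 → e ≤ K + 1 → a * b * c * e ≤ P :=
    fun a b c e ha hb hc he => by rw [hP]; gcongr
  have hm' := Nat.le_succ m
  have hK' := Nat.le_succ K
  have hm1 : 1 ≤ m + 1 := by omega
  have hK1 : 1 ≤ K + 1 := by omega
  have h1 := key 1 1 1 1 hT hX hm1 hK1
  have h2 := key 1 1 m 1 hT hX hm' hK1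
  have h3 := key n 1 1 1 hn hX hm1 hK1
  have h4 := key n 1 m 1 hn hX hm' hK1
  have h5 := key T 1 1 1 le_rfl hX hm1 hK1
  have h6 := key n 1 1 K hn hX hm1 hK'
  have h7 := key n X m K hn le_rfl hm' hK'
  have h8 := key n X 1 K hn le_rfl hm1 hK'
  have h9 := key 1 X m 1 hT le_rfl hm' hK1
  have h10 := key n X 1 1 hn le_rfl hm1 hK1
  have h11 := key T X 1 1 le_rfl le_rfl hm1 hK1
  have h12 := key 1 X 1 1 hT le_rfl hm1 hK1
  clear_value P
  linarith

/-- Since `1 / ε ≥ 1`, summands without `1 / ε` are absorbed: `2 K + 1` and `K + 1` are multiples of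
`1 / ε` up to polynomials in `m`. The `m`-th power yields `(2 m) ^ (2 m)`, and the remaining
polynomial is below `(2 m) ^ 6`. -/
theorem cost_bound {m K T D : ℕ} {ε : ℚ} (hm : 1 ≤ m) (hε0 : 0 < ε) (hε1 : ε < 1)
    (hK : (K : ℚ) ≤ m * (m + 1) * (1 / ε)) :
    ((T * ((2 * K + 1) ^ m * D) * (m + 1) * (K + 1) : ℕ) : ℚ) ≤
      2 * (T * (1 / ε) ^ (m + 3) * (2 * m : ℚ) ^ (2 * m + 6) * D) := by
  have he : 1 ≤ 1 / ε := by rw [le_div_iff₀ hε0]; linarith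
  set e := 1 / ε
  have hm' : (1 : ℚ) ≤ m := by exact_mod_cast hm
  have h1 : (2 * K + 1 : ℚ) ≤ (2 * m ^ 2 + 2 * m + 1) * e := by nlinarith
  have h2 : (K + 1 : ℚ) ≤ (m ^ 2 + m + 1) * e := by nlinarith
  have h3 : ((2 * m ^ 2 + 2 * m + 1 : ℚ)) ^ m ≤ 2 * (2 * m) ^ (2 * m) := by
    exact_mod_cast two_mul_sq_add_pow_le hm
  have h4 : (m + 1 : ℚ) * (m ^ 2 + m + 1) ≤ (2 * m) ^ 6 := by
    have h5 : (m : ℚ) ^ 3 ≤ m ^ 6 := pow_le_pow_right₀ hm' (by norm_num)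
    have h6 : (m : ℚ) ^ 2 ≤ m ^ 3 := pow_le_pow_right₀ hm' (by norm_num)
    have h7 : (m : ℚ) ≤ m ^ 2 := by nlinarith
    rw [mul_pow]
    linarith
  have h5 : e ^ (m + 1) ≤ e ^ (m + 3) := pow_le_pow_right₀ he (by omega)
  push_cast
  calc (T : ℚ) * ((2 * K + 1) ^ m * D) * (m + 1) * (K + 1)
      ≤ T * (((2 * m ^ 2 + 2 * m + 1) * e) ^ m * D) * (m + 1) * ((m ^ 2 + m + 1) * e) := by gcongr
    _ = T * ((2 * m ^ 2 + 2 * m + 1) ^ m * D) * ((m + 1) * (m ^ 2 + m + 1)) * e ^ (m + 1) := by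
        rw [mul_pow]; ring
    _ ≤ T * ((2 * (2 * m) ^ (2 * m)) * D) * (2 * m) ^ 6 * e ^ (m + 3) := by gcongr
    _ = 2 * (T * e ^ (m + 3) * (2 * m : ℚ) ^ (2 * m + 6) * D) := by ring

end Knapsack

end

/-! ### The main theorem. -/

theorem theorem1 :
    ∃ (prog : RAM.Prog) (K : ℕ) (p : Polynomial ℕ),
      ∀ (S : LPSolver) (m n : ℕ) (I : Knapsack m n) (D T : ℕ) (ε : ℚ),
        1 ≤ m → I.IsModular D → 0 < ε → ε < 1 →
        (∀ n' ≤ n, ∀ P : LP m n', P.EntriesLE I.maxEntry → S.cost P ≤ T) →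
        max 1 n ≤ T →
        ∃ (σ : RAM.State) (t : ℕ) (x : Fin n → ℕ),
          RAM.Exec S (p.eval (I.inputLength ε)) prog (RAM.State.init I ε) σ t ∧
          (t : ℚ) ≤ K * (T * (1 / ε) ^ (m + 3) * (2 * m : ℚ) ^ (2 * m + 6) * D) ∧
          σ.Outputs I x ∧
          I.Feasible x ∧
          ∀ y : Fin n → ℕ, I.Feasible y → (1 - ε) * (I.value y : ℚ) ≤ I.value x := by
  -- The constant is `1000` from `total_cost_le` times `2` from `cost_bound`; the polynomial is the
  -- word length of `bound_data`.
  refine ⟨RAM.knapsackP, 2000, 100 * (Polynomial.X + 1) ^ 2, ?_⟩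
  intro S m n I D T ε hm hD hε0 hε1 hS hT
  obtain ⟨hT1, hn⟩ := max_le_iff.mp hT
  have hB : (Polynomial.eval (I.inputLength ε) (100 * (Polynomial.X + 1) ^ 2)) =
      100 * (I.inputLength ε + 1) ^ 2 := by simp
  rw [hB]
  obtain ⟨-, -, -, hb, -, -, hr⟩ := I.le_two_pow_inputLength ε
  have hnum : 0 < ε.num := Rat.num_pos.mpr hε0
  have hεpr : ε = (ε.num.natAbs : ℚ) / ε.den := by
    rw [Nat.cast_natAbs, abs_of_pos hnum, Rat.num_div_den]
  have hden : (0 : ℚ) < ε.den := by exact_mod_cast ε.den_pos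
  have hp : 0 < ε.num.natAbs := by omega
  have hp' : (0 : ℚ) < ε.num.natAbs := by exact_mod_cast hp
  have hpr : ε.num.natAbs ≤ ε.den := by
    have h1 := hε1
    rw [hεpr, div_lt_one hden] at h1
    exact_mod_cast h1.le
  obtain ⟨K, hK⟩ : ∃ K, K = m * (m + 1) * ε.den / ε.num.natAbs := ⟨_, rfl⟩
  obtain ⟨σ, t, hex, ht, x, hx, hval, hpk, hxu, hopt⟩ := RAM.run_knapsackP (S := S) (TL := T) (K := K)
    (X := (2 * K + 1) ^ m * D) (I.bound_data hm ε)
    (fun i hi => (I.data_b ⟨i, hi⟩).trans_le (hb _)) (I.inp_init ε)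
    (fun j hj => I.init_arr_three ε hj) (ε := ε) (by simp [RAM.State.init]) hεpr hp hpr hr
    (I.init_arr (by norm_num) ε) (I.init_arr (by norm_num) ε) (I.init_arr (by norm_num) ε)
    (I.init_arr (by norm_num) ε) (fun bb uu hbb huu => hS n le_rfl _ (I.entriesLE_lp hbb huu)) hK
    (fun it l T cnt hd hk => I.cnt_le hD hd hk)
  have hX : 1 ≤ (2 * K + 1) ^ m * D := Nat.mul_pos (by positivity) hD.one_le
  refine ⟨σ, t, fun j => x j, hex, ?_, ⟨fun j => hx j j.2, by rw [hval, I.profit_data]⟩,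
    (I.feasible_iff x).mpr ⟨hpk, hxu⟩, fun y hy => ?_⟩
  · have h1 := ht.trans (Knapsack.total_cost_le K hm hT1 hn hX)
    have hKε : (K : ℚ) ≤ m * (m + 1) * (1 / ε) := by
      rw [hK]
      refine Nat.cast_div_le.trans_eq ?_
      push_cast
      nth_rw 3 [hεpr]
      field_simp
    have h2 := Knapsack.cost_bound (T := T) (D := D) hm hε0 hε1 hKε
    have h3 : (t : ℚ) ≤ ((1000 * (T * ((2 * K + 1) ^ m * D) * (m + 1) * (K + 1)) : ℕ) : ℚ) := by
      exact_mod_cast h1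
    rw [Nat.cast_mul] at h3
    push_cast at h2 h3 ⊢
    linarith
  · obtain ⟨z, rfl⟩ := Knapsack.exists_extend y
    obtain ⟨hz, hzu⟩ := (I.feasible_iff z).mp hy
    have := hopt z hz hzu
    rwa [I.profit_data, I.profit_data] at this
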